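/- **Setting.** Let $n,d\ge 1$, $\rho\ge 0$, $\varepsilon\in[0,1]$; $\|\cdot\|$ is the Euclidean norm on $\mathbb R^d$ and $\mathsf W_1$ the $1$-Wasserstein distance. For a Markov kernel $\kappa$ on $\mathbb R^d$ put $$\mathcal E_1(\kappa;\mu,\nu)=\Bigl[\iint\|x-y\|\,d\kappa_x(y)\,d\mu(x)-\mathsf W_1(\mu,\nu)\Bigr]_+ +\mathsf W_1(\kappa_\sharp\mu,\nu).$$ Let $\mu$ be a distribution on $\mathbb R^d$ with $\mathbb E_\mu[e^{\|X\|^2}]\le 2$ and $\nu$ a distribution on $[0,1]^d$. Let $X_1,\dots,X_n\sim\mu$ be i.i.d. and $Y_1,\dots,Y_n\sim\nu$ be i.i.d. One observes random points $\tilde X_1,\dots,\tilde X_n\in\mathbb R^d$ and $\tilde Y_1,\dots,\tilde Y_n\in[0,1]^d$, chosen by an adversary who may look at all the clean samples, such that for some index sets $I,J\subseteq\{1,\dots,n\}$ with $|I|,|J|\ge(1-\varepsilon)n$ one has $\frac1n\sum_{i\in I}\|\tilde X_i-X_i\|\le\rho$ and $\frac1n\sum_{i\in J}\|\tilde Y_i-Y_i\|\le\rho$.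 **Algorithm** (input: $S=(\tilde X_i)_i$, $T=(\tilde Y_j)_j$, $\rho$, $\varepsilon$; tuning parameters: an integer $m\ge1$ and a real $c>0$). Finite tuples are identified with their uniform distributions (with multiplicity), $\mathrm{proj}_S$ is the nearest-point projection onto $S$ (ties go to the smallest index), and $N^\sigma_x=\mathcal N(x,\sigma^2I_d)$. 1. Set $\tau=n^{-1/(d+2)}$ and $\sigma=3^{d/(d+2)}(nd)^{-1/(d+2)}+c\sqrt\rho$. 2. Independently of the data, draw independent $i_1,\dots,i_m$ uniform on $\{1,\dots,n\}$ and $Z_1,\dots,Z_m\sim\mathcal N(0,I_d)$; let $S'=(\mathrm{proj}_S(\tilde X_{i_k}+\sigma Z_k))_{k\le m}$. 3. Compute a kernel $\bar\kappa$ into the points of $T$ with $\bar\kappa_\sharp S'=T$ and $\frac1m\sum_{x\in S'}\int\|x-y\|\,d\bar\kappa_x(y)\le\mathsf W_1(S',T)+\tau$ (its values at points outside $S'$ may be any distributions on the points of $T$). 4. Return $\hat\kappa=\bar\kappa\circ\mathrm{proj}_S\circ N^\sigma$. **Theorem.** (i) *Risk.* There are an absolute constant $C$ and constants $K_d$ depending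 only on $d$ such that for all $m\ge n^{(d+4)/(d+2)}$ and all $c>0$, whatever kernel satisfying the requirement is selected in Step 3, $$\mathbb E\bigl[\mathcal E_1(\hat\kappa;\mu,\nu)\bigr]\le C\,\min\Bigl\{\sqrt d\,\varepsilon+\max(c,c^{-1})\sqrt d\,\rho^{1/2}+\rho+K_d\,n^{-1/(d+2)},\ \sqrt d\Bigr\}$$ (an outer expectation, should the selection in Step 3 not be measurable). In particular, $c=1$ gives the bound $\bigl(\sqrt d\,\varepsilon+\sqrt d\,\rho^{1/2}+\rho+O_d(n^{-1/(d+2)})\bigr)\wedge\sqrt d$ up to an absolute constant factor. (ii) *Computation.* Consider programs for a randomized real random access machine, in which operations on real numbers ($+,-,\times,/$, comparison, $\sqrt{\cdot}$, $\exp$, $\log$), additions, subtractions and comparisons of integers, memory accesses, and drawing a uniform number of $[0,1]$ or a standard Gaussian number each take one step. There are two programs (the same for all $n,d$ and all inputs), an absolute constant $K$, and a sequence $e_d\to0$ as $d\to\infty$, such that for all $m\ge 1$, $c>0$, $\rho\ge0$, $\varepsilon\in[0,1]$ and all points $\tilde X_i\in\mathbb R^d$, $\tilde Y_j\in[0,1]^d$,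 with $C_\infty=\max_{i,j}\|\tilde X_i-\tilde Y_j\|$: - the first program carries out Steps 1–3 in at most $K\bigl(d\,m\,n+(C_\infty+d)\,n^{2+e_d}\bigr)$ steps; for $m=\lceil n^{(d+4)/(d+2)}\rceil$ it takes at most $K(C_\infty+d)\,n^{2+e_d}$ steps; - started on the memory left by the first program and any $x\in\mathbb R^d$, with fresh randomness, the second program takes at most $K\,n\,d$ steps and returns a sample of $\hat\kappa_x$. -/

import Mathlib

open MeasureTheory ProbabilityTheory Filter Topology
open scoped ENNReal

namespace StochasticOT

noncomputable section

/-- `ℝᵈ` with the Euclidean norm. -/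
abbrev Pt (d : ℕ) : Type := EuclideanSpace ℝ (Fin d)

/-! ### Optimal transport and the transportation error (for `p = 1`) -/

/-- The couplings of two measures on `ℝᵈ`. -/
def IsCoupling {d : ℕ} (μ ν : Measure (Pt d)) (π : Measure (Pt d × Pt d)) : Prop :=
  π.map Prod.fst = μ ∧ π.map Prod.snd = ν

/-- The Wasserstein distance `W₁(μ, ν)`. -/
def W1 {d : ℕ} (μ ν : Measure (Pt d)) : ℝ≥0∞ :=
  ⨅ (π : Measure (Pt d × Pt d)) (_ : IsCoupling μ ν π), ∫⁻ z, edist z.1 z.2 ∂π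

/-- The cost `∬ ‖x - y‖ dκ_x(y) dμ(x)` of moving `μ` along the kernel `κ`. -/
def kernelCost {d : ℕ} (κ : Kernel (Pt d) (Pt d)) (μ : Measure (Pt d)) : ℝ≥0∞ :=
  ∫⁻ x, ∫⁻ y, edist x y ∂(κ x) ∂μ

/-- The transportation error `[cost - W₁(μ, ν)]₊ + W₁(κ_♯ μ, ν)`; subtraction in `ℝ≥0∞` is the
positive part of the difference. -/
def transportError {d : ℕ} (κ : Kernel (Pt d) (Pt d)) (μ ν : Measure (Pt d)) : ℝ≥0∞ :=
  (kernelCost κ μ - W1 μ ν) + W1 (μ.bind κ) ν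

/-! ### The statistical setting -/

/-- `1`-sub-Gaussian: `E exp(‖X‖²) ≤ 2`. -/
def IsOneSubGaussian {d : ℕ} (μ : Measure (Pt d)) : Prop :=
  ∫⁻ x, ENNReal.ofReal (Real.exp (‖x‖ ^ 2)) ∂μ ≤ 2

/-- The cube `[0,1]ᵈ`. -/
def unitCube (d : ℕ) : Set (Pt d) := {y | ∀ k, 0 ≤ y k ∧ y k ≤ 1}

/-- `x'` is a corruption of the sample `x`: outside a fraction `ε` of the points, which are
arbitrary, the average displacement (over the whole sample size) is at most `ρ`. -/
def IsCorruption {n d : ℕ} (ρ ε : ℝ) (x x' : Fin n → Pt d) : Prop :=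
  ∃ I : Finset (Fin n), (1 - ε) * n ≤ (I.card : ℝ) ∧ (1 / (n : ℝ)) * ∑ i ∈ I, ‖x' i - x i‖ ≤ ρ

/-- The empirical measure of a tuple (the uniform distribution, with multiplicity). -/
def empirical {n d : ℕ} (x : Fin n → Pt d) : Measure (Pt d) :=
  (n : ℝ≥0∞)⁻¹ • ∑ i, Measure.dirac (x i)

/-- The outer expectation, equal to the expectation `∫⁻ f` when `f` is measurable and never
smaller than it. It is used since a solver may select its output in a non-measurable way. -/
def outerExpectation {Ω : Type*} [MeasurableSpace Ω] (P : Measure Ω) (f : Ω → ℝ≥0∞) : ℝ≥0∞ :=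
  ⨅ (g : Ω → ℝ≥0∞) (_ : Measurable g) (_ : ∀ ω, f ω ≤ g ω), ∫⁻ ω, g ω ∂P

/-! ### Projection onto a finite point set and Gaussian convolution -/

/-- `i` is the first index of a point of `S` nearest to `z`. -/
def IsFirstNearest {n d : ℕ} (S : Fin n → Pt d) (z : Pt d) (i : Fin n) : Prop :=
  (∀ j, dist z (S i) ≤ dist z (S j)) ∧ ∀ j, j < i → dist z (S i) < dist z (S j)

open Classical in
/-- The nearest-point projection onto the points of `S`, ties going to the smallest index
(the sum has exactly one non-trivial term, see `proj_eq` and `exists_isFirstNearest`). -/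
def proj {n d : ℕ} (S : Fin n → Pt d) (z : Pt d) : Pt d :=
  ∑ i, if IsFirstNearest S z i then S i else 0

theorem IsFirstNearest.unique {n d : ℕ} {S : Fin n → Pt d} {z : Pt d} {i j : Fin n}
    (hi : IsFirstNearest S z i) (hj : IsFirstNearest S z j) : i = j := by
  rcases lt_trichotomy i j with h | h | h
  · exact absurd (hi.1 j) (not_le.mpr (hj.2 i h))
  · exact h
  · exact absurd (hj.1 i) (not_le.mpr (hi.2 j h))

theorem proj_eq {n d : ℕ} {S : Fin n → Pt d} {z : Pt d} {i : Fin n}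
    (hi : IsFirstNearest S z i) : proj S z = S i := by
  classical
  unfold proj
  rw [Finset.sum_eq_single i]
  · simp [hi]
  · intro j _ hj
    rw [if_neg]
    intro h
    exact hj (h.unique hi)
  · simp

theorem exists_isFirstNearest {n d : ℕ} (hn : 1 ≤ n) (S : Fin n → Pt d) (z : Pt d) :
    ∃ i, IsFirstNearest S z i := by
  classical
  have : Nonempty (Fin n) := ⟨⟨0, hn⟩⟩
  obtain ⟨i₀, hi₀⟩ := Finite.exists_min (fun i => dist z (S i))
  let A : Finset (Fin n) := Finset.univ.filter fun i => ∀ j, dist z (S i) ≤ dist z (S j)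
  have hA : A.Nonempty := ⟨i₀, by simpa [A] using hi₀⟩
  have hm : ∀ j, dist z (S (A.min' hA)) ≤ dist z (S j) := by
    simpa [A] using A.min'_mem hA
  refine ⟨A.min' hA, hm, ?_⟩
  intro j hj
  by_contra hcon
  have hjA : j ∈ A := by
    simp only [A, Finset.mem_filter, Finset.mem_univ, true_and]
    intro k
    exact (not_lt.mp hcon).trans (hm k)
  exact absurd (A.min'_le j hjA) (not_le.mpr hj)

theorem measurable_proj {n d : ℕ} (S : Fin n → Pt d) : Measurable (proj S) := by
  classical
  unfold proj
  refine Finset.measurable_sum _ fun i _ => Measurable.ite ?_ measurable_const measurable_const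
  have h : {z | IsFirstNearest S z i} =
      (⋂ j, {z | dist z (S i) ≤ dist z (S j)}) ∩
        ⋂ j, ⋂ (_ : j < i), {z | dist z (S i) < dist z (S j)} := by
    ext z
    simp [IsFirstNearest]
  rw [h]
  refine MeasurableSet.inter (MeasurableSet.iInter fun j => ?_)
    (MeasurableSet.iInter fun j => MeasurableSet.iInter fun _ => ?_)
  · exact measurableSet_le (by fun_prop) (by fun_prop)
  · exact measurableSet_lt (by fun_prop) (by fun_prop)

/-- The kernel `x ↦ N(x, σ² I)`: add `σ` times a standard Gaussian vector. -/
def gaussConv (d : ℕ) (σ : ℝ) : Kernel (Pt d) (Pt d) :=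
  (Kernel.id ×ₖ Kernel.const (Pt d) (stdGaussian (Pt d))).map fun z => z.1 + σ • z.2

/-! ### The algorithm -/

/-- The bandwidth `σ = 3^{d/(d+2)} (n d)^{-1/(d+2)} + c √ρ`. -/
def bandwidth (n d : ℕ) (ρ c : ℝ) : ℝ :=
  (3 : ℝ) ^ ((d : ℝ) / (d + 2)) * ((n : ℝ) * d) ^ (-(1 : ℝ) / (d + 2)) + c * √ρ

/-- The accuracy `τ = n^{-1/(d+2)}` of the optimal transport solve. -/
def accuracy (n d : ℕ) : ℝ := (n : ℝ) ^ (-(1 : ℝ) / (d + 2))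

/-- The number `m = ⌈n^{(d+4)/(d+2)}⌉` of rounded points. -/
def roundingSize (n d : ℕ) : ℕ := ⌈(n : ℝ) ^ (((d : ℝ) + 4) / (d + 2))⌉₊

/-- The randomness of the rounding step: `m` indices of source points and `m` vectors. -/
abbrev Seed (n d m : ℕ) : Type := (Fin m → Fin n) × (Fin m → Pt d)

/-- The indices are uniform, the vectors are standard Gaussian, and all of them are independent. -/
def seedLaw (n d m : ℕ) : Measure (Seed n d m) :=
  (Measure.pi fun _ => uniformOn (Set.univ : Set (Fin n))).prod
    (Measure.pi fun _ => stdGaussian (Pt d))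

/-- Randomized rounding: the points `proj_S (X'_i + σ Z_i)`. -/
def roundedPoints {n d m : ℕ} (S : Fin n → Pt d) (σ : ℝ) (s : Seed n d m) : Fin m → Pt d :=
  fun i => proj S (S (s.1 i) + σ • s.2 i)

/-- The requirement on the solver: a kernel into the points of `T` that transports the uniform
distribution on `S'` exactly onto that on `T`, at cost at most `W₁(S', T) + τ`. The values of the
kernel at points outside `S'` are unconstrained (but are distributions on the points of `T`). -/
structure IsApproxOTKernel {m n d : ℕ} (S' : Fin m → Pt d) (T : Fin n → Pt d) (τ : ℝ)
    (κ : Kernel (Pt d) (Pt d)) : Prop where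
  markov : IsMarkovKernel κ
  range : ∀ x, κ x (Set.range T)ᶜ = 0
  push : (empirical S').bind κ = empirical T
  cost : kernelCost κ (empirical S') ≤ W1 (empirical S') (empirical T) + ENNReal.ofReal τ

/-- The returned kernel `κ̄ ∘ proj_S ∘ N^σ`. -/
def outputKernel {n d : ℕ} (S : Fin n → Pt d) (σ : ℝ) (κbar : Kernel (Pt d) (Pt d)) :
    Kernel (Pt d) (Pt d) :=
  κbar ∘ₖ (Kernel.deterministic (proj S) (measurable_proj S) ∘ₖ gaussConv d σ)

/-! ### A randomized real random access machine with a step count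

Programs act on integer and real registers and on two-dimensional integer and real arrays (all
indexed by natural numbers). Real arithmetic, comparisons, `√`, `exp`, `log`, additions and
subtractions of integers, memory accesses, and the drawing of a uniform number of `[0,1]` or of a
standard Gaussian number take one step each. There is no conversion of real numbers to integers. -/

/-- The random source: uniform numbers and Gaussian numbers, consumed in their order. -/
abbrev Tape : Type := (ℕ → unitInterval) × (ℕ → ℝ)

/-- All numbers of the random source are independent. -/
def tapeLaw : Measure Tape :=
  (Measure.infinitePi fun _ : ℕ => (volume : Measure unitInterval)).prod
    (Measure.infinitePi fun _ : ℕ => gaussianReal 0 1)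

/-- The memory, with the numbers of uniform and of Gaussian draws made so far. -/
structure Store where
  natReg : ℕ → ℕ
  realReg : ℕ → ℝ
  natArr : ℕ → ℕ → ℕ → ℕ
  realArr : ℕ → ℕ → ℕ → ℝ
  unifPos : ℕ
  gaussPos : ℕ

/-- Integer expressions; `arr A i j` reads the entry `(i, j)` of the array `A`. -/
inductive NatExpr : Type
  | lit (k : ℕ)
  | reg (r : ℕ)
  | arr (A : ℕ) (i j : NatExpr)
  | add (a b : NatExpr)
  | sub (a b : NatExpr)

namespace NatExpr

/-- The value of an integer expression (subtraction is truncated). -/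
def eval (s : Store) : NatExpr → ℕ
  | lit k => k
  | reg r => s.natReg r
  | arr A i j => s.natArr A (i.eval s) (j.eval s)
  | add a b => a.eval s + b.eval s
  | sub a b => a.eval s - b.eval s

/-- The number of operations in an integer expression. -/
def cost : NatExpr → ℕ
  | lit _ => 1
  | reg _ => 1
  | arr _ i j => i.cost + j.cost + 1
  | add a b => a.cost + b.cost + 1
  | sub a b => a.cost + b.cost + 1

end NatExpr

/-- Real expressions. -/
inductive RealExpr : Type
  | lit (q : ℚ)
  | ofNat (a : NatExpr)
  | reg (r : ℕ)
  | arr (A : ℕ) (i j : NatExpr)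
  | add (a b : RealExpr)
  | sub (a b : RealExpr)
  | mul (a b : RealExpr)
  | div (a b : RealExpr)
  | sqrt (a : RealExpr)
  | exp (a : RealExpr)
  | log (a : RealExpr)

namespace RealExpr

/-- The value of a real expression. -/
def eval (s : Store) : RealExpr → ℝ
  | lit q => (q : ℝ)
  | ofNat a => (a.eval s : ℝ)
  | reg r => s.realReg r
  | arr A i j => s.realArr A (i.eval s) (j.eval s)
  | add a b => a.eval s + b.eval s
  | sub a b => a.eval s - b.eval s
  | mul a b => a.eval s * b.eval s
  | div a b => a.eval s / b.eval s
  | sqrt a => √(a.eval s)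
  | exp a => Real.exp (a.eval s)
  | log a => Real.log (a.eval s)

/-- The number of operations in a real expression. -/
def cost : RealExpr → ℕ
  | lit _ => 1
  | ofNat a => a.cost + 1
  | reg _ => 1
  | arr _ i j => i.cost + j.cost + 1
  | add a b => a.cost + b.cost + 1
  | sub a b => a.cost + b.cost + 1
  | mul a b => a.cost + b.cost + 1
  | div a b => a.cost + b.cost + 1
  | sqrt a => a.cost + 1
  | exp a => a.cost + 1
  | log a => a.cost + 1

end RealExpr

/-- Tests. -/
inductive BoolExpr : Type
  | natLt (a b : NatExpr)
  | realLt (a b : RealExpr)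
  | not (b : BoolExpr)
  | and (b c : BoolExpr)

namespace BoolExpr

/-- Whether a test succeeds. -/
def Holds (s : Store) : BoolExpr → Prop
  | natLt a b => a.eval s < b.eval s
  | realLt a b => a.eval s < b.eval s
  | not b => ¬ b.Holds s
  | and b c => b.Holds s ∧ c.Holds s

/-- The number of operations in a test. -/
def cost : BoolExpr → ℕ
  | natLt a b => a.cost + b.cost + 1
  | realLt a b => a.cost + b.cost + 1
  | not b => b.cost + 1
  | and b c => b.cost + c.cost + 1

end BoolExpr

/-- Programs. -/
inductive Prog : Type
  | skip
  | setNat (r : ℕ) (a : NatExpr)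
  | setReal (r : ℕ) (a : RealExpr)
  | setNatArr (A : ℕ) (i j a : NatExpr)
  | setRealArr (A : ℕ) (i j : NatExpr) (a : RealExpr)
  | drawUnif (r : ℕ)
  | drawGauss (r : ℕ)
  | seq (p q : Prog)
  | ite (b : BoolExpr) (p q : Prog)
  | loop (b : BoolExpr) (p : Prog)

/-- Change one entry of a two-dimensional array. -/
def updateEntry {α : Type} (f : ℕ → ℕ → ℕ → α) (A i j : ℕ) (v : α) : ℕ → ℕ → ℕ → α :=
  Function.update f A (Function.update (f A) i (Function.update (f A i) j v))

/-- `Exec w p s t s'`: with random source `w`, the program `p` started on the memory `s` halts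
after exactly `t` steps with memory `s'`. -/
inductive Exec (w : Tape) : Prog → Store → ℕ → Store → Prop
  | skip (s : Store) : Exec w .skip s 1 s
  | setNat (s : Store) (r : ℕ) (a : NatExpr) :
      Exec w (.setNat r a) s (a.cost + 1) { s with natReg := Function.update s.natReg r (a.eval s) }
  | setReal (s : Store) (r : ℕ) (a : RealExpr) :
      Exec w (.setReal r a) s (a.cost + 1)
        { s with realReg := Function.update s.realReg r (a.eval s) }
  | setNatArr (s : Store) (A : ℕ) (i j a : NatExpr) :
      Exec w (.setNatArr A i j a) s (i.cost + j.cost + a.cost + 1)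
        { s with natArr := updateEntry s.natArr A (i.eval s) (j.eval s) (a.eval s) }
  | setRealArr (s : Store) (A : ℕ) (i j : NatExpr) (a : RealExpr) :
      Exec w (.setRealArr A i j a) s (i.cost + j.cost + a.cost + 1)
        { s with realArr := updateEntry s.realArr A (i.eval s) (j.eval s) (a.eval s) }
  | drawUnif (s : Store) (r : ℕ) :
      Exec w (.drawUnif r) s 1
        { s with
          realReg := Function.update s.realReg r (w.1 s.unifPos : ℝ)
          unifPos := s.unifPos + 1 }
  | drawGauss (s : Store) (r : ℕ) :
      Exec w (.drawGauss r) s 1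
        { s with
          realReg := Function.update s.realReg r (w.2 s.gaussPos)
          gaussPos := s.gaussPos + 1 }
  | seq {p q : Prog} {s s' s'' : Store} {t t' : ℕ} :
      Exec w p s t s' → Exec w q s' t' s'' → Exec w (.seq p q) s (t + t') s''
  | iteTrue {b : BoolExpr} {p q : Prog} {s s' : Store} {t : ℕ} :
      b.Holds s → Exec w p s t s' → Exec w (.ite b p q) s (b.cost + t) s'
  | iteFalse {b : BoolExpr} {p q : Prog} {s s' : Store} {t : ℕ} :
      ¬ b.Holds s → Exec w q s t s' → Exec w (.ite b p q) s (b.cost + t) s'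
  | loopDone {b : BoolExpr} {p : Prog} {s : Store} :
      ¬ b.Holds s → Exec w (.loop b p) s b.cost s
  | loopStep {b : BoolExpr} {p : Prog} {s s' s'' : Store} {t t' : ℕ} :
      b.Holds s → Exec w p s t s' → Exec w (.loop b p) s' t' s'' →
        Exec w (.loop b p) s (b.cost + t + t') s''

/-- A row of real numbers as the content of an array row (zero beyond its length). -/
def pad {d : ℕ} (x : Pt d) (k : ℕ) : ℝ := if h : k < d then x ⟨k, h⟩ else 0

/-- A tuple of points as the content of an array (zero beyond its size). -/
def padArr {n d : ℕ} (x : Fin n → Pt d) (i k : ℕ) : ℝ := if h : i < n then pad (x ⟨i, h⟩) k else 0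

/-- The initial memory: the integers `n`, `d`, `m`, the real numbers `ρ`, `ε`, `c`, the source
points in the real array `0`, the target points in the real array `1`, and zeros elsewhere. -/
def inputStore {n d : ℕ} (m : ℕ) (ρ ε c : ℝ) (S T : Fin n → Pt d) : Store where
  natReg r := if r = 0 then n else if r = 1 then d else if r = 2 then m else 0
  realReg r := if r = 0 then ρ else if r = 1 then ε else if r = 2 then c else 0
  natArr _ _ _ := 0
  realArr A i k := if A = 0 then padArr S i k else if A = 1 then padArr T i k else 0
  unifPos := 0
  gaussPos := 0

/-- A query: the point `x` is written into row `0` of the real array `2` of a memory `s`, and a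
fresh random source is used. -/
def queryStore {d : ℕ} (s : Store) (x : Pt d) : Store :=
  { s with
    realArr := Function.update s.realArr 2 (Function.update (s.realArr 2) 0 (pad x))
    unifPos := 0
    gaussPos := 0 }

/-- The answer to a query: the first `d` entries of row `0` of the real array `3`. -/
def answer (d : ℕ) (s : Store) : Pt d := WithLp.toLp 2 fun k : Fin d => s.realArr 3 0 k

/-- On a memory `s`, the program `p` samples from `κ_x` for every query `x`, and takes at most `B`
steps on every random source. -/
def Samples {d : ℕ} (p : Prog) (s : Store) (κ : Kernel (Pt d) (Pt d)) (B : ℝ) : Prop :=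
  ∀ x : Pt d, ∃ out : Tape → Pt d, Measurable out ∧ tapeLaw.map out = κ x ∧
    ∀ w, ∃ (t : ℕ) (s' : Store), Exec w p (queryStore s x) t s' ∧ (t : ℝ) ≤ B ∧
      answer d s' = out w

/-- The largest distance between a source point and a target point. -/
def maxDist {n d : ℕ} (S T : Fin n → Pt d) : ℝ := ⨆ ij : Fin n × Fin n, ‖S ij.1 - T ij.2‖

end

end StochasticOT

open StochasticOT

/-!
**The risk bound.** All measures are compared through `Near δ α β`: `α ≤ β` up to an error of mass
`δ`. Three such errors occur. Adding Gaussian noise of standard deviation `σ` makes a displacement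
by `r` cost only `2 r / σ` (`near_gaussConv`), so the corruption changes the smoothed empirical
measure by `ε + 2 ρ / σ` (`near_of_isCorruption`). The smoothed empirical measure of a clean sample
differs from the smoothed population measure by `√((6 / σ) ^ d e ^ d / n)` in expectation
(`lintegral_smoothDev_le`): this is a second moment computation for the densities with respect to
one wide Gaussian measure, where the hypothesis on `𝔼 exp ‖X‖²` enters. The `m` rounded points
differ from their common law on the `n` points of `S` by `√(n / m)` (`lintegral_resampleDev_le`).

If `κbar` is nearly optimal between the rounded points and `T`, then `κbar` after rounding is nearly
optimal between `μ` and `ν`. Transport into the unit cube can be priced by the reduced cost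
`‖x - y‖ - ‖x‖ + √d`, which lies between `0` and `2 √d` although `μ` has unbounded support; hence a
change of the source measure by `δ` changes the cost by `O(√d δ)`. A coupling of `(μ, ν)` is carried
over to the rounded points and `T` (`lintegral_reducedCost_le`), optimality of `κbar` is used there,
and its output is carried back (`kernelCost_outputKernel_le`); the price of rounding is the length
`σ √d` of the noise. The marginal error is bounded in the same way, and
`transportError_outputKernel_le` collects
`O(σ √d + √d (δX + δY + δR)) + τ`. With the given `σ`, `τ`, `m` all terms are of the stated order
provided that `max c c⁻¹ √ρ ≤ 1`; otherwise the trivial bound `2 √d` is already good enough.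

**The computation.** `Runs w p s B Q` is total correctness of a program together with a step count;
its rules, one for each construct of the language, reduce a claim about a program to a claim about
its parts. A `for` loop has an invariant, and everything that a program does not mention is
unchanged (`Frame`).

The transport problem is solved by an auction. Let `η = τ / 2` be the price increment and
`B = ⌈√d / η⌉` the number of slots into which the mass `1 / n` of every target is divided. The units
of mass of the sources bid one after the other for a slot of the cheapest target, and a displaced
owner bids again. Invariants (`Auction.Valid`): every owner is content up to `η`, and prices stay
at most `η (B + 1)`, because the costs of one source vary by at most `√d ≤ η B` and an empty slot is
free. As every bid moves the pointer of a target, the number of steps is `O(n B²)`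
(`Auction.Valid.clock_le`), each of cost `O(n)`. At the end the units that do not fill a slot, of
total mass at most `1 / B`, are distributed by a product measure; only targets with price `0` still
have room, so that this wastes at most `√d / B ≤ η`. The prices give a dual potential, and
the plan is optimal up to `2 η = τ` (`Auction.Valid.isApproxOTKernel`). Since `η` is of order
`n ^ (-1 / (d + 2))`, the time is `O(d m n + d n ^ (2 + 2 / (d + 2)))`, so `e d = 2 / (d + 2)`.

The conditional laws of the plan remain in memory as an `n × n` matrix. A query perturbs the point,
finds the nearest source point, and inverts the distribution function of the corresponding row at a
uniform number; both take `O(n d)` steps (`samples_evaluateProg`).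
-/

namespace StochasticOT

/-! ### Domination of measures up to a small error, and couplings -/

/-- The measure `α` is dominated by `β` up to an error of mass at most `δ`. For probability
measures this says that their total variation distance is at most `δ`; the one-sided form passes
through kernels, images and sums without any computation. -/
def Near {E : Type*} [MeasurableSpace E] (δ : ℝ≥0∞) (α β : Measure E) : Prop :=
  ∃ ζ : Measure E, α ≤ β + ζ ∧ ζ Set.univ ≤ δ

section Near

variable {E F : Type*} [MeasurableSpace E] [MeasurableSpace F]

theorem Near.trans {δ δ' : ℝ≥0∞} {α β γ : Measure E} (h : Near δ α β) (h' : Near δ' β γ) :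
    Near (δ + δ') α γ := by
  obtain ⟨ζ, h1, h2⟩ := h
  obtain ⟨ζ', h3, h4⟩ := h'
  refine ⟨ζ + ζ', h1.trans ?_, ?_⟩
  · calc β + ζ ≤ (γ + ζ') + ζ := by gcongr
      _ = γ + (ζ + ζ') := by rw [add_assoc, add_comm ζ' ζ]
  · simpa using add_le_add h2 h4

theorem bind_mono {α β : Measure E} (h : α ≤ β) (κ : Kernel E F) : α.bind κ ≤ β.bind κ := by
  refine Measure.le_iff.2 fun s hs => ?_
  rw [Measure.bind_apply hs κ.aemeasurable, Measure.bind_apply hs κ.aemeasurable]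
  exact lintegral_mono' h le_rfl

theorem bind_add_measure (α β : Measure E) (κ : Kernel E F) :
    (α + β).bind κ = α.bind κ + β.bind κ := by
  refine Measure.ext fun s hs => ?_
  rw [Measure.add_apply, Measure.bind_apply hs κ.aemeasurable,
    Measure.bind_apply hs κ.aemeasurable, Measure.bind_apply hs κ.aemeasurable,
    lintegral_add_measure]

theorem bind_univ (α : Measure E) (κ : Kernel E F) [IsMarkovKernel κ] :
    α.bind κ Set.univ = α Set.univ := by
  rw [Measure.bind_apply MeasurableSet.univ κ.aemeasurable]
  simp

theorem Near.bind {δ : ℝ≥0∞} {α β : Measure E} (h : Near δ α β) (κ : Kernel E F)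
    [IsMarkovKernel κ] : Near δ (α.bind κ) (β.bind κ) := by
  obtain ⟨ζ, h1, h2⟩ := h
  refine ⟨ζ.bind κ, ?_, ?_⟩
  · rw [← bind_add_measure]
    exact bind_mono h1 κ
  · rwa [bind_univ]

theorem Near.map {δ : ℝ≥0∞} {α β : Measure E} (h : Near δ α β) {f : E → F}
    (hf : Measurable f) : Near δ (α.map f) (β.map f) := by
  obtain ⟨ζ, h1, h2⟩ := h
  refine ⟨ζ.map f, ?_, ?_⟩
  · rw [← Measure.map_add _ _ hf]
    exact Measure.map_mono h1 hf
  · rwa [Measure.map_apply hf MeasurableSet.univ, Set.preimage_univ]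

theorem Near.lintegral_le {δ : ℝ≥0∞} {α β : Measure E} (h : Near δ α β) {f : E → ℝ≥0∞}
    {c : ℝ≥0∞} (hf : ∀ x, f x ≤ c) : ∫⁻ x, f x ∂α ≤ ∫⁻ x, f x ∂β + c * δ := by
  obtain ⟨ζ, h1, h2⟩ := h
  calc ∫⁻ x, f x ∂α ≤ ∫⁻ x, f x ∂(β + ζ) := lintegral_mono' h1 le_rfl
    _ = ∫⁻ x, f x ∂β + ∫⁻ x, f x ∂ζ := lintegral_add_measure ..
    _ ≤ ∫⁻ x, f x ∂β + ∫⁻ _, c ∂ζ := by gcongr; exact hf _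
    _ ≤ _ := by
      rw [lintegral_const]
      gcongr

/-- The common part of two measures, in the form of a density of the dominating one. -/
theorem Near.exists_density {δ : ℝ≥0∞} {α β : Measure E} [IsFiniteMeasure α] [IsFiniteMeasure β]
    (h : Near δ α β) (hδ : δ ≠ ⊤) :
    ∃ g : E → ℝ≥0∞, Measurable g ∧ (∀ x, g x ≤ 1) ∧ β.withDensity g ≤ α ∧
      α Set.univ ≤ β.withDensity g Set.univ + δ := by
  obtain ⟨ζ, h1, h2⟩ := h
  have hζ : IsFiniteMeasure ζ := ⟨h2.trans_lt (lt_top_iff_ne_top.2 hδ)⟩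
  have hac : α ≪ β + ζ := Measure.absolutelyContinuous_of_le h1
  let g : E → ℝ≥0∞ := fun x => min (α.rnDeriv (β + ζ) x) 1
  have hg : Measurable g := (Measure.measurable_rnDeriv _ _).min measurable_const
  have hge : g =ᵐ[β + ζ] α.rnDeriv (β + ζ) := by
    filter_upwards [Measure.rnDeriv_le_one_of_le h1] with x hx
    exact min_eq_left hx
  have hα : α = β.withDensity g + ζ.withDensity g := by
    rw [← withDensity_add_measure, withDensity_congr_ae hge, Measure.withDensity_rnDeriv_eq _ _ hac]
  have hg1 : ∀ x, g x ≤ 1 := fun x => min_le_right _ _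
  refine ⟨g, hg, hg1, ?_, ?_⟩
  · conv_rhs => rw [hα]
    exact Measure.le_add_right le_rfl
  · conv_lhs => rw [hα]
    rw [Measure.add_apply]
    gcongr
    refine le_trans ?_ h2
    rw [withDensity_apply _ MeasurableSet.univ, Measure.restrict_univ]
    calc ∫⁻ x, g x ∂ζ ≤ ∫⁻ _, 1 ∂ζ := lintegral_mono hg1
      _ = _ := by simp

theorem withDensity_le_self {α : Measure E} {g : E → ℝ≥0∞} (hg : ∀ x, g x ≤ 1) :
    α.withDensity g ≤ α := by
  calc α.withDensity g ≤ α.withDensity 1 := withDensity_mono (ae_of_all _ hg)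
    _ = α := withDensity_one

/-- The common part has mass at least `1 - δ`, hence the rest of `β` has mass at most `δ`. -/
theorem Near.symm {δ : ℝ≥0∞} {α β : Measure E} [IsProbabilityMeasure α] [IsProbabilityMeasure β]
    (h : Near δ α β) : Near δ β α := by
  rcases eq_or_ne δ ⊤ with rfl | hδ
  · exact ⟨β, Measure.le_add_left le_rfl, le_top⟩
  obtain ⟨g, hg, hg1, h1, h2⟩ := h.exists_density hδ
  have hle : β.withDensity g ≤ β := withDensity_le_self hg1
  have : IsFiniteMeasure (β.withDensity g) := isFiniteMeasure_of_le β hle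
  refine ⟨β - β.withDensity g, ?_, ?_⟩
  · conv_lhs => rw [← Measure.sub_add_cancel_of_le hle]
    rw [add_comm]
    gcongr
  · rw [Measure.sub_apply MeasurableSet.univ hle]
    rw [measure_univ] at h2 ⊢
    exact tsub_le_iff_left.2 h2

theorem inv_smul_smul_of_univ {θ : Measure E} {r : ℝ≥0∞} (hθ : θ Set.univ = r) (hr : r ≠ ⊤) :
    r⁻¹ • (r • θ) = θ := by
  rcases eq_or_ne r 0 with h0 | h0
  · rw [h0] at hθ
    rw [Measure.measure_univ_eq_zero.1 hθ]
    simp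
  · rw [smul_smul, ENNReal.inv_mul_cancel h0 hr, one_smul]

/-- A coupling survives a small change of its first marginal, up to an error of the same mass. -/
theorem exists_coupling_of_near {δ : ℝ≥0∞} {α α' : Measure E} {β : Measure F}
    [IsProbabilityMeasure α] [IsProbabilityMeasure α'] [IsProbabilityMeasure β]
    (h : Near δ α' α) {π : Measure (E × F)} (h1 : π.map Prod.fst = α) (h2 : π.map Prod.snd = β) :
    ∃ π' ξ : Measure (E × F), π'.map Prod.fst = α' ∧ π'.map Prod.snd = β ∧ π' ≤ π + ξ ∧
      ξ Set.univ ≤ δ := by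
  rcases eq_or_ne δ ⊤ with rfl | hδ
  · exact ⟨α'.prod β, α'.prod β, by simp, by simp,
      Measure.le_add_left le_rfl, le_top⟩
  obtain ⟨g, hg, hg1, h3, h4⟩ := h.exists_density hδ
  set η := α.withDensity g with hη
  set π₁ := π.withDensity (g ∘ Prod.fst) with hπ₁
  have hle : π₁ ≤ π := withDensity_le_self fun x => hg1 _
  have hfst : π₁.map Prod.fst = η := by
    refine Measure.ext fun s hs => ?_
    rw [Measure.map_apply measurable_fst hs, withDensity_apply _ (measurable_fst hs),
      withDensity_apply _ hs, ← h1, Measure.restrict_map measurable_fst hs,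
      lintegral_map hg measurable_fst]
    rfl
  set β₁ := π₁.map Prod.snd with hβ₁
  have hβle : β₁ ≤ β := by
    rw [← h2]
    exact Measure.map_mono hle measurable_snd
  have : IsFiniteMeasure η := isFiniteMeasure_of_le α' h3
  have : IsFiniteMeasure β₁ := isFiniteMeasure_of_le β hβle
  have hmass : β₁ Set.univ = η Set.univ := by
    rw [← hfst, hβ₁, Measure.map_apply measurable_fst MeasurableSet.univ,
      Measure.map_apply measurable_snd MeasurableSet.univ]
    rfl
  set r := 1 - η Set.univ with hr
  have hr1 : (α' - η) Set.univ = r := by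
    rw [Measure.sub_apply MeasurableSet.univ h3, measure_univ]
  have hr2 : (β - β₁) Set.univ = r := by
    rw [Measure.sub_apply MeasurableSet.univ hβle, measure_univ, hmass]
  have hrtop : r ≠ ⊤ := ne_top_of_le_ne_top ENNReal.one_ne_top tsub_le_self
  refine ⟨π₁ + r⁻¹ • (α' - η).prod (β - β₁), r⁻¹ • (α' - η).prod (β - β₁), ?_, ?_, ?_, ?_⟩
  · rw [Measure.map_add _ _ measurable_fst, hfst, Measure.map_smul, Measure.map_fst_prod, hr2,
      inv_smul_smul_of_univ hr1 hrtop, add_comm, Measure.sub_add_cancel_of_le h3]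
  · rw [Measure.map_add _ _ measurable_snd, Measure.map_smul, Measure.map_snd_prod, hr1,
      inv_smul_smul_of_univ hr2 hrtop, add_comm, Measure.sub_add_cancel_of_le hβle]
  · gcongr
  · rw [Measure.smul_apply, Measure.prod_apply MeasurableSet.univ]
    simp only [Set.preimage_univ, lintegral_const, hr1, hr2, smul_eq_mul]
    rw [← mul_assoc]
    calc r⁻¹ * r * r ≤ 1 * r := by gcongr; exact ENNReal.inv_mul_le_one r
      _ ≤ δ := by
        rw [one_mul, hr]
        rw [measure_univ] at h4
        exact tsub_le_iff_left.2 h4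

/-- Two couplings with a common marginal are glued along it. -/
theorem exists_gluing {G : Type*} [MeasurableSpace G] [StandardBorelSpace G] [Nonempty G]
    {π : Measure (E × F)} [IsProbabilityMeasure π] {π' : Measure (F × G)} [IsProbabilityMeasure π']
    (h : π.map Prod.snd = π'.map Prod.fst) :
    ∃ θ : Measure ((E × F) × G), θ.map Prod.fst = π ∧ θ.map (fun p => (p.1.2, p.2)) = π' := by
  refine ⟨π ⊗ₘ π'.condKernel.comap Prod.snd measurable_snd, ?_, ?_⟩
  · exact Measure.fst_compProd ..
  · have hm : Measurable (fun p : (E × F) × G => (p.1.2, p.2)) := by fun_prop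
    conv_rhs => rw [← π'.disintegrate π'.condKernel, Measure.fst, ← h]
    refine Measure.ext_of_lintegral _ fun f hf => ?_
    rw [lintegral_map hf hm, Measure.lintegral_compProd (by fun_prop),
      Measure.lintegral_compProd hf, lintegral_map (by fun_prop) measurable_snd]
    rfl

end Near

variable {d : ℕ}

theorem W1_le {μ ν : Measure (Pt d)} {π : Measure (Pt d × Pt d)} (h : IsCoupling μ ν π) :
    W1 μ ν ≤ ∫⁻ z, edist z.1 z.2 ∂π :=
  iInf₂_le π h

theorem IsCoupling.isProbabilityMeasure {μ ν : Measure (Pt d)} [IsProbabilityMeasure μ]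
    {π : Measure (Pt d × Pt d)} (h : IsCoupling μ ν π) : IsProbabilityMeasure π := by
  have h1 := h.1
  refine ⟨?_⟩
  rw [← Set.preimage_univ (f := Prod.fst), ← Measure.map_apply measurable_fst MeasurableSet.univ,
    h1, measure_univ]

/-- The couplings are glued along `β`; no optimal coupling is needed. -/
theorem W1_triangle {α β γ : Measure (Pt d)} [IsProbabilityMeasure α] [IsProbabilityMeasure β] :
    W1 α γ ≤ W1 α β + W1 β γ := by
  unfold W1
  rw [ENNReal.iInf_add]
  refine le_iInf fun π => ?_
  rw [ENNReal.iInf_add]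
  refine le_iInf fun hπ => ?_
  rw [ENNReal.add_iInf]
  refine le_iInf fun π' => ?_
  rw [ENNReal.add_iInf]
  refine le_iInf fun hπ' => ?_
  have := hπ.isProbabilityMeasure
  have := hπ'.isProbabilityMeasure
  obtain ⟨θ, h1, h2⟩ := exists_gluing (hπ.2.trans hπ'.1.symm)
  have hc : IsCoupling α γ (θ.map fun p => (p.1.1, p.2)) := by
    constructor
    · rw [Measure.map_map measurable_fst (by fun_prop), ← hπ.1, ← h1,
        Measure.map_map measurable_fst measurable_fst]
      rfl
    · rw [Measure.map_map measurable_snd (by fun_prop), ← hπ'.2, ← h2,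
        Measure.map_map measurable_snd (by fun_prop)]
      rfl
  refine (W1_le hc).trans ?_
  rw [lintegral_map (by fun_prop) (by fun_prop), ← h1, ← h2,
    lintegral_map (by fun_prop) (by fun_prop), lintegral_map (by fun_prop) (by fun_prop),
    ← lintegral_add_left (by fun_prop)]
  exact lintegral_mono fun p => edist_triangle _ _ _

theorem W1_comm (μ ν : Measure (Pt d)) : W1 μ ν = W1 ν μ := by
  have key : ∀ μ ν : Measure (Pt d), W1 μ ν ≤ W1 ν μ := by
    intro μ ν
    refine le_iInf₂ fun π hπ => ?_
    have hc : IsCoupling μ ν (π.map Prod.swap) := by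
      constructor
      · rw [Measure.map_map measurable_fst measurable_swap, ← hπ.2]
        rfl
      · rw [Measure.map_map measurable_snd measurable_swap, ← hπ.1]
        rfl
    refine (W1_le hc).trans_eq ?_
    rw [lintegral_map (by fun_prop) measurable_swap]
    simp [edist_comm]
  exact le_antisymm (key μ ν) (key ν μ)

/-! ### Gaussian kernels -/

theorem lintegral_le_sqrt_lintegral_sq {Ω : Type*} [MeasurableSpace Ω] (P : Measure Ω)
    [IsProbabilityMeasure P] {f : Ω → ℝ≥0∞} (hf : AEMeasurable f P) :
    ∫⁻ ω, f ω ∂P ≤ (∫⁻ ω, f ω ^ 2 ∂P) ^ (1 / 2 : ℝ) := by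
  have h := ENNReal.lintegral_mul_le_Lp_mul_Lq P (p := 2) (q := 2)
    (Real.holderConjugate_iff.2 ⟨by norm_num, by norm_num⟩) hf (aemeasurable_const (b := 1))
  simpa using h

theorem lintegral_inner_sq_stdGaussian {d : ℕ} (u : Pt d) :
    ∫⁻ z, ENNReal.ofReal (inner ℝ u z ^ 2) ∂(stdGaussian (Pt d)) = ENNReal.ofReal (‖u‖ ^ 2) := by
  have h := variance_dual_stdGaussian (E := Pt d) (innerSL ℝ u)
  have h2 : MemLp (innerSL ℝ u) 2 (stdGaussian (Pt d)) := IsGaussian.memLp_dual _ _ _ (by simp)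
  rw [innerSL_apply_norm] at h
  rw [← h, h2.ofReal_variance_eq, evariance_eq_lintegral_ofReal,
    integral_strongDual_stdGaussian]
  simp

theorem lintegral_abs_inner_stdGaussian_le {d : ℕ} (u : Pt d) :
    ∫⁻ z, ENNReal.ofReal |inner ℝ u z| ∂(stdGaussian (Pt d)) ≤ ENNReal.ofReal ‖u‖ := by
  refine (lintegral_le_sqrt_lintegral_sq _ (by fun_prop)).trans ?_
  simp_rw [← ENNReal.ofReal_pow (abs_nonneg _), sq_abs]
  rw [lintegral_inner_sq_stdGaussian, ENNReal.ofReal_rpow_of_nonneg (by positivity) (by norm_num),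
    ← Real.sqrt_eq_rpow, Real.sqrt_sq (norm_nonneg _)]

theorem lintegral_norm_stdGaussian_le (d : ℕ) :
    ∫⁻ z, ENNReal.ofReal ‖z‖ ∂(stdGaussian (Pt d)) ≤ ENNReal.ofReal √d := by
  refine (lintegral_le_sqrt_lintegral_sq _ (by fun_prop)).trans ?_
  have h : ∀ z : Pt d, ENNReal.ofReal ‖z‖ ^ 2 =
      ∑ k, ENNReal.ofReal (inner ℝ (EuclideanSpace.single k (1 : ℝ)) z ^ 2) := by
    intro z
    rw [← ENNReal.ofReal_pow (norm_nonneg _), EuclideanSpace.real_norm_sq_eq,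
      ENNReal.ofReal_sum_of_nonneg fun _ _ => sq_nonneg _]
    simp [EuclideanSpace.inner_single_left]
  simp_rw [h]
  rw [lintegral_finsetSum _ (by fun_prop)]
  simp_rw [lintegral_inner_sq_stdGaussian]
  simp only [PiLp.norm_single, norm_one, one_pow, ENNReal.ofReal_one, Finset.sum_const,
    Finset.card_univ, Fintype.card_fin, nsmul_eq_mul, mul_one]
  rw [← ENNReal.ofReal_natCast, ENNReal.ofReal_rpow_of_nonneg (by positivity) (by norm_num),
    ← Real.sqrt_eq_rpow]

theorem gaussConv_apply (d : ℕ) (σ : ℝ) (x : Pt d) :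
    gaussConv d σ x = (stdGaussian (Pt d)).map fun z => x + σ • z := by
  rw [gaussConv, Kernel.map_apply _ (by fun_prop), Kernel.prod_apply, Kernel.id_apply,
    Kernel.const_apply, Measure.dirac_prod, Measure.map_map (by fun_prop) (by fun_prop)]
  rfl

instance isMarkovKernel_gaussConv (d : ℕ) (σ : ℝ) : IsMarkovKernel (gaussConv d σ) := by
  refine ⟨fun x => ?_⟩
  rw [gaussConv_apply]
  exact Measure.isProbabilityMeasure_map (by fun_prop)

theorem lintegral_edist_gaussConv_le (d : ℕ) {σ : ℝ} (hσ : 0 ≤ σ) (x : Pt d) :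
    ∫⁻ z, edist x z ∂(gaussConv d σ x) ≤ ENNReal.ofReal (σ * √d) := by
  rw [gaussConv_apply, lintegral_map (by fun_prop) (by fun_prop)]
  have h : ∀ z : Pt d, edist x (x + σ • z) = ENNReal.ofReal σ * ENNReal.ofReal ‖z‖ := by
    intro z
    rw [edist_dist, dist_self_add_right, norm_smul, Real.norm_of_nonneg hσ, ENNReal.ofReal_mul hσ]
  simp_rw [h]
  rw [lintegral_const_mul _ (by fun_prop), ENNReal.ofReal_mul hσ]
  gcongr
  exact lintegral_norm_stdGaussian_le d

theorem gaussianReal_eq_withDensity (a b : ℝ) {u v : NNReal} (hu : u ≠ 0) (hv : v ≠ 0) :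
    gaussianReal a v = (gaussianReal b u).withDensity fun z =>
      ENNReal.ofReal (√(u / v) * Real.exp ((z - b) ^ 2 / (2 * u) - (z - a) ^ 2 / (2 * v))) := by
  rw [gaussianReal_of_var_ne_zero _ hu, gaussianReal_of_var_ne_zero _ hv,
    ← withDensity_mul _ (measurable_gaussianPDF _ _) (by fun_prop)]
  congr 1
  ext z
  rw [Pi.mul_apply, gaussianPDF, gaussianPDF, ← ENNReal.ofReal_mul (gaussianPDFReal_nonneg _ _ _)]
  congr 1
  have hu' : (0 : ℝ) < u := by positivity
  have hv' : (0 : ℝ) < v := by positivity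
  rw [gaussianPDFReal, gaussianPDFReal, Real.sqrt_div hu'.le, Real.exp_sub,
    Real.sqrt_mul (by positivity), Real.sqrt_mul (by positivity : (0 : ℝ) ≤ 2 * Real.pi), neg_div,
    neg_div, Real.exp_neg, Real.exp_neg]
  have h1 : √(u : ℝ) ≠ 0 := by positivity
  have h2 : √(v : ℝ) ≠ 0 := by positivity
  field_simp

theorem pi_withDensity {ι : Type*} [Fintype ι] (θ : ι → Measure ℝ)
    [∀ i, IsProbabilityMeasure (θ i)] (g : ι → ℝ → ℝ≥0∞) (hg : ∀ i, Measurable (g i))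
    [∀ i, IsProbabilityMeasure ((θ i).withDensity (g i))] :
    Measure.pi (fun i => (θ i).withDensity (g i)) =
      (Measure.pi θ).withDensity fun z => ∏ i, g i (z i) := by
  refine (Measure.pi_eq (μ := fun i => (θ i).withDensity (g i)) fun s hs => ?_)
  rw [withDensity_apply _ (MeasurableSet.univ_pi hs), ← lintegral_indicator
    (MeasurableSet.univ_pi hs)]
  have h : ∀ z : ι → ℝ, (Set.univ.pi s).indicator (fun z => ∏ i, g i (z i)) z =
      ∏ i, (s i).indicator (g i) (z i) := by
    intro z
    by_cases hz : z ∈ Set.univ.pi s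
    · rw [Set.indicator_of_mem hz]
      exact Finset.prod_congr rfl fun i _ => (Set.indicator_of_mem (hz i trivial) _).symm
    · rw [Set.indicator_of_notMem hz]
      simp only [Set.mem_pi, Set.mem_univ, true_implies, not_forall] at hz
      obtain ⟨i, hi⟩ := hz
      exact (Finset.prod_eq_zero (Finset.mem_univ i) (Set.indicator_of_notMem hi _)).symm
  simp_rw [h]
  have hm : ∀ i, Measurable ((s i).indicator (g i)) := fun i => (hg i).indicator (hs i)
  have hind : iIndepFun (fun i (z : ι → ℝ) => (s i).indicator (g i) (z i)) (Measure.pi θ) :=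
    iIndepFun_pi (X := fun i => (s i).indicator (g i)) fun i => (hm i).aemeasurable
  rw [lintegral_prod_eq_prod_lintegral_of_indepFun Finset.univ _ hind
    fun i => (hm i).comp (measurable_pi_apply i)]
  refine Finset.prod_congr rfl fun i _ => ?_
  rw [withDensity_apply _ (hs i), ← lintegral_indicator (hs i),
    ← (measurePreserving_eval θ i).lintegral_comp (hm i)]

theorem gaussConv_eq_map_pi (d : ℕ) (σ : ℝ) (x : Pt d) :
    gaussConv d σ x = (Measure.pi fun k => gaussianReal (x k) (Real.toNNReal (σ ^ 2))).map
      (WithLp.toLp 2) := by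
  have h : ∀ k, gaussianReal (x k) (Real.toNNReal (σ ^ 2)) =
      (gaussianReal 0 1).map fun z => x k + σ * z := by
    intro k
    have : (fun z => x k + σ * z) = (fun z => x k + z) ∘ fun z => σ * z := rfl
    rw [this, ← Measure.map_map (by fun_prop) (by fun_prop), gaussianReal_map_const_mul,
      gaussianReal_map_const_add]
    congr 1
    · simp
    · ext
      simp [sq_nonneg]
  simp_rw [h]
  rw [← Measure.pi_map_pi (fun k => by fun_prop), gaussConv_apply, ← map_pi_eq_stdGaussian,
    Measure.map_map (by fun_prop) (by fun_prop), Measure.map_map (by fun_prop) (by fun_prop)]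
  rfl

/-- The density of one Gaussian measure with respect to another. -/
theorem gaussConv_eq_withDensity {d : ℕ} {σ s : ℝ} (hσ : 0 < σ) (hs : 0 < s) (x y : Pt d) :
    gaussConv d σ x = (gaussConv d s y).withDensity fun z => ENNReal.ofReal
      ((s / σ) ^ d * Real.exp (‖z - y‖ ^ 2 / (2 * s ^ 2) - ‖z - x‖ ^ 2 / (2 * σ ^ 2))) := by
  have hs' : Real.toNNReal (s ^ 2) ≠ 0 := by
    rw [Ne, Real.toNNReal_eq_zero, not_le]; positivity
  have hσ' : Real.toNNReal (σ ^ 2) ≠ 0 := by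
    rw [Ne, Real.toNNReal_eq_zero, not_le]; positivity
  have h1 := fun k => gaussianReal_eq_withDensity (x k) (y k) hs' hσ'
  rw [gaussConv_eq_map_pi, gaussConv_eq_map_pi]
  set θ := fun k => gaussianReal (y k) (Real.toNNReal (s ^ 2)) with hθ
  set g : Fin d → ℝ → ℝ≥0∞ := fun k z => ENNReal.ofReal (√((Real.toNNReal (s ^ 2) : ℝ) /
    Real.toNNReal (σ ^ 2)) * Real.exp ((z - y k) ^ 2 / (2 * Real.toNNReal (s ^ 2)) -
      (z - x k) ^ 2 / (2 * Real.toNNReal (σ ^ 2)))) with hg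
  have hp : ∀ k, IsProbabilityMeasure ((θ k).withDensity (g k)) := by
    intro k
    rw [hθ, hg]
    dsimp only
    rw [← h1 k]
    infer_instance
  have h2 : (Measure.pi fun k => gaussianReal (x k) (Real.toNNReal (σ ^ 2))) =
      (Measure.pi θ).withDensity fun z => ∏ k, g k (z k) := by
    rw [← pi_withDensity θ g (fun k => by fun_prop)]
    congr 1
    ext1 k
    exact h1 k
  rw [h2]
  refine Measure.ext fun t ht => ?_
  have hm : Measurable (WithLp.toLp 2 : (Fin d → ℝ) → Pt d) := by fun_prop
  rw [Measure.map_apply hm ht, withDensity_apply _ (hm ht), withDensity_apply _ ht,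
    Measure.restrict_map hm ht, lintegral_map (by fun_prop) hm]
  refine lintegral_congr fun z => ?_
  rw [hg]
  dsimp only
  rw [← ENNReal.ofReal_prod_of_nonneg fun k _ => by positivity]
  congr 1
  rw [Finset.prod_mul_distrib, Finset.prod_const, Finset.card_univ, Fintype.card_fin,
    ← Real.exp_sum, Finset.sum_sub_distrib, ← Finset.sum_div, ← Finset.sum_div,
    Real.coe_toNNReal _ (sq_nonneg _), Real.coe_toNNReal _ (sq_nonneg _), ← div_pow,
    Real.sqrt_sq (by positivity), EuclideanSpace.real_norm_sq_eq, EuclideanSpace.real_norm_sq_eq]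
  rfl

/-- Translating a Gaussian measure by `x - y` changes it by at most a multiple of `‖x - y‖ / σ`
in total variation, with a constant that does not depend on the dimension. -/
theorem near_gaussConv {d : ℕ} {σ : ℝ} (hσ : 0 < σ) (x y : Pt d) :
    Near (ENNReal.ofReal (2 * (‖x - y‖ / σ))) (gaussConv d σ x) (gaussConv d σ y) := by
  -- beyond distance `σ` the claim is trivial, as `N(x, σ²)` itself is an admissible error
  rcases le_or_gt 1 (‖x - y‖ / σ) with h1 | h1
  · refine ⟨gaussConv d σ x, Measure.le_add_left le_rfl, ?_⟩
    rw [measure_univ, ENNReal.one_le_ofReal]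
    linarith
  set u : Pt d := σ⁻¹ • (x - y) with hu
  have hun : ‖u‖ = ‖x - y‖ / σ := by
    rw [hu, norm_smul, norm_inv, Real.norm_of_nonneg hσ.le]; ring
  have hdens := gaussConv_eq_withDensity (d := d) hσ hσ y x
  set a : Pt d → ℝ := fun z => ‖z - y‖ ^ 2 / (2 * σ ^ 2) - ‖z - x‖ ^ 2 / (2 * σ ^ 2) with ha
  have ham : Measurable a := by fun_prop
  refine ⟨(gaussConv d σ x).withDensity fun z => ENNReal.ofReal (a z), ?_, ?_⟩
  · -- the density of `N(y, σ²)` is `exp (-a) ≥ 1 - a`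
    rw [hdens, ← withDensity_add_left (by fun_prop)]
    calc gaussConv d σ x = (gaussConv d σ x).withDensity 1 := withDensity_one.symm
      _ ≤ _ := withDensity_mono (ae_of_all _ fun z => ?_)
    rw [Pi.one_apply, Pi.add_apply, ← ENNReal.ofReal_one]
    have h3 : (σ / σ) ^ d * Real.exp (‖z - x‖ ^ 2 / (2 * σ ^ 2) - ‖z - y‖ ^ 2 / (2 * σ ^ 2)) =
        Real.exp (- a z) := by
      rw [div_self hσ.ne', one_pow, one_mul, ha]
      congr 1
      ring
    rw [h3]
    refine le_trans (ENNReal.ofReal_le_ofReal ?_) ENNReal.ofReal_add_le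
    have := Real.add_one_le_exp (- a z)
    linarith
  · -- under `N(x, σ²)`, the exponent `a` is normal with mean `‖u‖² / 2` and variance `‖u‖²`
    rw [withDensity_apply _ MeasurableSet.univ, Measure.restrict_univ, gaussConv_apply,
      lintegral_map (by fun_prop) (by fun_prop)]
    have h4 : ∀ z : Pt d, a (x + σ • z) = inner ℝ u z + ‖u‖ ^ 2 / 2 := by
      intro z
      have e1 : x + σ • z - y = σ • (z + u) := by
        rw [hu, smul_add, smul_smul, mul_inv_cancel₀ hσ.ne', one_smul]; abel
      have e2 : x + σ • z - x = σ • z := by abel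
      rw [ha]
      dsimp only
      rw [e1, e2, norm_smul, norm_smul, Real.norm_of_nonneg hσ.le, mul_pow, mul_pow,
        norm_add_sq_real, real_inner_comm]
      field_simp
      ring
    simp_rw [h4]
    calc ∫⁻ z, ENNReal.ofReal (inner ℝ u z + ‖u‖ ^ 2 / 2) ∂(stdGaussian (Pt d))
        ≤ ∫⁻ z, (ENNReal.ofReal |inner ℝ u z| + ENNReal.ofReal (‖u‖ ^ 2 / 2))
          ∂(stdGaussian (Pt d)) := by
          refine lintegral_mono fun z => ?_
          refine le_trans (ENNReal.ofReal_le_ofReal ?_) ENNReal.ofReal_add_le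
          gcongr
          exact le_abs_self _
      _ = ∫⁻ z, ENNReal.ofReal |inner ℝ u z| ∂(stdGaussian (Pt d)) +
          ENNReal.ofReal (‖u‖ ^ 2 / 2) := by
          rw [lintegral_add_right _ measurable_const]
          simp
      _ ≤ ENNReal.ofReal ‖u‖ + ENNReal.ofReal (‖u‖ ^ 2 / 2) := by
          gcongr
          exact lintegral_abs_inner_stdGaussian_le u
      _ = ENNReal.ofReal (‖u‖ + ‖u‖ ^ 2 / 2) :=
          (ENNReal.ofReal_add (norm_nonneg _) (by positivity)).symm
      _ ≤ _ := by
          rw [← hun] at h1 ⊢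
          refine ENNReal.ofReal_le_ofReal ?_
          nlinarith [norm_nonneg u]

/-! ### Deviation of empirical averages -/

section Deviation

variable {Ω 𝒰 𝒵 : Type*} [MeasurableSpace Ω] [MeasurableSpace 𝒰] [MeasurableSpace 𝒵]
  {P : Measure Ω} [IsProbabilityMeasure P] {n : ℕ} {U : Fin n → Ω → 𝒰} {lam : Measure 𝒰}

theorem lintegral_sq_average_sub_le (hn : 1 ≤ n) (hU : ∀ i, Measurable (U i))
    (hind : iIndepFun U P) (hlaw : ∀ i, P.map (U i) = lam) {f : 𝒰 → ℝ} (hf : Measurable f) :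
    ∫⁻ ω, ENNReal.ofReal (((n : ℝ)⁻¹ * ∑ i, f (U i ω) - ∫ u, f u ∂lam) ^ 2) ∂P ≤
      (∫⁻ u, ENNReal.ofReal (f u ^ 2) ∂lam) / n := by
  have hn0 : (n : ℝ) ≠ 0 := by positivity
  rcases eq_or_ne (∫⁻ u, ENNReal.ofReal (f u ^ 2) ∂lam) ⊤ with htop | htop
  · rw [htop, ENNReal.top_div_of_ne_top (ENNReal.natCast_ne_top n)]
    exact le_top
  have hlamp : IsProbabilityMeasure lam := by
    rw [← hlaw ⟨0, hn⟩]
    exact Measure.isProbabilityMeasure_map (hU _).aemeasurable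
  have hint : Integrable (fun u => f u ^ 2) lam := by
    refine ⟨by fun_prop, ?_⟩
    rw [hasFiniteIntegral_iff_ofReal (ae_of_all _ fun u => sq_nonneg _)]
    exact lt_top_iff_ne_top.2 htop
  have hL2 : MemLp f 2 lam := (memLp_two_iff_integrable_sq hf.aestronglyMeasurable).2 hint
  set X : Fin n → Ω → ℝ := fun i ω => f (U i ω) with hX
  have hXm : ∀ i, MemLp (X i) 2 P := by
    intro i
    have : MemLp f 2 (P.map (U i)) := by rw [hlaw i]; exact hL2
    exact this.comp_of_map (hU i).aemeasurable
  have hXi : iIndepFun X P := hind.comp (fun _ => f) fun _ => hf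
  have hE : ∀ i, ∫ ω, X i ω ∂P = ∫ u, f u ∂lam := by
    intro i
    rw [← hlaw i, integral_map (hU i).aemeasurable hf.aestronglyMeasurable]
  have hE2 : ∀ i, ∫ ω, X i ω ^ 2 ∂P = ∫ u, f u ^ 2 ∂lam := by
    intro i
    rw [← hlaw i, integral_map (hU i).aemeasurable (by fun_prop)]
  have hS : MemLp (fun ω => (n : ℝ)⁻¹ * (∑ i, X i) ω) 2 P :=
    (memLp_finsetSum' _ fun i _ => hXm i).const_mul _
  have hmean : ∫ ω, (n : ℝ)⁻¹ * (∑ i, X i) ω ∂P = ∫ u, f u ∂lam := by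
    rw [integral_const_mul]
    simp only [Finset.sum_apply]
    rw [integral_finsetSum _ fun i _ => (hXm i).integrable (by norm_num)]
    simp_rw [hE]
    simp [hn0]
  have hvar : Var[fun ω => (n : ℝ)⁻¹ * (∑ i, X i) ω; P] ≤ (∫ u, f u ^ 2 ∂lam) / n := by
    rw [variance_const_mul, IndepFun.variance_sum (fun i _ => hXm i)
      fun i _ j _ hij => hXi.indepFun hij]
    calc (n : ℝ)⁻¹ ^ 2 * ∑ i, Var[X i; P] ≤ (n : ℝ)⁻¹ ^ 2 * ∑ _i : Fin n, ∫ u, f u ^ 2 ∂lam := by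
          gcongr with i
          rw [← hE2 i]
          exact variance_le_expectation_sq (hXm i).aestronglyMeasurable
      _ = _ := by
          simp only [Finset.sum_const, Finset.card_univ, Fintype.card_fin, nsmul_eq_mul]
          field_simp
  have h := hS.ofReal_variance_eq
  rw [evariance_eq_lintegral_ofReal, hmean] at h
  simp only [Finset.sum_apply] at h
  rw [← h, ← ofReal_integral_eq_lintegral_ofReal hint (ae_of_all _ fun u => sq_nonneg _),
    ← ENNReal.ofReal_natCast, ← ENNReal.ofReal_div_of_pos (by positivity)]
  refine ENNReal.ofReal_le_ofReal ?_
  simpa only [Finset.sum_apply] using hvar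

theorem measurable_average_sub (lam : Measure 𝒰) [IsProbabilityMeasure lam] {h : 𝒰 → 𝒵 → ℝ}
    (hh : Measurable (Function.uncurry h)) :
    Measurable fun p : (Fin n → 𝒰) × 𝒵 =>
      (n : ℝ)⁻¹ * ∑ i, h (p.1 i) p.2 - ∫ u, h u p.2 ∂lam := by
  have hmi : Measurable fun z => ∫ u, h u z ∂lam := by
    have : StronglyMeasurable fun z => ∫ u, h u z ∂lam :=
      (hh.comp measurable_swap).stronglyMeasurable.integral_prod_right' (ν := lam)
        (f := fun p : 𝒵 × 𝒰 => h p.2 p.1)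
    exact this.measurable
  have hmh : ∀ i, Measurable fun p : (Fin n → 𝒰) × 𝒵 => h (p.1 i) p.2 := by
    intro i
    have e : Measurable fun p : (Fin n → 𝒰) × 𝒵 => (p.1 i, p.2) := by fun_prop
    exact hh.comp e
  exact Measurable.sub (Measurable.const_mul (Finset.measurable_sum _ fun i _ => hmh i) _)
    (hmi.comp measurable_snd)

theorem measurable_lintegral_abs_average_sub (lam : Measure 𝒰) [IsProbabilityMeasure lam]
    (θ : Measure 𝒵) [IsProbabilityMeasure θ] {h : 𝒰 → 𝒵 → ℝ}
    (hh : Measurable (Function.uncurry h)) :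
    Measurable fun x : Fin n → 𝒰 =>
      ∫⁻ z, ENNReal.ofReal |(n : ℝ)⁻¹ * ∑ i, h (x i) z - ∫ u, h u z ∂lam| ∂θ := by
  have hm := (continuous_abs.measurable.comp
    (measurable_average_sub (n := n) lam hh)).ennreal_ofReal
  exact hm.lintegral_prod_right'

/-- The mean `L¹(θ)` distance between the average of `h (U i) ·` and its expectation, in terms of
the second moment of `h`: Jensen's inequality, and the variance of a sum of independent terms. -/
theorem lintegral_abs_average_sub_le (hn : 1 ≤ n) (hU : ∀ i, Measurable (U i))
    (hind : iIndepFun U P) (hlaw : ∀ i, P.map (U i) = lam) (θ : Measure 𝒵)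
    [IsProbabilityMeasure θ] {h : 𝒰 → 𝒵 → ℝ} (hh : Measurable (Function.uncurry h)) {V : ℝ≥0∞}
    (hV : ∫⁻ u, ∫⁻ z, ENNReal.ofReal (h u z ^ 2) ∂θ ∂lam ≤ V) :
    ∫⁻ ω, ∫⁻ z, ENNReal.ofReal |(n : ℝ)⁻¹ * ∑ i, h (U i ω) z - ∫ u, h u z ∂lam| ∂θ ∂P ≤
      (V / n) ^ (1 / 2 : ℝ) := by
  have hlamp : IsProbabilityMeasure lam := by
    rw [← hlaw ⟨0, hn⟩]
    exact Measure.isProbabilityMeasure_map (hU _).aemeasurable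
  have hm := measurable_average_sub (n := n) lam hh
  have hm : Measurable fun p : Ω × 𝒵 =>
      (n : ℝ)⁻¹ * ∑ i, h (U i p.1) p.2 - ∫ u, h u p.2 ∂lam :=
    hm.comp ((measurable_pi_lambda (fun ω i => U i ω) hU).prodMap measurable_id)
  have hma : Measurable fun p : Ω × 𝒵 =>
      ENNReal.ofReal |(n : ℝ)⁻¹ * ∑ i, h (U i p.1) p.2 - ∫ u, h u p.2 ∂lam| :=
    (continuous_abs.measurable.comp hm).ennreal_ofReal
  have hms : Measurable fun p : Ω × 𝒵 =>
      ENNReal.ofReal (((n : ℝ)⁻¹ * ∑ i, h (U i p.1) p.2 - ∫ u, h u p.2 ∂lam) ^ 2) :=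
    (hm.pow_const 2).ennreal_ofReal
  rw [← lintegral_prod (fun p : Ω × 𝒵 =>
    ENNReal.ofReal |(n : ℝ)⁻¹ * ∑ i, h (U i p.1) p.2 - ∫ u, h u p.2 ∂lam|) hma.aemeasurable]
  refine (lintegral_le_sqrt_lintegral_sq _ hma.aemeasurable).trans ?_
  gcongr
  simp_rw [← ENNReal.ofReal_pow (abs_nonneg _), sq_abs]
  rw [lintegral_prod_symm _ hms.aemeasurable]
  calc ∫⁻ z, ∫⁻ ω, ENNReal.ofReal
        (((n : ℝ)⁻¹ * ∑ i, h (U i ω) z - ∫ u, h u z ∂lam) ^ 2) ∂P ∂θ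
      ≤ ∫⁻ z, (∫⁻ u, ENNReal.ofReal (h u z ^ 2) ∂lam) / n ∂θ := by
        refine lintegral_mono fun z => ?_
        exact lintegral_sq_average_sub_le hn hU hind hlaw (f := fun u => h u z)
          (hh.comp measurable_prodMk_right)
    _ = (∫⁻ z, ∫⁻ u, ENNReal.ofReal (h u z ^ 2) ∂lam ∂θ) / n := by
        simp_rw [div_eq_mul_inv]
        rw [lintegral_mul_const']
        simpa using Nat.one_le_iff_ne_zero.1 hn
    _ ≤ V / n := by
        rw [lintegral_lintegral_swap]
        · gcongr
        · exact ((hh.comp measurable_swap).pow_const 2).ennreal_ofReal.aemeasurable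

end Deviation

/-! ### Smoothed empirical measures -/

theorem lintegral_empirical {n d : ℕ} (x : Fin n → Pt d) (f : Pt d → ℝ≥0∞) :
    ∫⁻ y, f y ∂(empirical x) = (n : ℝ≥0∞)⁻¹ * ∑ i, f (x i) := by
  rw [empirical, lintegral_smul_measure, lintegral_finsetSum_measure, smul_eq_mul]
  simp_rw [lintegral_dirac]

theorem isProbabilityMeasure_empirical {n d : ℕ} (hn : 1 ≤ n) (x : Fin n → Pt d) :
    IsProbabilityMeasure (empirical x) := by
  refine ⟨?_⟩
  have h := lintegral_empirical x fun _ => 1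
  have hn0 : (n : ℝ≥0∞) ≠ 0 := by
    simpa using Nat.one_le_iff_ne_zero.1 hn
  rw [lintegral_one] at h
  rw [h]
  simp [ENNReal.inv_mul_cancel hn0]

theorem empirical_bind {n d : ℕ} {F : Type*} [MeasurableSpace F] (x : Fin n → Pt d)
    (κ : Kernel (Pt d) F) : (empirical x).bind κ = (n : ℝ≥0∞)⁻¹ • ∑ i, κ (x i) := by
  refine Measure.ext fun s hs => ?_
  rw [Measure.bind_apply hs κ.aemeasurable, lintegral_empirical]
  simp

theorem ae_empirical {n d : ℕ} {x : Fin n → Pt d} {A : Set (Pt d)} (hA : MeasurableSet A)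
    (h : ∀ i, x i ∈ A) : ∀ᵐ y ∂(empirical x), y ∈ A := by
  rw [ae_iff]
  have : {a | a ∉ A} = Aᶜ := rfl
  rw [this, empirical]
  simp [Measure.dirac_apply' _ hA.compl, h]

theorem bind_withDensity {E F : Type*} [MeasurableSpace E] [MeasurableSpace F] {θ : Measure F}
    [SFinite θ] {α : Measure E} [SFinite α] {κ : Kernel E F} {h : E → F → ℝ≥0∞}
    (hh : Measurable (Function.uncurry h)) (hκ : ∀ x, κ x = θ.withDensity (h x)) :
    α.bind κ = θ.withDensity fun z => ∫⁻ x, h x z ∂α := by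
  refine Measure.ext fun s hs => ?_
  rw [Measure.bind_apply hs κ.aemeasurable, withDensity_apply _ hs]
  simp_rw [hκ, withDensity_apply _ hs]
  exact lintegral_lintegral_swap hh.aemeasurable

/-- The density of `N(x, σ²)` with respect to `N(0, s²)`. -/
noncomputable def relDensity (d : ℕ) (σ s : ℝ) (x z : Pt d) : ℝ :=
  (s / σ) ^ d * Real.exp (‖z - 0‖ ^ 2 / (2 * s ^ 2) - ‖z - x‖ ^ 2 / (2 * σ ^ 2))

theorem measurable_relDensity (d : ℕ) (σ s : ℝ) :
    Measurable (Function.uncurry (relDensity d σ s)) := by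
  unfold Function.uncurry relDensity
  fun_prop

theorem relDensity_nonneg {d : ℕ} {σ s : ℝ} (hσ : 0 < σ) (hs : 0 < s) (x z : Pt d) :
    0 ≤ relDensity d σ s x z := by
  unfold relDensity; positivity

theorem integrable_relDensity {d : ℕ} {σ s : ℝ} (hσ : 0 < σ) (hs : 0 < s) (μ : Measure (Pt d))
    [IsFiniteMeasure μ] (z : Pt d) : Integrable (fun x => relDensity d σ s x z) μ := by
  refine Integrable.of_bound (C := (s / σ) ^ d * Real.exp (‖z - 0‖ ^ 2 / (2 * s ^ 2)))
    ((measurable_relDensity d σ s).comp measurable_prodMk_right).aestronglyMeasurable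
    (ae_of_all _ fun x => ?_)
  rw [Real.norm_of_nonneg (relDensity_nonneg hσ hs _ _), relDensity]
  gcongr
  have : 0 ≤ ‖z - x‖ ^ 2 / (2 * σ ^ 2) := by positivity
  linarith

/-- The distance between the smoothed empirical measure of the points `x` and the smoothed
measure `μ`, as the `L¹` distance of their densities. -/
noncomputable def smoothDev {n d : ℕ} (μ : Measure (Pt d)) (σ s : ℝ) (x : Fin n → Pt d) : ℝ≥0∞ :=
  ∫⁻ z, ENNReal.ofReal |(n : ℝ)⁻¹ * ∑ i, relDensity d σ s (x i) z -
    ∫ u, relDensity d σ s u z ∂μ| ∂(gaussConv d s 0)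

theorem measurable_smoothDev {n d : ℕ} (μ : Measure (Pt d)) [IsProbabilityMeasure μ] (σ s : ℝ) :
    Measurable (smoothDev μ σ s : (Fin n → Pt d) → ℝ≥0∞) :=
   measurable_lintegral_abs_average_sub μ _ (measurable_relDensity d σ s)

/-- An inequality of densities: `f ≤ g + |f - g|`. -/
theorem near_smoothDev {n d : ℕ} (hn : 1 ≤ n) {μ : Measure (Pt d)} [IsProbabilityMeasure μ]
    {σ s : ℝ} (hσ : 0 < σ) (hs : 0 < s) (x : Fin n → Pt d) :
    Near (smoothDev μ σ s x) ((empirical x).bind (gaussConv d σ)) (μ.bind (gaussConv d σ)) := by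
  have hκ : ∀ u : Pt d, gaussConv d σ u =
      (gaussConv d s 0).withDensity fun z => ENNReal.ofReal (relDensity d σ s u z) :=
    fun u => gaussConv_eq_withDensity hσ hs u 0
  have hm : Measurable (Function.uncurry fun u z => ENNReal.ofReal (relDensity d σ s u z)) :=
    (measurable_relDensity d σ s).ennreal_ofReal
  have := isProbabilityMeasure_empirical hn x
  rw [bind_withDensity hm hκ, bind_withDensity hm hκ]
  set k : Pt d → ℝ≥0∞ := fun z => ENNReal.ofReal
    |(n : ℝ)⁻¹ * ∑ i, relDensity d σ s (x i) z - ∫ u, relDensity d σ s u z ∂μ| with hk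
  refine ⟨(gaussConv d s 0).withDensity k, ?_, ?_⟩
  · rw [← withDensity_add_left]
    · refine withDensity_mono (ae_of_all _ fun z => ?_)
      rw [Pi.add_apply]
      dsimp only
      rw [lintegral_empirical, ← ofReal_integral_eq_lintegral_ofReal
        (integrable_relDensity hσ hs μ z) (ae_of_all _ fun u => relDensity_nonneg hσ hs u z),
        ← ENNReal.ofReal_sum_of_nonneg fun i _ => relDensity_nonneg hσ hs _ _,
        ← ENNReal.ofReal_natCast, ← ENNReal.ofReal_inv_of_pos (by positivity),
        ← ENNReal.ofReal_mul (by positivity)]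
      refine le_trans (ENNReal.ofReal_le_ofReal ?_) ENNReal.ofReal_add_le
      have := le_abs_self ((n : ℝ)⁻¹ * ∑ i, relDensity d σ s (x i) z -
        ∫ u, relDensity d σ s u z ∂μ)
      linarith
    · exact hm.lintegral_prod_left
  · rw [withDensity_apply _ MeasurableSet.univ, Measure.restrict_univ]
    exact le_rfl

/-- The reference Gaussian `N(0, s²)` is wide enough (`2 σ² ≤ s²`) for the density to be bounded by
the right-hand side, and its integral is `1`. -/
theorem lintegral_relDensity_sq_le {d : ℕ} {σ s : ℝ} (hσ : 0 < σ) (hs1 : 1 ≤ s)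
    (hs2 : 2 * σ ^ 2 ≤ s ^ 2) (x : Pt d) :
    ∫⁻ z, ENNReal.ofReal (relDensity d σ s x z ^ 2) ∂(gaussConv d s 0) ≤
      ENNReal.ofReal ((s / σ) ^ d) * ENNReal.ofReal (Real.exp (‖x‖ ^ 2)) := by
  have hs : 0 < s := by linarith
  have hb : ∀ z, relDensity d σ s x z ≤ (s / σ) ^ d * Real.exp (‖x‖ ^ 2) := by
    intro z
    rw [relDensity]
    gcongr
    rw [sub_zero]
    have h1 : ‖z‖ ^ 2 ≤ 2 * ‖z - x‖ ^ 2 + 2 * ‖x‖ ^ 2 := by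
      have h0 : ‖z‖ ≤ ‖z - x‖ + ‖x‖ := by simpa using norm_add_le (z - x) x
      nlinarith [norm_nonneg z, sq_nonneg (‖z - x‖ - ‖x‖)]
    have h2 : ‖z‖ ^ 2 / (2 * s ^ 2) ≤ (2 * ‖z - x‖ ^ 2 + 2 * ‖x‖ ^ 2) / (2 * s ^ 2) := by gcongr
    have h3 : (2 * ‖z - x‖ ^ 2 + 2 * ‖x‖ ^ 2) / (2 * s ^ 2) =
        ‖z - x‖ ^ 2 / s ^ 2 + ‖x‖ ^ 2 / s ^ 2 := by field_simp
    have h4 : ‖z - x‖ ^ 2 / s ^ 2 ≤ ‖z - x‖ ^ 2 / (2 * σ ^ 2) := by gcongr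
    have h5 : ‖x‖ ^ 2 / s ^ 2 ≤ ‖x‖ ^ 2 := div_le_self (sq_nonneg _) (one_le_pow₀ hs1)
    linarith
  calc ∫⁻ z, ENNReal.ofReal (relDensity d σ s x z ^ 2) ∂(gaussConv d s 0)
      ≤ ∫⁻ z, ENNReal.ofReal (relDensity d σ s x z) *
          ENNReal.ofReal ((s / σ) ^ d * Real.exp (‖x‖ ^ 2)) ∂(gaussConv d s 0) := by
        refine lintegral_mono fun z => ?_
        rw [← ENNReal.ofReal_mul (relDensity_nonneg hσ hs _ _), sq]
        refine ENNReal.ofReal_le_ofReal ?_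
        gcongr
        · exact relDensity_nonneg hσ hs _ _
        · exact hb z
    _ = _ := by
        rw [lintegral_mul_const]
        · have : ∫⁻ z, ENNReal.ofReal (relDensity d σ s x z) ∂(gaussConv d s 0) = 1 := by
            have h := gaussConv_eq_withDensity hσ hs x 0
            have h' := congrArg (fun θ => θ Set.univ) h
            rw [measure_univ, withDensity_apply _ MeasurableSet.univ, Measure.restrict_univ] at h'
            exact h'.symm
          rw [this, one_mul, ENNReal.ofReal_mul (by positivity)]
        · exact ((measurable_relDensity d σ s).comp measurable_prodMk_left).ennreal_ofReal

/-- The expected total variation distance between the smoothed empirical measure of a sample and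
the smoothed measure. -/
theorem lintegral_smoothDev_le {Ω : Type*} [MeasurableSpace Ω] {P : Measure Ω}
    [IsProbabilityMeasure P] {n d : ℕ} (hn : 1 ≤ n) {μ : Measure (Pt d)}
    {X : Fin n → Ω → Pt d} (hX : ∀ i, Measurable (X i)) (hind : iIndepFun X P)
    (hlaw : ∀ i, P.map (X i) = μ) {σ s : ℝ} (hσ : 0 < σ) (hs1 : 1 ≤ s)
    (hs2 : 2 * σ ^ 2 ≤ s ^ 2) {M : ℝ≥0∞}
    (hM : ∫⁻ x, ENNReal.ofReal (Real.exp (‖x‖ ^ 2)) ∂μ ≤ M) :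
    ∫⁻ ω, smoothDev μ σ s (fun i => X i ω) ∂P ≤
      (ENNReal.ofReal ((s / σ) ^ d) * M / n) ^ (1 / 2 : ℝ) := by
  refine lintegral_abs_average_sub_le hn hX hind hlaw (gaussConv d s 0)
    (measurable_relDensity d σ s) ?_
  calc ∫⁻ x, ∫⁻ z, ENNReal.ofReal (relDensity d σ s x z ^ 2) ∂(gaussConv d s 0) ∂μ
      ≤ ∫⁻ x, ENNReal.ofReal ((s / σ) ^ d) * ENNReal.ofReal (Real.exp (‖x‖ ^ 2)) ∂μ :=
        lintegral_mono fun x => lintegral_relDensity_sq_le hσ hs1 hs2 x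
    _ = ENNReal.ofReal ((s / σ) ^ d) * ∫⁻ x, ENNReal.ofReal (Real.exp (‖x‖ ^ 2)) ∂μ :=
        lintegral_const_mul _ (by fun_prop)
    _ ≤ _ := by gcongr

attribute [irreducible] relDensity smoothDev

/-- The corruption changes the smoothed empirical measure by `ε + 2 ρ / σ`: an outlier has full
effect, a small displacement only in proportion to the bandwidth. -/
theorem near_of_isCorruption {n d : ℕ} (hn : 1 ≤ n) {ρ ε σ : ℝ} (hσ : 0 < σ)
    {x x' : Fin n → Pt d} (h : IsCorruption ρ ε x x') :
    Near (ENNReal.ofReal (ε + 2 * (ρ / σ))) ((empirical x).bind (gaussConv d σ))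
      ((empirical x').bind (gaussConv d σ)) := by
  classical
  obtain ⟨I, hI, hd⟩ := h
  have hn' : (0 : ℝ) < n := by exact_mod_cast hn
  let w : Fin n → ℝ := fun i => if i ∈ I then 2 * (‖x' i - x i‖ / σ) else 1
  have hw0 : ∀ i, 0 ≤ w i := by
    intro i
    by_cases hi : i ∈ I
    · simp only [w, if_pos hi]; positivity
    · simp [w, if_neg hi]
  have hw : ∀ i, Near (ENNReal.ofReal (w i)) (gaussConv d σ (x i)) (gaussConv d σ (x' i)) := by
    intro i
    by_cases hi : i ∈ I
    · simp only [w, if_pos hi]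
      rw [norm_sub_rev]
      exact near_gaussConv hσ _ _
    · refine ⟨gaussConv d σ (x i), Measure.le_add_left le_rfl, ?_⟩
      simp [w, if_neg hi]
  choose ζ h1 h2 using hw
  refine ⟨(n : ℝ≥0∞)⁻¹ • ∑ i, ζ i, ?_, ?_⟩
  · rw [empirical_bind, empirical_bind, ← smul_add, ← Finset.sum_add_distrib]
    gcongr with i
    exact h1 i
  · have hsum : (n : ℝ)⁻¹ * ∑ i, w i ≤ ε + 2 * (ρ / σ) := by
      have e1 : ∑ i, w i = ∑ i ∈ I, 2 * (‖x' i - x i‖ / σ) + ((n : ℝ) - I.card) := by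
        simp only [w, Finset.sum_ite, Finset.filter_mem_eq_inter, Finset.univ_inter,
          Finset.sum_const, nsmul_eq_mul, mul_one]
        congr 1
        have : Finset.univ.filter (fun i => i ∉ I) = Iᶜ := by ext; simp
        rw [this, Finset.card_compl, Fintype.card_fin, Nat.cast_sub]
        simpa using Finset.card_le_univ I
      have e2 : ∑ i ∈ I, 2 * (‖x' i - x i‖ / σ) = 2 / σ * ∑ i ∈ I, ‖x' i - x i‖ := by
        rw [Finset.mul_sum]
        exact Finset.sum_congr rfl fun i _ => by ring
      have e3 : (n : ℝ)⁻¹ * (2 / σ * ∑ i ∈ I, ‖x' i - x i‖) ≤ 2 * (ρ / σ) := by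
        calc (n : ℝ)⁻¹ * (2 / σ * ∑ i ∈ I, ‖x' i - x i‖)
            = 2 / σ * (1 / (n : ℝ) * ∑ i ∈ I, ‖x' i - x i‖) := by ring
          _ ≤ 2 / σ * ρ := by gcongr
          _ = _ := by ring
      have e4 : (n : ℝ)⁻¹ * ((n : ℝ) - I.card) ≤ ε := by
        rw [inv_mul_le_iff₀ hn']
        linarith
      rw [e1, mul_add, e2]
      linarith
    calc ((n : ℝ≥0∞)⁻¹ • ∑ i, ζ i) Set.univ = (n : ℝ≥0∞)⁻¹ * ∑ i, ζ i Set.univ := by simp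
      _ ≤ (n : ℝ≥0∞)⁻¹ * ∑ i, ENNReal.ofReal (w i) := by
          gcongr with i
          exact h2 i
      _ = ENNReal.ofReal ((n : ℝ)⁻¹ * ∑ i, w i) := by
          rw [← ENNReal.ofReal_sum_of_nonneg fun i _ => hw0 i, ← ENNReal.ofReal_natCast,
            ← ENNReal.ofReal_inv_of_pos hn', ← ENNReal.ofReal_mul (by positivity)]
      _ ≤ _ := ENNReal.ofReal_le_ofReal hsum

/-! ### The resampled points -/

/-- The index of the nearest point, the smallest one in case of ties. -/
noncomputable def nearestIndex {n d : ℕ} (hn : 1 ≤ n) (S : Fin n → Pt d) (z : Pt d) : Fin n :=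
  (exists_isFirstNearest hn S z).choose

theorem isFirstNearest_nearestIndex {n d : ℕ} (hn : 1 ≤ n) (S : Fin n → Pt d) (z : Pt d) :
    IsFirstNearest S z (nearestIndex hn S z) :=
  (exists_isFirstNearest hn S z).choose_spec

attribute [irreducible] nearestIndex

theorem nearestIndex_eq_iff {n d : ℕ} (hn : 1 ≤ n) (S : Fin n → Pt d) (z : Pt d) (j : Fin n) :
    nearestIndex hn S z = j ↔ IsFirstNearest S z j :=
  ⟨fun h => h ▸ isFirstNearest_nearestIndex hn S z,
    fun h => (isFirstNearest_nearestIndex hn S z).unique h⟩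

theorem proj_eq_nearestIndex {n d : ℕ} (hn : 1 ≤ n) (S : Fin n → Pt d) (z : Pt d) :
    proj S z = S (nearestIndex hn S z) :=
  proj_eq (isFirstNearest_nearestIndex hn S z)

theorem measurable_nearestIndex {n d : ℕ} (hn : 1 ≤ n) :
    Measurable fun p : (Fin n → Pt d) × Pt d => nearestIndex hn p.1 p.2 := by
  refine measurable_to_countable' fun j => ?_
  have h : (fun p : (Fin n → Pt d) × Pt d => nearestIndex hn p.1 p.2) ⁻¹' {j} =
      (⋂ i, {p | dist p.2 (p.1 j) ≤ dist p.2 (p.1 i)}) ∩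
        ⋂ i, ⋂ (_ : i < j), {p | dist p.2 (p.1 j) < dist p.2 (p.1 i)} := by
    ext p
    simp [nearestIndex_eq_iff, IsFirstNearest]
  rw [h]
  refine MeasurableSet.inter (MeasurableSet.iInter fun i => ?_)
    (MeasurableSet.iInter fun i => MeasurableSet.iInter fun _ => ?_)
  · exact measurableSet_le (by fun_prop) (by fun_prop)
  · exact measurableSet_lt (by fun_prop) (by fun_prop)

theorem measurable_nearestIndex_right {n d : ℕ} (hn : 1 ≤ n) (S : Fin n → Pt d) :
    Measurable fun z => nearestIndex hn S z := by
  have e : Measurable fun z : Pt d => (S, z) := measurable_prodMk_left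
  exact (measurable_nearestIndex hn).comp e

theorem edist_proj_le {n d : ℕ} (S : Fin n → Pt d) (z : Pt d) (i : Fin n) :
    edist z (proj S z) ≤ edist z (S i) := by
  have hn : 1 ≤ n := i.pos
  rw [proj_eq_nearestIndex hn, edist_dist, edist_dist]
  exact ENNReal.ofReal_le_ofReal ((isFirstNearest_nearestIndex hn S z).1 i)

/-- Gaussian perturbation followed by the projection onto `S`. -/
noncomputable def roundingKernel {n d : ℕ} (S : Fin n → Pt d) (σ : ℝ) : Kernel (Pt d) (Pt d) :=
  Kernel.deterministic (proj S) (measurable_proj S) ∘ₖ gaussConv d σ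

instance isMarkovKernel_roundingKernel {n d : ℕ} (S : Fin n → Pt d) (σ : ℝ) :
    IsMarkovKernel (roundingKernel S σ) := by
  unfold roundingKernel; infer_instance

theorem roundingKernel_apply {n d : ℕ} (S : Fin n → Pt d) (σ : ℝ) (x : Pt d) :
    roundingKernel S σ x = (gaussConv d σ x).map (proj S) := by
  rw [roundingKernel, Kernel.deterministic_comp_eq_map, Kernel.map_apply _ (measurable_proj S)]

theorem bind_roundingKernel {n d : ℕ} (S : Fin n → Pt d) (σ : ℝ) (α : Measure (Pt d)) :
    α.bind (roundingKernel S σ) = (α.bind (gaussConv d σ)).map (proj S) := by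
  rw [roundingKernel, ← Measure.comp_assoc, Measure.deterministic_comp_eq_map]

theorem lintegral_uniformOn {n : ℕ} (f : Fin n → ℝ≥0∞) :
    ∫⁻ j, f j ∂(uniformOn (Set.univ : Set (Fin n))) = (n : ℝ≥0∞)⁻¹ * ∑ j, f j := by
  rw [uniformOn, ProbabilityTheory.cond, lintegral_smul_measure, Measure.restrict_univ,
    lintegral_count, tsum_fintype]
  simp

instance isProbabilityMeasure_uniformOn_fin {n : ℕ} [NeZero n] :
    IsProbabilityMeasure (uniformOn (Set.univ : Set (Fin n))) :=
  isProbabilityMeasure_uniformOn Set.finite_univ Set.univ_nonempty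

theorem near_withDensity {E : Type*} [MeasurableSpace E] (θ : Measure E) {f g : E → ℝ}
    (hg : Measurable g) : Near (∫⁻ z, ENNReal.ofReal |f z - g z| ∂θ)
      (θ.withDensity fun z => ENNReal.ofReal (f z))
      (θ.withDensity fun z => ENNReal.ofReal (g z)) := by
  refine ⟨θ.withDensity fun z => ENNReal.ofReal |f z - g z|, ?_, ?_⟩
  · rw [← withDensity_add_left (by fun_prop)]
    refine withDensity_mono (ae_of_all _ fun z => ?_)
    refine le_trans (ENNReal.ofReal_le_ofReal ?_) ENNReal.ofReal_add_le
    have := le_abs_self (f z - g z)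
    linarith
  · rw [withDensity_apply _ MeasurableSet.univ, Measure.restrict_univ]

section Resampling

variable {n d m : ℕ}

/-- The density, with respect to the uniform distribution, of the index of the point to which
the `u.1`-th point of `S` is moved by the perturbation `u.2`. -/
noncomputable def indexDensity (hn : 1 ≤ n) (S : Fin n → Pt d) (σ : ℝ) (u : Fin n × Pt d)
    (j : Fin n) : ℝ :=
  if nearestIndex hn S (S u.1 + σ • u.2) = j then (n : ℝ) else 0

theorem indexDensity_nonneg (hn : 1 ≤ n) (S : Fin n → Pt d) (σ : ℝ) (u : Fin n × Pt d)
    (j : Fin n) : 0 ≤ indexDensity hn S σ u j := by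
  unfold indexDensity
  split_ifs <;> positivity

theorem measurable_indexDensity_joint (hn : 1 ≤ n) (σ : ℝ) (j : Fin n) :
    Measurable fun p : (Fin n → Pt d) × (Fin n × Pt d) => indexDensity hn p.1 σ p.2 j := by
  have h1 : Measurable fun p : (Fin n → Pt d) × (Fin n × Pt d) =>
      (p.1, p.1 p.2.1 + σ • p.2.2) := by
    have e1 : Measurable fun q : (Fin n → Pt d) × Fin n => q.1 q.2 :=
      measurable_from_prod_countable_left fun i => measurable_pi_apply i
    have e2 : Measurable fun p : (Fin n → Pt d) × (Fin n × Pt d) => (p.1, p.2.1) := by fun_prop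
    exact measurable_fst.prodMk (Measurable.add (e1.comp e2) (by fun_prop))
  exact Measurable.ite ((measurable_nearestIndex hn).comp h1 (measurableSet_singleton j))
    measurable_const measurable_const

theorem measurable_indexDensity (hn : 1 ≤ n) (S : Fin n → Pt d) (σ : ℝ) :
    Measurable (Function.uncurry (indexDensity hn S σ)) := by
  refine measurable_from_prod_countable_left fun j => ?_
  have e : Measurable fun u : Fin n × Pt d => (S, u) := measurable_prodMk_left
  exact (measurable_indexDensity_joint hn σ j).comp e

/-- The law of the index and of the perturbation of one resampled point. -/
noncomputable def unitSeedLaw (n d : ℕ) : Measure (Fin n × Pt d) :=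
  (uniformOn (Set.univ : Set (Fin n))).prod (stdGaussian (Pt d))

instance [NeZero n] : IsProbabilityMeasure (unitSeedLaw n d) := by
  unfold unitSeedLaw; infer_instance

instance [NeZero n] : IsProbabilityMeasure (seedLaw n d m) := by
  unfold seedLaw; infer_instance

/-- The `ℓ¹` distance of the frequencies of the indices of the resampled points from their
probabilities. -/
noncomputable def resampleDev (hn : 1 ≤ n) (S : Fin n → Pt d) (σ : ℝ) (s : Seed n d m) : ℝ≥0∞ :=
  ∫⁻ j, ENNReal.ofReal |(m : ℝ)⁻¹ * ∑ k, indexDensity hn S σ (s.1 k, s.2 k) j -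
    ∫ u, indexDensity hn S σ u j ∂(unitSeedLaw n d)| ∂(uniformOn (Set.univ : Set (Fin n)))

theorem measurable_resampleDev [NeZero n] (hn : 1 ≤ n) (σ : ℝ) :
    Measurable fun p : (Fin n → Pt d) × Seed n d m => resampleDev hn p.1 σ p.2 := by
  simp only [resampleDev, lintegral_uniformOn]
  refine Measurable.const_mul (Finset.measurable_sum _ fun j _ => ?_) _
  have h1 : Measurable fun S : Fin n → Pt d =>
      ∫ u, indexDensity hn S σ u j ∂(unitSeedLaw n d) :=
    (StronglyMeasurable.integral_prod_right' (ν := unitSeedLaw n d)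
      (f := fun p : (Fin n → Pt d) × (Fin n × Pt d) => indexDensity hn p.1 σ p.2 j)
      (measurable_indexDensity_joint hn σ j).stronglyMeasurable).measurable
  have h2 : ∀ k, Measurable fun p : (Fin n → Pt d) × Seed n d m =>
      indexDensity hn p.1 σ (p.2.1 k, p.2.2 k) j := by
    intro k
    have e : Measurable fun p : (Fin n → Pt d) × Seed n d m => (p.1, (p.2.1 k, p.2.2 k)) := by
      fun_prop
    exact (measurable_indexDensity_joint hn σ j).comp e
  have h3 : Measurable fun p : (Fin n → Pt d) × Seed n d m =>
      (m : ℝ)⁻¹ * ∑ k, indexDensity hn p.1 σ (p.2.1 k, p.2.2 k) j -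
        ∫ u, indexDensity hn p.1 σ u j ∂(unitSeedLaw n d) :=
    (Measurable.const_mul (Finset.measurable_sum _ fun k _ => h2 k) _).sub (h1.comp measurable_fst)
  exact (continuous_abs.measurable.comp h3).ennreal_ofReal

theorem lintegral_mul_indexDensity (hn : 1 ≤ n) (S : Fin n → Pt d) (σ : ℝ) (u : Fin n × Pt d)
    (f : Pt d → ℝ≥0∞) :
    ∫⁻ j, f (S j) * ENNReal.ofReal (indexDensity hn S σ u j) ∂(uniformOn (Set.univ : Set (Fin n))) =
      f (proj S (S u.1 + σ • u.2)) := by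
  have hn0 : (n : ℝ≥0∞) ≠ 0 := by simpa using Nat.one_le_iff_ne_zero.1 hn
  rw [lintegral_uniformOn, Finset.sum_eq_single (nearestIndex hn S (S u.1 + σ • u.2))]
  · rw [indexDensity, if_pos rfl, ENNReal.ofReal_natCast, mul_comm (f _), ← mul_assoc,
      ENNReal.inv_mul_cancel hn0 (ENNReal.natCast_ne_top n), one_mul, proj_eq_nearestIndex hn]
  · intro j _ hj
    rw [indexDensity, if_neg (Ne.symm hj)]
    simp
  · simp

theorem empirical_roundedPoints_eq (hn : 1 ≤ n) (hm : 1 ≤ m) (S : Fin n → Pt d) (σ : ℝ)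
    (s : Seed n d m) : empirical (roundedPoints S σ s) =
      ((uniformOn (Set.univ : Set (Fin n))).withDensity fun j => ENNReal.ofReal
        ((m : ℝ)⁻¹ * ∑ k, indexDensity hn S σ (s.1 k, s.2 k) j)).map S := by
  refine Measure.ext_of_lintegral _ fun f hf => ?_
  rw [lintegral_empirical, lintegral_map hf (measurable_from_top),
    lintegral_withDensity_eq_lintegral_mul _ measurable_from_top measurable_from_top]
  simp only [Pi.mul_apply]
  have h1 : ∀ j, ENNReal.ofReal ((m : ℝ)⁻¹ * ∑ k, indexDensity hn S σ (s.1 k, s.2 k) j) * f (S j) =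
      (m : ℝ≥0∞)⁻¹ * ∑ k, f (S j) * ENNReal.ofReal (indexDensity hn S σ (s.1 k, s.2 k) j) := by
    intro j
    rw [ENNReal.ofReal_mul (by positivity), ENNReal.ofReal_sum_of_nonneg
      fun k _ => indexDensity_nonneg hn S σ _ j, ENNReal.ofReal_inv_of_pos (by positivity),
      ENNReal.ofReal_natCast, mul_comm, ← mul_assoc, mul_comm (f (S j)), mul_assoc, Finset.mul_sum]
  simp_rw [h1]
  rw [lintegral_const_mul _ measurable_from_top, lintegral_finsetSum _
    fun k _ => measurable_from_top]
  simp_rw [lintegral_mul_indexDensity]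
  rfl

theorem empirical_bind_roundingKernel_eq [NeZero n] (hn : 1 ≤ n) (S : Fin n → Pt d) (σ : ℝ) :
    (empirical S).bind (roundingKernel S σ) =
      ((uniformOn (Set.univ : Set (Fin n))).withDensity fun j => ENNReal.ofReal
        (∫ u, indexDensity hn S σ u j ∂(unitSeedLaw n d))).map S := by
  refine Measure.ext_of_lintegral _ fun f hf => ?_
  have hmp := measurable_proj S
  have hmu : Measurable fun u : Fin n × Pt d => f (proj S (S u.1 + σ • u.2)) := by
    refine hf.comp (hmp.comp (Measurable.add ?_ (by fun_prop)))
    exact (measurable_from_top (f := S)).comp measurable_fst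
  have hL : ∫⁻ a, f a ∂(empirical S).bind (roundingKernel S σ) =
      ∫⁻ u, f (proj S (S u.1 + σ • u.2)) ∂(unitSeedLaw n d) := by
    rw [bind_roundingKernel, lintegral_map hf hmp, empirical_bind, lintegral_smul_measure,
      lintegral_finsetSum_measure, unitSeedLaw, lintegral_prod _ hmu.aemeasurable,
      lintegral_uniformOn, smul_eq_mul]
    congr 1
    refine Finset.sum_congr rfl fun i _ => ?_
    rw [gaussConv_apply]
    exact lintegral_map (hf.comp hmp) (by fun_prop)
  have hint : ∀ j, Integrable (fun u => indexDensity hn S σ u j) (unitSeedLaw n d) := by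
    intro j
    refine Integrable.of_bound (C := n)
      ((measurable_indexDensity hn S σ).comp measurable_prodMk_right).aestronglyMeasurable
      (ae_of_all _ fun u => ?_)
    rw [indexDensity]
    split_ifs <;> simp
  rw [hL, lintegral_map hf (measurable_from_top),
    lintegral_withDensity_eq_lintegral_mul _ measurable_from_top measurable_from_top]
  simp only [Pi.mul_apply]
  simp_rw [← lintegral_mul_indexDensity hn S σ]
  rw [lintegral_lintegral_swap]
  · refine lintegral_congr fun j => ?_
    have hmj : Measurable fun u => indexDensity hn S σ u j :=
      (measurable_indexDensity hn S σ).comp measurable_prodMk_right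
    rw [lintegral_const_mul _ hmj.ennreal_ofReal,
      ofReal_integral_eq_lintegral_ofReal (hint j)
        (ae_of_all _ fun u => indexDensity_nonneg hn S σ u j), mul_comm]
  · refine Measurable.aemeasurable (Measurable.mul ?_
      (measurable_indexDensity hn S σ).ennreal_ofReal)
    exact (measurable_from_top (f := fun j => f (S j))).comp measurable_snd

/-- The rounded points compared with the kernel that generates them. Both measures are images of
measures on the finite set of indices. -/
theorem near_resampleDev (hn : 1 ≤ n) (hm : 1 ≤ m) (S : Fin n → Pt d) (σ : ℝ)
    (s : Seed n d m) : Near (resampleDev hn S σ s) (empirical (roundedPoints S σ s))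
      ((empirical S).bind (roundingKernel S σ)) := by
  have : NeZero n := ⟨by omega⟩
  rw [empirical_roundedPoints_eq hn hm, empirical_bind_roundingKernel_eq hn]
  exact (near_withDensity _ measurable_from_top).map measurable_from_top

theorem iIndepFun_seed [NeZero n] :
    iIndepFun (fun (k : Fin m) (s : Seed n d m) => (s.1 k, s.2 k)) (seedLaw n d m) ∧
      ∀ k : Fin m, (seedLaw n d m).map (fun s => (s.1 k, s.2 k)) = unitSeedLaw n d := by
  have hmap : (seedLaw n d m).map (fun s k => (s.1 k, s.2 k)) =
      Measure.pi fun _ : Fin m => unitSeedLaw n d := by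
    have hCu : ∀ _ : Fin m, (Set.univ : Set (Fin n × Pt d)) ∈ Set.image2 (· ×ˢ ·)
        {s : Set (Fin n) | MeasurableSet s} {t : Set (Pt d) | MeasurableSet t} := by
      intro _
      refine ⟨Set.univ, ?_, Set.univ, ?_, Set.univ_prod_univ⟩ <;> simp
    refine (Measure.pi_eq_generateFrom (C := fun _ => Set.image2 (· ×ˢ ·)
      {s : Set (Fin n) | MeasurableSet s} {t : Set (Pt d) | MeasurableSet t})
      (fun _ => generateFrom_prod) (fun _ => isPiSystem_prod)
      (fun k => ⟨fun _ => Set.univ, fun _ => hCu k, fun _ => measure_lt_top _ _,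
        Set.iUnion_const _⟩) ?_).symm
    intro A hA
    choose B hB C hC hBC using hA
    replace hB : ∀ k, MeasurableSet (B k) := hB
    replace hC : ∀ k, MeasurableSet (C k) := hC
    replace hBC : ∀ k, B k ×ˢ C k = A k := hBC
    have hmm : Measurable fun (s : Seed n d m) (k : Fin m) => (s.1 k, s.2 k) := by fun_prop
    have hset : (fun (s : Seed n d m) (k : Fin m) => (s.1 k, s.2 k)) ⁻¹' Set.univ.pi A =
        Set.univ.pi B ×ˢ Set.univ.pi C := by
      ext s
      simp only [← hBC, Set.mem_preimage, Set.mem_pi, Set.mem_univ, true_implies, Set.mem_prod]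
      exact forall_and
    rw [Measure.map_apply hmm (MeasurableSet.univ_pi fun k => hBC k ▸ (hB k).prod (hC k)), hset,
      seedLaw, Measure.prod_prod, Measure.pi_pi, Measure.pi_pi, ← Finset.prod_mul_distrib]
    refine Finset.prod_congr rfl fun k _ => ?_
    rw [← hBC k, unitSeedLaw, Measure.prod_prod]
  have hlaw : ∀ k : Fin m, (seedLaw n d m).map (fun s => (s.1 k, s.2 k)) = unitSeedLaw n d := by
    intro k
    rw [← (measurePreserving_eval (fun _ : Fin m => unitSeedLaw n d) k).map_eq, ← hmap,
      Measure.map_map (measurable_pi_apply k) (by fun_prop)]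
    rfl
  refine ⟨?_, hlaw⟩
  rw [iIndepFun_iff_map_fun_eq_pi_map fun k => by fun_prop, hmap]
  simp_rw [hlaw]

/-- The second moment of `indexDensity` under the uniform distribution is `n`, whatever the law of
the rounded point is. -/
theorem lintegral_resampleDev_le (hn : 1 ≤ n) (hm : 1 ≤ m) (S : Fin n → Pt d) (σ : ℝ) :
    ∫⁻ s : Seed n d m, resampleDev hn S σ s ∂(seedLaw n d m) ≤
      ((n : ℝ≥0∞) / m) ^ (1 / 2 : ℝ) := by
  have : NeZero n := ⟨by omega⟩
  have hn0 : (n : ℝ≥0∞) ≠ 0 := by simpa using Nat.one_le_iff_ne_zero.1 hn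
  refine lintegral_abs_average_sub_le hm (fun k => by fun_prop) iIndepFun_seed.1 iIndepFun_seed.2
    (uniformOn (Set.univ : Set (Fin n))) (measurable_indexDensity hn S σ) ?_
  have h : ∀ u : Fin n × Pt d, ∫⁻ j, ENNReal.ofReal (indexDensity hn S σ u j ^ 2)
      ∂(uniformOn (Set.univ : Set (Fin n))) = n := by
    intro u
    have e : ∀ j, ENNReal.ofReal (indexDensity hn S σ u j ^ 2) =
        (fun _ => (n : ℝ≥0∞)) (S j) * ENNReal.ofReal (indexDensity hn S σ u j) := by
      intro j
      rw [indexDensity]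
      split_ifs
      · rw [sq, ENNReal.ofReal_mul (by positivity), ENNReal.ofReal_natCast]
      · simp
    simp_rw [e]
    exact lintegral_mul_indexDensity hn S σ u fun _ => n
  simp_rw [h]
  simp

attribute [irreducible] resampleDev

end Resampling

/-! ### The error of the output in terms of total variation distances -/

section Cube

variable {d : ℕ}

theorem measurableSet_unitCube (d : ℕ) : MeasurableSet (unitCube d) := by
  have : unitCube d = ⋂ k, {y | 0 ≤ y k ∧ y k ≤ 1} := by
    ext y
    simp [unitCube]
  rw [this]
  refine MeasurableSet.iInter fun k => ?_
  have h : Measurable fun y : Pt d => y k := by fun_prop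
  exact (measurableSet_le measurable_const h).inter (measurableSet_le h measurable_const)

theorem dist_le_sqrt_of_mem_unitCube {x y : Pt d} (hx : x ∈ unitCube d) (hy : y ∈ unitCube d) :
    dist x y ≤ √d := by
  rw [EuclideanSpace.dist_eq]
  refine Real.sqrt_le_sqrt ?_
  calc ∑ k, dist (x k) (y k) ^ 2 ≤ ∑ _k : Fin d, (1 : ℝ) := by
        refine Finset.sum_le_sum fun k _ => ?_
        have h1 := hx k
        have h2 := hy k
        rw [Real.dist_eq, sq_abs]
        nlinarith
    _ = d := by simp

theorem norm_le_sqrt_of_mem_unitCube {y : Pt d} (hy : y ∈ unitCube d) : ‖y‖ ≤ √d := by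
  rw [← dist_zero_right]
  exact dist_le_sqrt_of_mem_unitCube hy fun k => by simp

theorem edist_le_of_mem_unitCube {x y : Pt d} (hx : x ∈ unitCube d) (hy : y ∈ unitCube d) :
    edist x y ≤ ENNReal.ofReal √d := by
  rw [edist_dist]
  exact ENNReal.ofReal_le_ofReal (dist_le_sqrt_of_mem_unitCube hx hy)

theorem IsCoupling.ae_fst {μ ν : Measure (Pt d)} {π : Measure (Pt d × Pt d)}
    (h : IsCoupling μ ν π) {A : Set (Pt d)} (hA : ∀ᵐ x ∂μ, x ∈ A) : ∀ᵐ z ∂π, z.1 ∈ A := by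
  rw [← h.1] at hA
  exact ae_of_ae_map measurable_fst.aemeasurable hA

theorem IsCoupling.ae_snd {μ ν : Measure (Pt d)} {π : Measure (Pt d × Pt d)}
    (h : IsCoupling μ ν π) {A : Set (Pt d)} (hA : ∀ᵐ x ∂ν, x ∈ A) : ∀ᵐ z ∂π, z.2 ∈ A := by
  rw [← h.2] at hA
  exact ae_of_ae_map measurable_snd.aemeasurable hA

theorem isCoupling_compProd (μ : Measure (Pt d)) [IsProbabilityMeasure μ]
    (κ : Kernel (Pt d) (Pt d)) [IsMarkovKernel κ] : IsCoupling μ (μ.bind κ) (μ ⊗ₘ κ) := by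
  constructor
  · exact Measure.fst_compProd ..
  · exact Measure.snd_compProd ..

theorem W1_bind_le_kernelCost (μ : Measure (Pt d)) [IsProbabilityMeasure μ]
    (κ : Kernel (Pt d) (Pt d)) [IsMarkovKernel κ] : W1 μ (μ.bind κ) ≤ kernelCost κ μ := by
  refine (W1_le (isCoupling_compProd μ κ)).trans_eq ?_
  rw [Measure.lintegral_compProd (by fun_prop), kernelCost]

theorem isProbabilityMeasure_bind {E F : Type*} [MeasurableSpace E] [MeasurableSpace F]
    (μ : Measure E) [IsProbabilityMeasure μ] (κ : Kernel E F) [IsMarkovKernel κ] :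
    IsProbabilityMeasure (μ.bind κ) :=
  ⟨by rw [bind_univ, measure_univ]⟩

/-- On the cube, the diagonal coupling of the common part costs nothing, the rest at most `√d`. -/
theorem W1_le_of_near {α β : Measure (Pt d)} [IsProbabilityMeasure α] [IsProbabilityMeasure β]
    (hα : ∀ᵐ x ∂α, x ∈ unitCube d) (hβ : ∀ᵐ x ∂β, x ∈ unitCube d) {δ : ℝ≥0∞}
    (h : Near δ α β) : W1 α β ≤ ENNReal.ofReal √d * δ := by
  have hm : Measurable fun x : Pt d => (x, x) := by fun_prop
  have hd1 : (β.map fun x => (x, x)).map Prod.fst = β := by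
    rw [Measure.map_map measurable_fst hm]; exact Measure.map_id
  have hd2 : (β.map fun x => (x, x)).map Prod.snd = β := by
    rw [Measure.map_map measurable_snd hm]; exact Measure.map_id
  obtain ⟨π, ξ, h1, h2, h3, h4⟩ := exists_coupling_of_near h hd1 hd2
  have hc : IsCoupling α β π := ⟨h1, h2⟩
  refine (W1_le hc).trans ?_
  have hb : ∀ᵐ z ∂π, edist z.1 z.2 ≤ min (edist z.1 z.2) (ENNReal.ofReal √d) := by
    filter_upwards [hc.ae_fst hα, hc.ae_snd hβ] with z hz1 hz2
    exact le_min le_rfl (edist_le_of_mem_unitCube hz1 hz2)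
  have hn : Near δ π (β.map fun x => (x, x)) := ⟨ξ, h3, h4⟩
  calc ∫⁻ z, edist z.1 z.2 ∂π ≤ ∫⁻ z, min (edist z.1 z.2) (ENNReal.ofReal √d) ∂π :=
        lintegral_mono_ae hb
    _ ≤ ∫⁻ z, min (edist z.1 z.2) (ENNReal.ofReal √d) ∂(β.map fun x => (x, x)) +
          ENNReal.ofReal √d * δ := hn.lintegral_le fun z => min_le_right _ _
    _ = _ := by
        rw [lintegral_map (by fun_prop) hm]
        simp

end Cube

section Displacement

variable {n d : ℕ} {σ : ℝ}

/-- The mean displacement by the rounding kernel, truncated at the diameter of the cube. -/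
noncomputable def truncatedCost (S : Fin n → Pt d) (σ : ℝ) (μ : Measure (Pt d)) : ℝ≥0∞ :=
  ∫⁻ x, ∫⁻ s, min (edist x s) (ENNReal.ofReal √d) ∂(roundingKernel S σ x) ∂μ

/-- Rounding moves a point by the length of the Gaussian perturbation and the distance to `S`;
the latter is controlled by comparing `μ` with the uniform distribution on `S`. -/
theorem truncatedCost_le (hn : 1 ≤ n) (hσ : 0 ≤ σ) (S : Fin n → Pt d) (μ : Measure (Pt d))
    [IsProbabilityMeasure μ] {δ : ℝ≥0∞}
    (h : Near δ (μ.bind (gaussConv d σ)) ((empirical S).bind (gaussConv d σ))) :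
    truncatedCost S σ μ ≤ 2 * ENNReal.ofReal (σ * √d) + ENNReal.ofReal √d * δ := by
  have := isProbabilityMeasure_empirical hn S
  set R := ENNReal.ofReal √d
  set a := ENNReal.ofReal (σ * √d)
  set g : Pt d → ℝ≥0∞ := fun z => min (edist z (proj S z)) R with hg
  have hgm : Measurable g := (measurable_id.edist (measurable_proj S)).min measurable_const
  have h1 : truncatedCost S σ μ ≤ a + ∫⁻ z, g z ∂(μ.bind (gaussConv d σ)) := by
    rw [Measure.lintegral_bind (Kernel.aemeasurable _) hgm.aemeasurable]
    calc truncatedCost S σ μ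
        ≤ ∫⁻ x, (a + ∫⁻ z, g z ∂(gaussConv d σ x)) ∂μ := by
          refine lintegral_mono fun x => ?_
          rw [roundingKernel_apply, lintegral_map (by fun_prop) (measurable_proj S)]
          calc ∫⁻ z, min (edist x (proj S z)) R ∂(gaussConv d σ x)
              ≤ ∫⁻ z, (edist x z + g z) ∂(gaussConv d σ x) := by
                refine lintegral_mono fun z => ?_
                rw [hg]
                dsimp only
                rw [← min_add_add_left]
                exact min_le_min (edist_triangle _ _ _) le_add_self
            _ = ∫⁻ z, edist x z ∂(gaussConv d σ x) + ∫⁻ z, g z ∂(gaussConv d σ x) :=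
                lintegral_add_left (by fun_prop) _
            _ ≤ _ := by
                gcongr
                exact lintegral_edist_gaussConv_le d hσ x
      _ = _ := by
          rw [lintegral_add_left measurable_const]
          simp
  have h2 : ∫⁻ z, g z ∂((empirical S).bind (gaussConv d σ)) ≤ a := by
    rw [Measure.lintegral_bind (Kernel.aemeasurable _) hgm.aemeasurable, lintegral_empirical]
    calc (n : ℝ≥0∞)⁻¹ * ∑ i, ∫⁻ z, g z ∂(gaussConv d σ (S i))
        ≤ (n : ℝ≥0∞)⁻¹ * ∑ _i : Fin n, a := by
          gcongr with i
          calc ∫⁻ z, g z ∂(gaussConv d σ (S i))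
              ≤ ∫⁻ z, edist (S i) z ∂(gaussConv d σ (S i)) := by
                refine lintegral_mono fun z => ?_
                rw [edist_comm]
                exact (min_le_left _ _).trans (edist_proj_le S z i)
            _ ≤ a := lintegral_edist_gaussConv_le d hσ _
      _ = a := by
          have hn0 : (n : ℝ≥0∞) ≠ 0 := by simpa using Nat.one_le_iff_ne_zero.1 hn
          rw [Finset.sum_const, Finset.card_univ, Fintype.card_fin, nsmul_eq_mul, ← mul_assoc,
            ENNReal.inv_mul_cancel hn0 (ENNReal.natCast_ne_top n), one_mul]
  have h3 : ∫⁻ z, g z ∂(μ.bind (gaussConv d σ)) ≤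
      ∫⁻ z, g z ∂((empirical S).bind (gaussConv d σ)) + R * δ :=
    h.lintegral_le fun z => min_le_right _ _
  calc truncatedCost S σ μ ≤ a + (a + R * δ) := h1.trans (by gcongr; exact h3.trans (by gcongr))
    _ = _ := by ring

theorem ae_roundingKernel_bind {S : Fin n → Pt d} (hn : 1 ≤ n) {A : Set (Pt d)}
    (hA : MeasurableSet A) (hS : ∀ i, S i ∈ A) (μ : Measure (Pt d)) :
    ∀ᵐ s ∂(μ.bind (roundingKernel S σ)), s ∈ A := by
  rw [bind_roundingKernel]
  refine (ae_map_iff (measurable_proj S).aemeasurable hA).2 ?_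
  exact ae_of_all _ fun z => by rw [proj_eq_nearestIndex hn]; exact hS _

theorem ae_roundingKernel {S : Fin n → Pt d} (hn : 1 ≤ n) {A : Set (Pt d)}
    (hA : MeasurableSet A) (hS : ∀ i, S i ∈ A) (x : Pt d) :
    ∀ᵐ s ∂(roundingKernel S σ x), s ∈ A := by
  rw [roundingKernel_apply]
  refine (ae_map_iff (measurable_proj S).aemeasurable hA).2 ?_
  exact ae_of_all _ fun z => by rw [proj_eq_nearestIndex hn]; exact hS _

theorem kernelCost_roundingKernel_le {T : Fin n → Pt d} (hn : 1 ≤ n)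
    (hT : ∀ j, T j ∈ unitCube d) {ν : Measure (Pt d)} (hν : ∀ᵐ y ∂ν, y ∈ unitCube d) :
    kernelCost (roundingKernel T σ) ν ≤ truncatedCost T σ ν := by
  refine lintegral_mono_ae ?_
  filter_upwards [hν] with y hy
  refine lintegral_mono_ae ?_
  filter_upwards [ae_roundingKernel hn (measurableSet_unitCube d) hT y] with t ht
  exact le_min le_rfl (edist_le_of_mem_unitCube hy ht)

/-- The Wasserstein distance of a measure on the cube from an empirical measure on the cube, by
way of their images under the rounding kernel. -/
theorem W1_empirical_le (hn : 1 ≤ n) (hσ : 0 ≤ σ) {T : Fin n → Pt d}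
    (hT : ∀ j, T j ∈ unitCube d) {ν : Measure (Pt d)} [IsProbabilityMeasure ν]
    (hν : ∀ᵐ y ∂ν, y ∈ unitCube d) {δ : ℝ≥0∞}
    (h : Near δ (ν.bind (gaussConv d σ)) ((empirical T).bind (gaussConv d σ))) :
    W1 ν (empirical T) ≤ 4 * ENNReal.ofReal (σ * √d) + 2 * (ENNReal.ofReal √d * δ) := by
  have := isProbabilityMeasure_empirical hn T
  have := isProbabilityMeasure_bind ν (roundingKernel T σ)
  have := isProbabilityMeasure_bind (empirical T) (roundingKernel T σ)
  have hT' : ∀ᵐ y ∂(empirical T), y ∈ unitCube d := ae_empirical (measurableSet_unitCube d) hT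
  have h0 : Near 0 ((empirical T).bind (gaussConv d σ)) ((empirical T).bind (gaussConv d σ)) :=
    ⟨0, by simp, by simp⟩
  have e1 : W1 ν (ν.bind (roundingKernel T σ)) ≤
      2 * ENNReal.ofReal (σ * √d) + ENNReal.ofReal √d * δ :=
    (W1_bind_le_kernelCost _ _).trans
      ((kernelCost_roundingKernel_le hn hT hν).trans (truncatedCost_le hn hσ T ν h))
  have e2 : W1 ((empirical T).bind (roundingKernel T σ)) (empirical T) ≤
      2 * ENNReal.ofReal (σ * √d) := by
    rw [W1_comm]
    refine (W1_bind_le_kernelCost _ _).trans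
      ((kernelCost_roundingKernel_le hn hT hT').trans ?_)
    simpa using truncatedCost_le hn hσ T (empirical T) h0
  have e3 : W1 (ν.bind (roundingKernel T σ)) ((empirical T).bind (roundingKernel T σ)) ≤
      ENNReal.ofReal √d * δ := by
    refine W1_le_of_near (ae_roundingKernel_bind hn (measurableSet_unitCube d) hT _)
      (ae_roundingKernel_bind hn (measurableSet_unitCube d) hT _) ?_
    rw [bind_roundingKernel, bind_roundingKernel]
    exact h.map (measurable_proj T)
  calc W1 ν (empirical T) ≤ W1 ν (ν.bind (roundingKernel T σ)) +
        (W1 (ν.bind (roundingKernel T σ)) ((empirical T).bind (roundingKernel T σ)) +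
          W1 ((empirical T).bind (roundingKernel T σ)) (empirical T)) :=
        W1_triangle.trans (by gcongr; exact W1_triangle)
    _ ≤ (2 * ENNReal.ofReal (σ * √d) + ENNReal.ofReal √d * δ) +
        (ENNReal.ofReal √d * δ + 2 * ENNReal.ofReal (σ * √d)) := by gcongr
    _ = _ := by ring

end Displacement

section Excess

variable {d : ℕ}

/-- The cost `‖x - y‖` less the part `‖x‖` that no plan can influence. On the cube it is bounded,
however far away `x` is. The summand `√d` makes it non-negative. -/
noncomputable def reducedCost (x y : Pt d) : ℝ≥0∞ := ENNReal.ofReal (dist x y - ‖x‖ + √d)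

theorem measurable_reducedCost : Measurable fun p : Pt d × Pt d => reducedCost p.1 p.2 := by
  unfold reducedCost; fun_prop

theorem reducedCost_add_norm (x : Pt d) {y : Pt d} (hy : y ∈ unitCube d) :
    reducedCost x y + ENNReal.ofReal ‖x‖ = edist x y + ENNReal.ofReal √d := by
  have h1 := norm_le_sqrt_of_mem_unitCube hy
  have h2 : ‖x‖ ≤ dist x y + ‖y‖ := by
    rw [dist_eq_norm]
    simpa using norm_add_le (x - y) y
  rw [reducedCost, edist_dist, ← ENNReal.ofReal_add (by linarith) (norm_nonneg _),
    ← ENNReal.ofReal_add dist_nonneg (Real.sqrt_nonneg _)]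
  congr 1
  ring

theorem reducedCost_le_two (x : Pt d) {y : Pt d} (hy : y ∈ unitCube d) :
    reducedCost x y ≤ 2 * ENNReal.ofReal √d := by
  have h1 := norm_le_sqrt_of_mem_unitCube hy
  have h2 : dist x y ≤ ‖x‖ + ‖y‖ := dist_le_norm_add_norm x y
  rw [reducedCost, two_mul, ← ENNReal.ofReal_add (Real.sqrt_nonneg _) (Real.sqrt_nonneg _)]
  exact ENNReal.ofReal_le_ofReal (by linarith)

theorem reducedCost_le_add (x s : Pt d) {y : Pt d} (hy : y ∈ unitCube d) :
    reducedCost x y ≤ reducedCost s y + 2 * min (edist x s) (ENNReal.ofReal √d) := by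
  rcases le_total (edist x s) (ENNReal.ofReal √d) with h | h
  · rw [min_eq_left h, reducedCost, reducedCost, edist_dist, two_mul,
      ← ENNReal.ofReal_add dist_nonneg dist_nonneg]
    refine le_trans (ENNReal.ofReal_le_ofReal ?_) ENNReal.ofReal_add_le
    have h1 := dist_triangle x s y
    have h2 : ‖s‖ ≤ dist x s + ‖x‖ := by
      rw [dist_comm, dist_eq_norm]
      simpa using norm_add_le (s - x) x
    linarith
  · rw [min_eq_right h]
    exact (reducedCost_le_two x hy).trans le_add_self

theorem reducedCost_le_add_right (x y y' : Pt d) :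
    reducedCost x y' ≤ reducedCost x y + edist y y' := by
  rw [reducedCost, reducedCost, edist_dist]
  refine le_trans (ENNReal.ofReal_le_ofReal ?_) ENNReal.ofReal_add_le
  have h1 := dist_triangle x y y'
  linarith

variable {n m : ℕ} {σ τ : ℝ} {S T : Fin n → Pt d} {S' : Fin m → Pt d}
  {κbar : Kernel (Pt d) (Pt d)} {μ ν : Measure (Pt d)} {δ δ' : ℝ≥0∞}

theorem IsApproxOTKernel.ae_mem_unitCube (hT : ∀ j, T j ∈ unitCube d)
    (hκ : IsApproxOTKernel S' T τ κbar) (s : Pt d) : ∀ᵐ y ∂(κbar s), y ∈ unitCube d := by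
  have h0 := hκ.range s
  rw [ae_iff]
  refine measure_mono_null (fun y hy => ?_) h0
  rintro ⟨j, rfl⟩
  exact hy (hT j)

/-- An approximately optimal kernel for `(S', T)` has a reduced cost on `S'` that is not much
larger than that of any coupling of `(μ, ν)`: such a coupling is carried over to `(S', T)` by
rounding its first marginal, and by following a coupling of `(ν, T)`. -/
theorem lintegral_reducedCost_le (hn : 1 ≤ n) (hm : 1 ≤ m) (hT : ∀ j, T j ∈ unitCube d)
    [IsProbabilityMeasure μ] [IsProbabilityMeasure ν]
    (hκ : IsApproxOTKernel S' T τ κbar)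
    (hnear : Near δ (empirical S') (μ.bind (roundingKernel S σ)))
    {π θ : Measure (Pt d × Pt d)} (hπ : IsCoupling μ ν π) (hθ : IsCoupling ν (empirical T) θ) :
    ∫⁻ s, ∫⁻ y, reducedCost s y ∂(κbar s) ∂(empirical S') ≤
      ∫⁻ z, reducedCost z.1 z.2 ∂π + ∫⁻ z, edist z.1 z.2 ∂θ + 2 * truncatedCost S σ μ +
        2 * (ENNReal.ofReal √d * δ) + ENNReal.ofReal τ := by
  have := hκ.markov
  have := isProbabilityMeasure_empirical hn T
  have := isProbabilityMeasure_empirical hm S'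
  have := hπ.isProbabilityMeasure
  have := hθ.isProbabilityMeasure
  have := isProbabilityMeasure_bind μ (roundingKernel S σ)
  set R := ENNReal.ofReal √d with hR
  have hT' : ∀ᵐ y ∂(empirical T), y ∈ unitCube d := ae_empirical (measurableSet_unitCube d) hT
  -- the joint law of the rounded point, the point, its image under `π`, and the image of that
  have hcomp := isCoupling_compProd μ (roundingKernel S σ)
  have hmx : Measurable fun z : Pt d × Pt d => (z.2, z.1) := measurable_swap
  have : IsProbabilityMeasure ((μ ⊗ₘ roundingKernel S σ).map Prod.swap) :=
    Measure.isProbabilityMeasure_map measurable_swap.aemeasurable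
  obtain ⟨Θ₁, hΘ1, hΘ2⟩ := exists_gluing (π := (μ ⊗ₘ roundingKernel S σ).map Prod.swap) (π' := π)
    (by rw [Measure.map_map measurable_snd measurable_swap, hπ.1]; exact hcomp.1)
  have hΘp : IsProbabilityMeasure Θ₁ := by
    refine ⟨?_⟩
    rw [← Set.preimage_univ (f := Prod.fst), ← Measure.map_apply measurable_fst MeasurableSet.univ,
      hΘ1, measure_univ]
  obtain ⟨Θ, hΘ3, hΘ4⟩ := exists_gluing (π := Θ₁) (π' := θ) (by
    rw [hθ.1, ← hπ.2, ← hΘ2, Measure.map_map measurable_snd (by fun_prop)]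
    rfl)
  have hsx : Θ.map (fun p => p.1.1) = (μ ⊗ₘ roundingKernel S σ).map Prod.swap := by
    rw [← hΘ1, ← hΘ3, Measure.map_map measurable_fst measurable_fst]
    rfl
  have hxy : Θ.map (fun p => (p.1.1.2, p.1.2)) = π := by
    rw [← hΘ2, ← hΘ3, Measure.map_map (by fun_prop) measurable_fst]
    rfl
  have hst : IsCoupling (μ.bind (roundingKernel S σ)) (empirical T)
      (Θ.map fun p => (p.1.1.1, p.2)) := by
    constructor
    · rw [Measure.map_map measurable_fst (by fun_prop), ← hcomp.2]
      have : (Prod.fst ∘ fun p : ((Pt d × Pt d) × Pt d) × Pt d => (p.1.1.1, p.2)) =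
          Prod.fst ∘ fun p => p.1.1 := rfl
      rw [this, ← Measure.map_map measurable_fst (by fun_prop), hsx,
        Measure.map_map measurable_fst measurable_swap]
      rfl
    · rw [Measure.map_map measurable_snd (by fun_prop), ← hθ.2, ← hΘ4,
        Measure.map_map measurable_snd (by fun_prop)]
      rfl
  obtain ⟨π', ξ, h1, h2, h3, h4⟩ := exists_coupling_of_near hnear hst.1 hst.2
  have hπ' : IsCoupling (empirical S') (empirical T) π' := ⟨h1, h2⟩
  -- the reduced cost of the coupling of `(S', T)`
  have hcost1 : ∫⁻ z, reducedCost z.1 z.2 ∂π' ≤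
      ∫⁻ z, reducedCost z.1 z.2 ∂(Θ.map fun p => (p.1.1.1, p.2)) + 2 * R * δ := by
    have hb : ∀ᵐ z ∂π', reducedCost z.1 z.2 ≤ min (reducedCost z.1 z.2) (2 * R) := by
      filter_upwards [hπ'.ae_snd hT'] with z hz
      exact le_min le_rfl (reducedCost_le_two _ hz)
    have hnn : Near δ π' (Θ.map fun p => (p.1.1.1, p.2)) := ⟨ξ, h3, h4⟩
    refine (lintegral_mono_ae hb).trans
      ((hnn.lintegral_le fun z => min_le_right _ (2 * R)).trans ?_)
    gcongr
    exact min_le_left _ _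
  have hmr := measurable_reducedCost (d := d)
  have hcost2 : ∫⁻ z, reducedCost z.1 z.2 ∂(Θ.map fun p => (p.1.1.1, p.2)) ≤
      ∫⁻ z, reducedCost z.1 z.2 ∂π + ∫⁻ z, edist z.1 z.2 ∂θ + 2 * truncatedCost S σ μ := by
    have e1 : ∫⁻ p, reducedCost p.1.1.2 p.1.2 ∂Θ = ∫⁻ z, reducedCost z.1 z.2 ∂π := by
      rw [← hxy, lintegral_map hmr (by fun_prop)]
    have e2 : ∫⁻ p, edist p.1.2 p.2 ∂Θ = ∫⁻ z, edist z.1 z.2 ∂θ := by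
      rw [← hΘ4, lintegral_map (by fun_prop) (by fun_prop)]
    have e3 : ∫⁻ p, min (edist p.1.1.1 p.1.1.2) R ∂Θ = truncatedCost S σ μ := by
      have hm2 : Measurable fun z : Pt d × Pt d => min (edist z.1 z.2) R := by fun_prop
      have : ∫⁻ p, min (edist p.1.1.1 p.1.1.2) R ∂Θ =
          ∫⁻ z, min (edist z.1 z.2) R ∂(Θ.map fun p => p.1.1) := by
        rw [lintegral_map hm2 (by fun_prop)]
      rw [this, hsx, lintegral_map hm2 measurable_swap, truncatedCost,
        Measure.lintegral_compProd (f := fun z => min (edist z.swap.1 z.swap.2) R)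
          (hm2.comp measurable_swap)]
      simp only [Prod.fst_swap, Prod.snd_swap, hR]
      simp_rw [edist_comm]
    rw [lintegral_map hmr (by fun_prop), ← e1, ← e2, ← e3, ← lintegral_add_right _ (by fun_prop),
      ← lintegral_const_mul _ (by fun_prop), ← lintegral_add_right _ (by fun_prop)]
    have hae : ∀ᵐ p ∂Θ, p.2 ∈ unitCube d := by
      have : ∀ᵐ z ∂(Θ.map fun p => (p.1.2, p.2)), z.2 ∈ unitCube d := by
        rw [hΘ4]; exact hθ.ae_snd hT'
      exact ae_of_ae_map (f := fun p : ((Pt d × Pt d) × Pt d) × Pt d => (p.1.2, p.2))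
        (by fun_prop) this
    refine lintegral_mono_ae ?_
    filter_upwards [hae] with p hp
    exact (reducedCost_le_add p.1.1.1 p.1.1.2 hp).trans
      (by gcongr; exact reducedCost_le_add_right _ _ _)
  -- optimality of the kernel, where the mean of `‖s‖` cancels
  set M := ∫⁻ s, ENNReal.ofReal ‖s‖ ∂(empirical S') with hM
  have hMtop : M ≠ ⊤ := by
    rw [hM, lintegral_empirical]
    refine ENNReal.mul_ne_top ?_ ?_
    · simpa using Nat.one_le_iff_ne_zero.1 hm
    · exact ENNReal.sum_ne_top.2 fun i _ => ENNReal.ofReal_ne_top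
  have hrange := hκ.ae_mem_unitCube hT
  have hL : ∫⁻ s, ∫⁻ y, reducedCost s y ∂(κbar s) ∂(empirical S') + M =
      kernelCost κbar (empirical S') + R := by
    have hRc : ∫⁻ _, R ∂(empirical S') = R := by simp
    have hmm : Measurable fun s => ∫⁻ y, edist s y ∂(κbar s) :=
      Measurable.lintegral_kernel_prod_right (by fun_prop)
    rw [hM, kernelCost, ← lintegral_add_right _ (by fun_prop)]
    conv_rhs => rw [← hRc, ← lintegral_add_right _ (by fun_prop)]
    refine lintegral_congr fun s => ?_
    have e1 : ∫⁻ _, ENNReal.ofReal ‖s‖ ∂(κbar s) = ENNReal.ofReal ‖s‖ := by simp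
    have e2 : ∫⁻ _, R ∂(κbar s) = R := by simp
    rw [← e1, ← lintegral_add_right _ (by fun_prop)]
    conv_rhs => rw [← e2, ← lintegral_add_right _ (by fun_prop)]
    refine lintegral_congr_ae ?_
    filter_upwards [hrange s] with y hy
    exact reducedCost_add_norm s hy
  have hW : W1 (empirical S') (empirical T) + R ≤ ∫⁻ z, reducedCost z.1 z.2 ∂π' + M := by
    have := hπ'.isProbabilityMeasure
    have hRc : ∫⁻ _, R ∂π' = R := by simp
    have hM' : M = ∫⁻ z, ENNReal.ofReal ‖z.1‖ ∂π' := by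
      rw [hM, ← h1, lintegral_map (by fun_prop) measurable_fst]
    calc W1 (empirical S') (empirical T) + R ≤ ∫⁻ z, edist z.1 z.2 ∂π' + R := by
          gcongr
          exact W1_le hπ'
      _ = ∫⁻ z, (edist z.1 z.2 + R) ∂π' := by
          rw [lintegral_add_right _ (by fun_prop), hRc]
      _ = ∫⁻ z, (reducedCost z.1 z.2 + ENNReal.ofReal ‖z.1‖) ∂π' := by
          refine lintegral_congr_ae ?_
          filter_upwards [hπ'.ae_snd hT'] with z hz
          exact (reducedCost_add_norm z.1 hz).symm
      _ = _ := by
          rw [lintegral_add_right _ (by fun_prop), hM']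
  refine (ENNReal.add_le_add_iff_right hMtop).1 ?_
  calc ∫⁻ s, ∫⁻ y, reducedCost s y ∂(κbar s) ∂(empirical S') + M
      = kernelCost κbar (empirical S') + R := hL
    _ ≤ W1 (empirical S') (empirical T) + R + ENNReal.ofReal τ := by
        rw [add_right_comm]
        gcongr
        exact hκ.cost
    _ ≤ (∫⁻ z, reducedCost z.1 z.2 ∂π + ∫⁻ z, edist z.1 z.2 ∂θ + 2 * truncatedCost S σ μ +
          2 * R * δ) + M + ENNReal.ofReal τ := by
        refine add_le_add_left (hW.trans (add_le_add_left (hcost1.trans ?_) _)) _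
        gcongr
    _ = _ := by ring

theorem outputKernel_eq (S : Fin n → Pt d) (σ : ℝ) (κbar : Kernel (Pt d) (Pt d)) :
    outputKernel S σ κbar = κbar ∘ₖ roundingKernel S σ := rfl

theorem IsApproxOTKernel.ae_outputKernel_mem (hT : ∀ j, T j ∈ unitCube d)
    (hκ : IsApproxOTKernel S' T τ κbar) (x : Pt d) :
    ∀ᵐ y ∂(outputKernel S σ κbar x), y ∈ unitCube d := by
  have h : outputKernel S σ κbar x (unitCube d)ᶜ = 0 := by
    rw [outputKernel_eq, Kernel.comp_apply' _ _ _ (measurableSet_unitCube d).compl]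
    have : ∀ s, κbar s (unitCube d)ᶜ = 0 := fun s => (hκ.ae_mem_unitCube hT s)
    simp [this]
  exact h

theorem measurable_lintegral_reducedCost [IsSFiniteKernel κbar] :
    Measurable fun s => ∫⁻ y, reducedCost s y ∂(κbar s) :=
  Measurable.lintegral_kernel_prod_right measurable_reducedCost

/-- The cost of the output on `μ`: the reduced cost is carried from `μ` to the rounded points, there
compared with that of a coupling, and the mean of `‖x‖` is added again at the end. -/
theorem kernelCost_outputKernel_le (hn : 1 ≤ n) (hm : 1 ≤ m) (hT : ∀ j, T j ∈ unitCube d)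
    [IsProbabilityMeasure μ] [IsProbabilityMeasure ν] (hν : ∀ᵐ y ∂ν, y ∈ unitCube d)
    (hκ : IsApproxOTKernel S' T τ κbar)
    (hnear : Near δ (empirical S') (μ.bind (roundingKernel S σ))) :
    kernelCost (outputKernel S σ κbar) μ ≤ W1 μ ν + W1 ν (empirical T) +
      4 * truncatedCost S σ μ + 4 * (ENNReal.ofReal √d * δ) + ENNReal.ofReal τ := by
  have := hκ.markov
  have := isProbabilityMeasure_empirical hm S'
  have := isProbabilityMeasure_bind μ (roundingKernel S σ)
  set R := ENNReal.ofReal √d with hR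
  obtain ⟨F, hF⟩ : ∃ F : Pt d → ℝ≥0∞, ∀ s, F s = ∫⁻ y, reducedCost s y ∂(κbar s) :=
    ⟨_, fun _ => rfl⟩
  have hmF : Measurable F := by
    rw [funext hF]
    exact measurable_lintegral_reducedCost
  have hmr := measurable_reducedCost (d := d)
  -- the reduced cost of the output on `μ`, by that of `κbar` on the rounded points
  have h1 : ∫⁻ x, ∫⁻ y, reducedCost x y ∂(outputKernel S σ κbar x) ∂μ ≤
      ∫⁻ s, F s ∂(μ.bind (roundingKernel S σ)) + 2 * truncatedCost S σ μ := by
    have hmQ : Measurable fun x => ∫⁻ s, F s ∂(roundingKernel S σ x) := hmF.lintegral_kernel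
    rw [Measure.lintegral_bind (Kernel.aemeasurable _) hmF.aemeasurable, truncatedCost,
      ← lintegral_const_mul' _ _ (by simp), ← lintegral_add_left hmQ]
    refine lintegral_mono fun x => ?_
    have hmx : Measurable fun y => reducedCost x y := by
      unfold reducedCost
      fun_prop
    rw [outputKernel_eq, Kernel.lintegral_comp _ _ _ hmx,
      ← lintegral_const_mul' _ _ (by simp), ← lintegral_add_left hmF]
    refine lintegral_mono fun s => ?_
    rw [hF]
    have e2 : ∀ c : ℝ≥0∞, ∫⁻ _, c ∂(κbar s) = c := fun c => by simp
    conv_rhs => rw [← e2 (2 * min (edist x s) R), ← lintegral_add_right _ measurable_const]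
    refine lintegral_mono_ae ?_
    filter_upwards [hκ.ae_mem_unitCube hT s] with y hy
    exact reducedCost_le_add x s hy
  have hFb : ∀ s, F s ≤ 2 * R := by
    intro s
    rw [hF]
    calc ∫⁻ y, reducedCost s y ∂(κbar s) ≤ ∫⁻ _, 2 * R ∂(κbar s) := by
          refine lintegral_mono_ae ?_
          filter_upwards [hκ.ae_mem_unitCube hT s] with y hy
          exact reducedCost_le_two s hy
      _ = 2 * R := by simp
  have h2 : ∫⁻ s, F s ∂(μ.bind (roundingKernel S σ)) ≤
      ∫⁻ s, F s ∂(empirical S') + 2 * R * δ :=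
    hnear.symm.lintegral_le hFb
  have hout := fun x => hκ.ae_outputKernel_mem (S := S) (σ := σ) hT x
  have hmark : IsMarkovKernel (outputKernel S σ κbar) := by rw [outputKernel_eq]; infer_instance
  have key : ∀ π θ : Measure (Pt d × Pt d), IsCoupling μ ν π → IsCoupling ν (empirical T) θ →
      kernelCost (outputKernel S σ κbar) μ ≤ ∫⁻ z, edist z.1 z.2 ∂π + ∫⁻ z, edist z.1 z.2 ∂θ +
        (4 * truncatedCost S σ μ + 4 * (R * δ) + ENNReal.ofReal τ) := by
    intro π θ hπ hθ
    have := hπ.isProbabilityMeasure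
    have h3 := lintegral_reducedCost_le hn hm hT hκ hnear hπ hθ
    simp_rw [← hF] at h3
    set M := ∫⁻ x, ENNReal.ofReal ‖x‖ ∂μ with hM
    have hL : kernelCost (outputKernel S σ κbar) μ + R =
        ∫⁻ x, ∫⁻ y, reducedCost x y ∂(outputKernel S σ κbar x) ∂μ + M := by
      have hRc : ∫⁻ _, R ∂μ = R := by simp
      rw [hM, ← lintegral_add_right _ (by fun_prop), kernelCost]
      conv_lhs => rw [← hRc, ← lintegral_add_right _ (by fun_prop)]
      refine lintegral_congr fun x => ?_
      have e1 : ∫⁻ _, ENNReal.ofReal ‖x‖ ∂(outputKernel S σ κbar x) = ENNReal.ofReal ‖x‖ := by simp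
      have e2 : ∫⁻ _, R ∂(outputKernel S σ κbar x) = R := by simp
      rw [← e1, ← lintegral_add_right _ (by fun_prop)]
      conv_lhs => rw [← e2, ← lintegral_add_right _ (by fun_prop)]
      refine lintegral_congr_ae ?_
      filter_upwards [hout x] with y hy
      exact (reducedCost_add_norm x hy).symm
    have hP : ∫⁻ z, reducedCost z.1 z.2 ∂π + M = ∫⁻ z, edist z.1 z.2 ∂π + R := by
      have hRc : ∫⁻ _, R ∂π = R := by simp
      have hM' : M = ∫⁻ z, ENNReal.ofReal ‖z.1‖ ∂π := by
        rw [hM, ← hπ.1, lintegral_map (by fun_prop) measurable_fst]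
      rw [hM', ← lintegral_add_right _ (by fun_prop)]
      conv_rhs => rw [← hRc, ← lintegral_add_right _ (by fun_prop)]
      refine lintegral_congr_ae ?_
      filter_upwards [hπ.ae_snd hν] with z hz
      exact reducedCost_add_norm z.1 hz
    -- the reduced cost exceeds the cost by `√d - ‖x‖` on both sides
    refine (ENNReal.add_le_add_iff_right (a := R) ENNReal.ofReal_ne_top).1 ?_
    rw [hL]
    calc ∫⁻ x, ∫⁻ y, reducedCost x y ∂(outputKernel S σ κbar x) ∂μ + M
        ≤ (((∫⁻ z, reducedCost z.1 z.2 ∂π + ∫⁻ z, edist z.1 z.2 ∂θ + 2 * truncatedCost S σ μ +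
          2 * (R * δ) + ENNReal.ofReal τ) + 2 * R * δ) + 2 * truncatedCost S σ μ) + M :=
          add_le_add_left (h1.trans (add_le_add_left (h2.trans (add_le_add_left h3 _)) _)) _
      _ = (∫⁻ z, reducedCost z.1 z.2 ∂π + M) + ∫⁻ z, edist z.1 z.2 ∂θ +
          (4 * truncatedCost S σ μ + 4 * (R * δ) + ENNReal.ofReal τ) := by ring
      _ = _ := by rw [hP]; ring
  have hW : kernelCost (outputKernel S σ κbar) μ ≤ (W1 μ ν + W1 ν (empirical T)) +
        (4 * truncatedCost S σ μ + 4 * (R * δ) + ENNReal.ofReal τ) := by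
    unfold W1
    simp only [ENNReal.iInf_add, ENNReal.add_iInf]
    exact le_iInf fun θ => le_iInf fun hθ => le_iInf fun π => le_iInf fun hπ => key π θ hπ hθ
  refine hW.trans_eq ?_
  ring

/-- The transportation error of the output, in terms of the distances of the smoothed measures
and of the resampling error. -/
theorem transportError_outputKernel_le (hn : 1 ≤ n) (hm : 1 ≤ m) (hσ : 0 ≤ σ)
    (hT : ∀ j, T j ∈ unitCube d)
    [IsProbabilityMeasure μ] [IsProbabilityMeasure ν] (hν : ∀ᵐ y ∂ν, y ∈ unitCube d)
    (hκ : IsApproxOTKernel S' T τ κbar) {δX δY δR : ℝ≥0∞}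
    (hX : Near δX (μ.bind (gaussConv d σ)) ((empirical S).bind (gaussConv d σ)))
    (hY : Near δY (ν.bind (gaussConv d σ)) ((empirical T).bind (gaussConv d σ)))
    (hR : Near δR (empirical S') ((empirical S).bind (roundingKernel S σ))) :
    transportError (outputKernel S σ κbar) μ ν ≤
      16 * (ENNReal.ofReal (σ * √d) + ENNReal.ofReal √d * (δX + δY + δR)) + ENNReal.ofReal τ := by
  have := hκ.markov
  have := isProbabilityMeasure_empirical hn T
  have := isProbabilityMeasure_empirical hn S
  have := isProbabilityMeasure_empirical hm S'
  have := isProbabilityMeasure_bind μ (roundingKernel S σ)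
  have := isProbabilityMeasure_bind μ (gaussConv d σ)
  have := isProbabilityMeasure_bind (empirical S) (gaussConv d σ)
  have := isProbabilityMeasure_bind (μ.bind (roundingKernel S σ)) κbar
  set a := ENNReal.ofReal (σ * √d)
  set R := ENNReal.ofReal √d
  have hT' : ∀ᵐ y ∂(empirical T), y ∈ unitCube d := ae_empirical (measurableSet_unitCube d) hT
  have hnear : Near (δR + δX) (empirical S') (μ.bind (roundingKernel S σ)) := by
    refine hR.trans ?_
    rw [bind_roundingKernel, bind_roundingKernel]
    exact hX.symm.map (measurable_proj S)
  have hW := W1_empirical_le hn hσ hT hν hY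
  have hC := kernelCost_outputKernel_le hn hm hT hν hκ hnear
  have hD := truncatedCost_le hn hσ S μ hX
  have hbind : μ.bind (outputKernel S σ κbar) = (μ.bind (roundingKernel S σ)).bind κbar := by
    rw [outputKernel_eq, Measure.comp_assoc]
  -- `κbar` maps the rounded points exactly to `T`
  have hE : W1 (μ.bind (outputKernel S σ κbar)) (empirical T) ≤ R * (δR + δX) := by
    rw [hbind]
    refine W1_le_of_near ?_ hT' ?_
    · rw [ae_iff]
      refine (Measure.bind_apply (measurableSet_unitCube d).compl (Kernel.aemeasurable _)).trans ?_
      have : ∀ s, κbar s (unitCube d)ᶜ = 0 := fun s => (hκ.ae_mem_unitCube hT s)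
      simp [this]
    · rw [← hκ.push]
      have := isProbabilityMeasure_bind (empirical S') κbar
      exact hnear.symm.bind κbar
  rw [W1_comm] at hW
  have hF : W1 (μ.bind (outputKernel S σ κbar)) ν ≤ R * (δR + δX) + (4 * a + 2 * (R * δY)) := by
    have : IsProbabilityMeasure (μ.bind (outputKernel S σ κbar)) := by rw [hbind]; infer_instance
    exact W1_triangle.trans (add_le_add hE hW)
  rw [W1_comm (empirical T)] at hW
  have hG : kernelCost (outputKernel S σ κbar) μ - W1 μ ν ≤ (4 * a + 2 * (R * δY)) +
      4 * (2 * a + R * δX) + 4 * (R * (δR + δX)) + ENNReal.ofReal τ := by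
    refine tsub_le_iff_left.2 (hC.trans ?_)
    calc W1 μ ν + W1 ν (empirical T) + 4 * truncatedCost S σ μ + 4 * (R * (δR + δX)) +
          ENNReal.ofReal τ
        ≤ W1 μ ν + (4 * a + 2 * (R * δY)) + 4 * (2 * a + R * δX) + 4 * (R * (δR + δX)) +
          ENNReal.ofReal τ := by gcongr
      _ = _ := by ring
  calc transportError (outputKernel S σ κbar) μ ν
      ≤ ((4 * a + 2 * (R * δY)) + 4 * (2 * a + R * δX) + 4 * (R * (δR + δX)) + ENNReal.ofReal τ) +
        (R * (δR + δX) + (4 * a + 2 * (R * δY))) := add_le_add hG hF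
    _ = 16 * a + R * (9 * δX + 4 * δY + 5 * δR) + ENNReal.ofReal τ := by ring
    _ ≤ 16 * a + R * (16 * δX + 16 * δY + 16 * δR) + ENNReal.ofReal τ := by
        gcongr <;> norm_num
    _ = _ := by ring

/-- Any kernel into the cube has transportation error at most twice the diameter of the cube. -/
theorem transportError_outputKernel_le_sqrt (hT : ∀ j, T j ∈ unitCube d)
    [IsProbabilityMeasure μ] [IsProbabilityMeasure ν] (hν : ∀ᵐ y ∂ν, y ∈ unitCube d)
    (hκ : IsApproxOTKernel S' T τ κbar) :
    transportError (outputKernel S σ κbar) μ ν ≤ 2 * ENNReal.ofReal √d := by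
  have := hκ.markov
  have hmark : IsMarkovKernel (outputKernel S σ κbar) := by rw [outputKernel_eq]; infer_instance
  have := isProbabilityMeasure_bind μ (outputKernel S σ κbar)
  set R := ENNReal.ofReal √d
  have hout : ∀ x, outputKernel S σ κbar x (unitCube d)ᶜ = 0 := fun x =>
    hκ.ae_outputKernel_mem hT x
  have hbind : ∀ᵐ y ∂(μ.bind (outputKernel S σ κbar)), y ∈ unitCube d := by
    rw [ae_iff]
    refine (Measure.bind_apply (measurableSet_unitCube d).compl (Kernel.aemeasurable _)).trans ?_
    simp [hout]
  have h1 : W1 (μ.bind (outputKernel S σ κbar)) ν ≤ R := by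
    have hone : Near 1 (μ.bind (outputKernel S σ κbar)) ν :=
      ⟨μ.bind (outputKernel S σ κbar), Measure.le_add_left le_rfl, by simp⟩
    simpa using W1_le_of_near hbind hν hone
  have h2 : kernelCost (outputKernel S σ κbar) μ ≤ W1 μ ν + R := by
    unfold W1
    simp only [ENNReal.iInf_add]
    refine le_iInf fun π => le_iInf fun hπ => ?_
    have := hπ.isProbabilityMeasure
    have hmm : Measurable fun x => ∫⁻ y, edist x y ∂(outputKernel S σ κbar x) :=
      Measurable.lintegral_kernel_prod_right (by fun_prop)
    have hRc : ∫⁻ _, R ∂π = R := by simp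
    rw [kernelCost, ← hπ.1, lintegral_map hmm measurable_fst, ← hRc,
      ← lintegral_add_right _ measurable_const]
    refine lintegral_mono_ae ?_
    filter_upwards [hπ.ae_snd hν] with z hz
    calc ∫⁻ y, edist z.1 y ∂(outputKernel S σ κbar z.1)
        ≤ ∫⁻ _, (edist z.1 z.2 + R) ∂(outputKernel S σ κbar z.1) := by
          refine lintegral_mono_ae ?_
          have : ∀ᵐ y ∂(outputKernel S σ κbar z.1), y ∈ unitCube d := hout z.1
          filter_upwards [this] with y hy
          exact (edist_triangle _ z.2 _).trans
            (by gcongr; exact edist_le_of_mem_unitCube hz hy)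
      _ = _ := by simp
  calc transportError (outputKernel S σ κbar) μ ν ≤ R + R :=
        add_le_add (tsub_le_iff_left.2 h2) h1
    _ = _ := by ring

end Excess

/-! ### The risk bound -/

theorem outerExpectation_le_of_ae {Ω : Type*} [MeasurableSpace Ω] {P : Measure Ω}
    {f g : Ω → ℝ≥0∞} (hg : Measurable g) (h : ∀ᵐ ω ∂P, f ω ≤ g ω) :
    outerExpectation P f ≤ ∫⁻ ω, g ω ∂P := by
  classical
  obtain ⟨A, hA, hAm, hA0⟩ := exists_measurable_superset_of_null (ae_iff.1 h)
  refine (iInf₂_le (fun ω => if ω ∈ A then ⊤ else g ω)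
    (Measurable.ite hAm measurable_const hg)).trans (iInf_le_of_le (fun ω => ?_) ?_)
  · dsimp only
    by_cases hω : ω ∈ A
    · simp [hω]
    · rw [if_neg hω]
      by_contra hcon
      exact hω (hA hcon)
  · refine (lintegral_congr_ae ?_).le
    filter_upwards [measure_eq_zero_iff_ae_notMem.1 hA0] with ω hω
    rw [if_neg hω]

theorem bandwidth_pos {n d : ℕ} (hn : 1 ≤ n) (hd : 1 ≤ d) {ρ c : ℝ} (hc : 0 < c) :
    0 < bandwidth n d ρ c := by
  have hn' : (0 : ℝ) < n := by exact_mod_cast hn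
  have hd' : (0 : ℝ) < d := by exact_mod_cast hd
  unfold bandwidth
  positivity

theorem mul_sqrt_le_bandwidth {n d : ℕ} (ρ c : ℝ) : c * √ρ ≤ bandwidth n d ρ c := by
  unfold bandwidth
  have : 0 ≤ (3 : ℝ) ^ ((d : ℝ) / (d + 2)) * ((n : ℝ) * d) ^ (-(1 : ℝ) / (d + 2)) := by positivity
  linarith

theorem bandwidth_le {n d : ℕ} (hn : 1 ≤ n) (hd : 1 ≤ d) (ρ c : ℝ) :
    bandwidth n d ρ c ≤ 3 * (n : ℝ) ^ (-(1 : ℝ) / (d + 2)) + c * √ρ := by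
  have hn' : (1 : ℝ) ≤ n := by exact_mod_cast hn
  have hd' : (1 : ℝ) ≤ d := by exact_mod_cast hd
  unfold bandwidth
  have h1 : (3 : ℝ) ^ ((d : ℝ) / (d + 2)) ≤ 3 := by
    calc (3 : ℝ) ^ ((d : ℝ) / (d + 2)) ≤ (3 : ℝ) ^ (1 : ℝ) :=
          Real.rpow_le_rpow_of_exponent_le (by norm_num)
            (by rw [div_le_one (by positivity)]; linarith)
      _ = 3 := Real.rpow_one 3
  have h2 : ((n : ℝ) * d) ^ (-(1 : ℝ) / (d + 2)) ≤ (n : ℝ) ^ (-(1 : ℝ) / (d + 2)) := by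
    refine Real.rpow_le_rpow_of_nonpos (by linarith) (by nlinarith) ?_
    rw [neg_div]
    exact neg_nonpos.2 (by positivity)
  exact add_le_add_left (mul_le_mul h1 h2 (by positivity) (by norm_num)) _

/-- The order of the deviation of the smoothed empirical measures at the chosen bandwidth. -/
theorem smoothing_rate_le {n d : ℕ} (hn : 1 ≤ n) (hd : 1 ≤ d) (ρ : ℝ) {c : ℝ} (hc : 0 < c) :
    (ENNReal.ofReal ((6 / bandwidth n d ρ c) ^ d) * ENNReal.ofReal (Real.exp d) / n) ^
      (1 / 2 : ℝ) ≤ ENNReal.ofReal (√(6 ^ d * (d : ℝ) ^ ((d : ℝ) / (d + 2)) * Real.exp d) *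
        (n : ℝ) ^ (-(1 : ℝ) / (d + 2))) := by
  have hn' : (0 : ℝ) < n := by exact_mod_cast hn
  have hd' : (0 : ℝ) < d := by exact_mod_cast hd
  have hσ := bandwidth_pos (ρ := ρ) hn hd hc
  have hσ0 : ((n : ℝ) * d) ^ (-(1 : ℝ) / (d + 2)) ≤ bandwidth n d ρ c := by
    unfold bandwidth
    have h1 : (1 : ℝ) ≤ (3 : ℝ) ^ ((d : ℝ) / (d + 2)) :=
      Real.one_le_rpow (by norm_num) (by positivity)
    have h2 : 0 ≤ c * √ρ := by positivity
    have h3 : 0 ≤ ((n : ℝ) * d) ^ (-(1 : ℝ) / (d + 2)) := by positivity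
    nlinarith
  have h1 : (6 / bandwidth n d ρ c) ^ d ≤ 6 ^ d * ((n : ℝ) * d) ^ ((d : ℝ) / (d + 2)) := by
    calc (6 / bandwidth n d ρ c) ^ d ≤ (6 / ((n : ℝ) * d) ^ (-(1 : ℝ) / (d + 2))) ^ d := by gcongr
      _ = _ := by
        rw [neg_div, Real.rpow_neg (by positivity), div_inv_eq_mul, mul_pow, ← Real.rpow_natCast
          (((n : ℝ) * d) ^ (1 / ((d : ℝ) + 2))), ← Real.rpow_mul (by positivity)]
        congr 2
        ring
  rw [← ENNReal.ofReal_mul (by positivity), ← ENNReal.ofReal_natCast,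
    ← ENNReal.ofReal_div_of_pos hn', ENNReal.ofReal_rpow_of_nonneg (by positivity) (by norm_num),
    ← Real.sqrt_eq_rpow]
  refine ENNReal.ofReal_le_ofReal ?_
  have h2 : (n : ℝ) ^ ((d : ℝ) / (d + 2)) / n = ((n : ℝ) ^ (-(1 : ℝ) / (d + 2))) ^ 2 := by
    rw [← Real.rpow_natCast, ← Real.rpow_mul hn'.le, div_eq_iff hn'.ne']
    nth_rw 3 [← Real.rpow_one (n : ℝ)]
    rw [← Real.rpow_add hn']
    congr 1
    push_cast
    field_simp
    ring
  calc √((6 / bandwidth n d ρ c) ^ d * Real.exp d / n)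
      ≤ √(6 ^ d * (d : ℝ) ^ ((d : ℝ) / (d + 2)) * Real.exp d *
          ((n : ℝ) ^ (-(1 : ℝ) / (d + 2))) ^ 2) := by
        refine Real.sqrt_le_sqrt ?_
        rw [← h2]
        calc (6 / bandwidth n d ρ c) ^ d * Real.exp d / n
            ≤ 6 ^ d * ((n : ℝ) * d) ^ ((d : ℝ) / (d + 2)) * Real.exp d / n := by gcongr
          _ = _ := by
            rw [Real.mul_rpow hn'.le hd'.le]
            ring
    _ = _ := by
        rw [Real.sqrt_mul (by positivity), Real.sqrt_sq (by positivity)]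

theorem resampling_rate_le {n d m : ℕ} (hn : 1 ≤ n)
    (hm : (n : ℝ) ^ (((d : ℝ) + 4) / (d + 2)) ≤ m) :
    ((n : ℝ≥0∞) / m) ^ (1 / 2 : ℝ) ≤ ENNReal.ofReal ((n : ℝ) ^ (-(1 : ℝ) / (d + 2))) := by
  have hn' : (0 : ℝ) < n := by exact_mod_cast hn
  have hm' : (0 : ℝ) < m := lt_of_lt_of_le (by positivity) hm
  rw [← ENNReal.ofReal_natCast, ← ENNReal.ofReal_natCast (n := m),
    ← ENNReal.ofReal_div_of_pos hm', ENNReal.ofReal_rpow_of_nonneg (by positivity) (by norm_num)]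
  refine ENNReal.ofReal_le_ofReal ?_
  calc ((n : ℝ) / m) ^ (1 / 2 : ℝ)
      ≤ ((n : ℝ) / (n : ℝ) ^ (((d : ℝ) + 4) / (d + 2))) ^ (1 / 2 : ℝ) := by
        gcongr
    _ = _ := by
        nth_rw 1 [← Real.rpow_one (n : ℝ)]
        rw [← Real.rpow_sub hn', ← Real.rpow_mul hn'.le]
        congr 1
        field_simp
        ring

/-- The constant of the term in `n` of the risk bound. -/
noncomputable def riskConst (d : ℕ) : ℝ :=
  16 * (4 * √d + 2 * √d * √(6 ^ d * (d : ℝ) ^ ((d : ℝ) / (d + 2)) * Real.exp d)) + 1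

theorem riskConst_nonneg (d : ℕ) : 0 ≤ riskConst d := by
  unfold riskConst; positivity

theorem lintegral_exp_norm_sq_le_of_cube {d : ℕ} {ν : Measure (Pt d)} [IsProbabilityMeasure ν]
    (hν : ∀ᵐ y ∂ν, y ∈ unitCube d) :
    ∫⁻ y, ENNReal.ofReal (Real.exp (‖y‖ ^ 2)) ∂ν ≤ ENNReal.ofReal (Real.exp d) := by
  calc ∫⁻ y, ENNReal.ofReal (Real.exp (‖y‖ ^ 2)) ∂ν ≤ ∫⁻ _, ENNReal.ofReal (Real.exp d) ∂ν := by
        refine lintegral_mono_ae ?_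
        filter_upwards [hν] with y hy
        refine ENNReal.ofReal_le_ofReal (Real.exp_le_exp.2 ?_)
        calc ‖y‖ ^ 2 ≤ √(d : ℝ) ^ 2 := by
              gcongr
              exact norm_le_sqrt_of_mem_unitCube hy
          _ = (d : ℝ) := Real.sq_sqrt (by positivity)
    _ = _ := by simp

theorem two_le_ofReal_exp {d : ℕ} (hd : 1 ≤ d) : 2 ≤ ENNReal.ofReal (Real.exp d) := by
  have hd' : (1 : ℝ) ≤ d := by exact_mod_cast hd
  rw [← ENNReal.ofReal_ofNat]
  refine ENNReal.ofReal_le_ofReal ?_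
  have := Real.add_one_le_exp (d : ℝ)
  linarith

section Risk

variable {n d m : ℕ} {ρ ε c : ℝ} {μ ν : Measure (Pt d)} [IsProbabilityMeasure μ]
  [IsProbabilityMeasure ν] {Ω : Type*} [MeasurableSpace Ω] {P : Measure Ω}
  [IsProbabilityMeasure P] {X Y X' Y' : Fin n → Ω → Pt d} {seed : Ω → Seed n d m}
  {κbar : Ω → Kernel (Pt d) (Pt d)}

/-- The smoothed population measure, the smoothed clean sample, the smoothed observed sample. -/
theorem near_of_corruption {x x' : Fin n → Pt d} (hn : 1 ≤ n) {σ s : ℝ} (hσ : 0 < σ) (hs : 0 < s)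
    (h : IsCorruption ρ ε x x') :
    Near (smoothDev μ σ s x + ENNReal.ofReal (ε + 2 * (ρ / σ))) (μ.bind (gaussConv d σ))
      ((empirical x').bind (gaussConv d σ)) := by
  have := isProbabilityMeasure_empirical hn x
  have := isProbabilityMeasure_bind μ (gaussConv d σ)
  have := isProbabilityMeasure_bind (empirical x) (gaussConv d σ)
  exact (near_smoothDev hn hσ hs x).symm.trans (near_of_isCorruption hn hσ h)

/-- The adversary has not seen the seed, so the bound for fixed points can be integrated over the
observed points. -/
theorem lintegral_resampleDev_comp_le (hn : 1 ≤ n)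
    (hm : (n : ℝ) ^ (((d : ℝ) + 4) / (d + 2)) ≤ m) (hX' : ∀ i, Measurable (X' i))
    (hseed : Measurable seed) (hlaw : P.map seed = seedLaw n d m)
    (hind : IndepFun (fun ω i => X' i ω) seed P) (σ : ℝ) :
    ∫⁻ ω, resampleDev hn (fun i => X' i ω) σ (seed ω) ∂P ≤
      ENNReal.ofReal ((n : ℝ) ^ (-(1 : ℝ) / (d + 2))) := by
  have : NeZero n := ⟨by omega⟩
  have hm1 : 1 ≤ m := by
    have hn' : (0 : ℝ) < n := by exact_mod_cast hn
    have hm' : (0 : ℝ) < m := lt_of_lt_of_le (by positivity) hm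
    exact_mod_cast hm'
  have hXm : Measurable fun ω i => X' i ω := measurable_pi_lambda _ hX'
  have hprod := (indepFun_iff_map_prod_eq_prod_map_map hXm.aemeasurable hseed.aemeasurable).1 hind
  have hmeas := measurable_resampleDev (d := d) (m := m) hn σ
  have : IsProbabilityMeasure (P.map fun ω i => X' i ω) :=
    Measure.isProbabilityMeasure_map hXm.aemeasurable
  calc ∫⁻ ω, resampleDev hn (fun i => X' i ω) σ (seed ω) ∂P
      = ∫⁻ p, resampleDev hn p.1 σ p.2 ∂(P.map fun ω => ((fun i => X' i ω), seed ω)) :=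
        (lintegral_map hmeas (hXm.prodMk hseed)).symm
    _ = ∫⁻ S, ∫⁻ s, resampleDev hn S σ s ∂(seedLaw n d m) ∂(P.map fun ω i => X' i ω) := by
        rw [hprod, hlaw, lintegral_prod _ hmeas.aemeasurable]
    _ ≤ ∫⁻ _, ((n : ℝ≥0∞) / m) ^ (1 / 2 : ℝ) ∂(P.map fun ω i => X' i ω) :=
        lintegral_mono fun S => lintegral_resampleDev_le hn hm1 S σ
    _ ≤ _ := by
        simpa using resampling_rate_le hn hm

/-- The risk bound when the corruption radius is small. -/
theorem outerExpectation_le_of_small (hn : 1 ≤ n) (hd : 1 ≤ d)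
    (hm : (n : ℝ) ^ (((d : ℝ) + 4) / (d + 2)) ≤ m) (hρ : 0 ≤ ρ) (hε : 0 ≤ ε) (hc : 0 < c)
    (hsmall : max c c⁻¹ * √ρ ≤ 1)
    (hμ : IsOneSubGaussian μ) (hν : ∀ᵐ y ∂ν, y ∈ unitCube d)
    (hX : ∀ i, Measurable (X i)) (hY : ∀ i, Measurable (Y i))
    (hX' : ∀ i, Measurable (X' i)) (hseed : Measurable seed)
    (hXi : iIndepFun X P) (hXl : ∀ i, P.map (X i) = μ)
    (hYi : iIndepFun Y P) (hYl : ∀ i, P.map (Y i) = ν)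
    (hXc : ∀ᵐ ω ∂P, IsCorruption ρ ε (fun i => X i ω) (fun i => X' i ω))
    (hYc : ∀ᵐ ω ∂P, IsCorruption ρ ε (fun i => Y i ω) (fun i => Y' i ω))
    (hcube : ∀ᵐ ω ∂P, ∀ i, Y' i ω ∈ unitCube d)
    (hlaw : P.map seed = seedLaw n d m) (hind : IndepFun (fun ω i => X' i ω) seed P)
    (hκ : ∀ᵐ ω ∂P, IsApproxOTKernel
      (roundedPoints (fun i => X' i ω) (bandwidth n d ρ c) (seed ω)) (fun i => Y' i ω)
      (accuracy n d) (κbar ω)) :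
    outerExpectation P (fun ω =>
        transportError (outputKernel (fun i => X' i ω) (bandwidth n d ρ c) (κbar ω)) μ ν) ≤
      ENNReal.ofReal (128 * (√d * ε + max c c⁻¹ * √d * √ρ + ρ +
        riskConst d * (n : ℝ) ^ (-(1 : ℝ) / (d + 2)))) := by
  have : NeZero n := ⟨by omega⟩
  have hn' : (1 : ℝ) ≤ n := by exact_mod_cast hn
  have hd' : (1 : ℝ) ≤ d := by exact_mod_cast hd
  have hm1 : 1 ≤ m := by
    have hm' : (0 : ℝ) < m := lt_of_lt_of_le (by positivity) hm
    exact_mod_cast hm'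
  have hσ := bandwidth_pos (ρ := ρ) hn hd hc
  have hσle := bandwidth_le hn hd ρ c
  have hσge := mul_sqrt_le_bandwidth (n := n) (d := d) ρ c
  set σ := bandwidth n d ρ c with hσdef
  set N := (n : ℝ) ^ (-(1 : ℝ) / (d + 2)) with hN
  set G := √(6 ^ d * (d : ℝ) ^ ((d : ℝ) / (d + 2)) * Real.exp d) with hG
  have hN0 : 0 ≤ N := by positivity
  have hN1 : N ≤ 1 := by
    refine Real.rpow_le_one_of_one_le_of_nonpos hn' ?_
    rw [neg_div]
    exact neg_nonpos.2 (by positivity)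
  have hcρ : c * √ρ ≤ max c c⁻¹ * √ρ := by gcongr; exact le_max_left _ _
  have hcρ' : c⁻¹ * √ρ ≤ max c c⁻¹ * √ρ := by gcongr; exact le_max_right _ _
  have hσ4 : σ ≤ 4 := by linarith
  -- the standard deviation `6` of the reference Gaussian is admissible as `σ ≤ 4`
  have hs2 : 2 * σ ^ 2 ≤ (6 : ℝ) ^ 2 := by nlinarith
  have hrat : ρ / σ ≤ c⁻¹ * √ρ := by
    rw [div_le_iff₀ hσ]
    calc ρ = c⁻¹ * √ρ * (c * √ρ) := by
          have := Real.mul_self_sqrt hρ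
          field_simp
          linarith
      _ ≤ _ := by gcongr
  set b := ENNReal.ofReal (ε + 2 * (ρ / σ)) with hb
  have hXm : Measurable fun ω i => X i ω := measurable_pi_lambda _ hX
  have hYm : Measurable fun ω i => Y i ω := measurable_pi_lambda _ hY
  have hXm' : Measurable fun ω i => X' i ω := measurable_pi_lambda _ hX'
  have hm1' : Measurable fun ω => smoothDev μ σ 6 (fun i => X i ω) :=
    (measurable_smoothDev μ σ 6).comp hXm
  have hm2' : Measurable fun ω => smoothDev ν σ 6 (fun i => Y i ω) :=
    (measurable_smoothDev ν σ 6).comp hYm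
  have hm3' : Measurable fun ω => resampleDev hn (fun i => X' i ω) σ (seed ω) :=
    (measurable_resampleDev hn σ).comp (hXm'.prodMk hseed)
  have hmg : Measurable fun ω => 16 * (ENNReal.ofReal (σ * √d) + ENNReal.ofReal √d *
      ((smoothDev μ σ 6 (fun i => X i ω) + b) + (smoothDev ν σ 6 (fun i => Y i ω) + b) +
        resampleDev hn (fun i => X' i ω) σ (seed ω))) + ENNReal.ofReal (accuracy n d) := by
    fun_prop
  refine (outerExpectation_le_of_ae hmg ?_).trans ?_
  · filter_upwards [hXc, hYc, hcube, hκ] with ω h1 h2 h3 h4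
    exact transportError_outputKernel_le hn hm1 hσ.le h3 hν h4
      (near_of_corruption hn hσ (by norm_num) h1) (near_of_corruption hn hσ (by norm_num) h2)
      (near_resampleDev hn hm1 _ σ _)
  have e1 : ∫⁻ ω, smoothDev μ σ 6 (fun i => X i ω) ∂P ≤ ENNReal.ofReal (G * N) :=
    (lintegral_smoothDev_le hn hX hXi hXl hσ (by norm_num) hs2
      (hμ.trans (two_le_ofReal_exp hd))).trans (smoothing_rate_le hn hd ρ hc)
  have e2 : ∫⁻ ω, smoothDev ν σ 6 (fun i => Y i ω) ∂P ≤ ENNReal.ofReal (G * N) :=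
    (lintegral_smoothDev_le hn hY hYi hYl hσ (by norm_num) hs2
      (lintegral_exp_norm_sq_le_of_cube hν)).trans (smoothing_rate_le hn hd ρ hc)
  have e3 := lintegral_resampleDev_comp_le (X' := X') (seed := seed) hn hm hX' hseed hlaw hind σ
  have econst : ∀ r : ℝ≥0∞, ∫⁻ _, r ∂P = r := fun r => by simp
  rw [lintegral_add_right _ measurable_const, lintegral_const_mul _ (by fun_prop),
    lintegral_add_left measurable_const, lintegral_const_mul _ (by fun_prop),
    lintegral_add_right _ hm3', lintegral_add_right _ (by fun_prop),
    lintegral_add_right _ measurable_const, lintegral_add_right _ measurable_const]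
  simp only [econst]
  have hb0 : 0 ≤ ε + 2 * (ρ / σ) := by positivity
  calc 16 * (ENNReal.ofReal (σ * √d) + ENNReal.ofReal √d *
        ((∫⁻ ω, smoothDev μ σ 6 (fun i => X i ω) ∂P + b) +
          (∫⁻ ω, smoothDev ν σ 6 (fun i => Y i ω) ∂P + b) +
          ∫⁻ ω, resampleDev hn (fun i => X' i ω) σ (seed ω) ∂P)) + ENNReal.ofReal (accuracy n d)
      ≤ 16 * (ENNReal.ofReal (σ * √d) + ENNReal.ofReal √d *
        ((ENNReal.ofReal (G * N) + b) + (ENNReal.ofReal (G * N) + b) + ENNReal.ofReal N)) +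
          ENNReal.ofReal N := by
        gcongr
        exact le_of_eq rfl
    _ = ENNReal.ofReal (16 * (σ * √d + √d * ((G * N + (ε + 2 * (ρ / σ))) +
          (G * N + (ε + 2 * (ρ / σ))) + N)) + N) := by
        rw [hb, ← ENNReal.ofReal_add (by positivity) hb0,
          ← ENNReal.ofReal_add (by positivity) (by positivity),
          ← ENNReal.ofReal_add (by positivity) hN0, ← ENNReal.ofReal_mul (by positivity),
          ← ENNReal.ofReal_add (by positivity) (by positivity), ← ENNReal.ofReal_ofNat,
          ← ENNReal.ofReal_mul (by norm_num), ← ENNReal.ofReal_add (by positivity) hN0]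
    _ ≤ _ := by
        refine ENNReal.ofReal_le_ofReal ?_
        have hsd : 0 ≤ √(d : ℝ) := Real.sqrt_nonneg _
        have hK : riskConst d * N = 16 * (4 * √d + 2 * √d * G) * N + N := by
          rw [riskConst]; ring
        have t1 : σ * √d ≤ (3 * N + max c c⁻¹ * √ρ) * √d := by gcongr; linarith
        have t2 : √d * (ρ / σ) ≤ √d * (max c c⁻¹ * √ρ) := by gcongr; linarith
        have t3 : 0 ≤ √d * (max c c⁻¹ * √ρ) := by positivity
        have t4 : 0 ≤ √d * ε := by positivity
        have t5 : 0 ≤ √d * N := by positivity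
        have t6 : 0 ≤ √d * G * N := by positivity
        have t7 : max c c⁻¹ * √d * √ρ = √d * (max c c⁻¹ * √ρ) := by ring
        rw [hK, t7]
        nlinarith

theorem outerExpectation_le_sqrt
    (hν : ∀ᵐ y ∂ν, y ∈ unitCube d) (hcube : ∀ᵐ ω ∂P, ∀ i, Y' i ω ∈ unitCube d) {σ τ : ℝ}
    (hκ : ∀ᵐ ω ∂P, IsApproxOTKernel
      (roundedPoints (fun i => X' i ω) σ (seed ω)) (fun i => Y' i ω) τ (κbar ω)) :
    outerExpectation P (fun ω =>
        transportError (outputKernel (fun i => X' i ω) σ (κbar ω)) μ ν) ≤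
      ENNReal.ofReal (128 * √d) := by
  refine (outerExpectation_le_of_ae (g := fun _ => 2 * ENNReal.ofReal √d) measurable_const
    ?_).trans ?_
  · filter_upwards [hcube, hκ] with ω h1 h2
    exact transportError_outputKernel_le_sqrt h1 hν h2
  · rw [lintegral_const, measure_univ, mul_one, ← ENNReal.ofReal_ofNat,
      ← ENNReal.ofReal_mul (by norm_num)]
    refine ENNReal.ofReal_le_ofReal ?_
    have := Real.sqrt_nonneg (d : ℝ)
    linarith

/-- If the first term of the minimum is the smaller one, the corruption radius is small; otherwise
the bound by the diameter of the cube applies. -/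
theorem outerExpectation_transportError_le (hn : 1 ≤ n) (hd : 1 ≤ d)
    (hm : (n : ℝ) ^ (((d : ℝ) + 4) / (d + 2)) ≤ m) (hρ : 0 ≤ ρ) (hε : 0 ≤ ε) (hc : 0 < c)
    (hμ : IsOneSubGaussian μ) (hν : ∀ᵐ y ∂ν, y ∈ unitCube d)
    (hX : ∀ i, Measurable (X i)) (hY : ∀ i, Measurable (Y i))
    (hX' : ∀ i, Measurable (X' i)) (hseed : Measurable seed)
    (hXi : iIndepFun X P) (hXl : ∀ i, P.map (X i) = μ)
    (hYi : iIndepFun Y P) (hYl : ∀ i, P.map (Y i) = ν)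
    (hXc : ∀ᵐ ω ∂P, IsCorruption ρ ε (fun i => X i ω) (fun i => X' i ω))
    (hYc : ∀ᵐ ω ∂P, IsCorruption ρ ε (fun i => Y i ω) (fun i => Y' i ω))
    (hcube : ∀ᵐ ω ∂P, ∀ i, Y' i ω ∈ unitCube d)
    (hlaw : P.map seed = seedLaw n d m) (hind : IndepFun (fun ω i => X' i ω) seed P)
    (hκ : ∀ᵐ ω ∂P, IsApproxOTKernel
      (roundedPoints (fun i => X' i ω) (bandwidth n d ρ c) (seed ω)) (fun i => Y' i ω)
      (accuracy n d) (κbar ω)) :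
    outerExpectation P (fun ω =>
        transportError (outputKernel (fun i => X' i ω) (bandwidth n d ρ c) (κbar ω)) μ ν) ≤
      ENNReal.ofReal (128 * min (√d * ε + max c c⁻¹ * √d * √ρ + ρ +
        riskConst d * (n : ℝ) ^ (-(1 : ℝ) / (d + 2))) √d) := by
  have h1 := outerExpectation_le_sqrt (μ := μ) hν hcube hκ
  rcases le_total (√d * ε + max c c⁻¹ * √d * √ρ + ρ +
      riskConst d * (n : ℝ) ^ (-(1 : ℝ) / (d + 2))) √d with h | h
  · rw [min_eq_left h]
    have hd' : (0 : ℝ) < √d := Real.sqrt_pos.2 (by exact_mod_cast hd)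
    have hK := riskConst_nonneg d
    have hN : 0 ≤ riskConst d * (n : ℝ) ^ (-(1 : ℝ) / (d + 2)) := by positivity
    have hsmall : max c c⁻¹ * √ρ ≤ 1 := by
      have h2 : √d * (max c c⁻¹ * √ρ) ≤ √d * 1 := by
        have h3 : 0 ≤ √d * ε := by positivity
        calc √d * (max c c⁻¹ * √ρ) = max c c⁻¹ * √d * √ρ := by ring
          _ ≤ _ := by linarith
      exact le_of_mul_le_mul_left h2 hd'
    exact outerExpectation_le_of_small hn hd hm hρ hε hc hsmall hμ hν hX hY hX' hseed hXi hXl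
      hYi hYl hXc hYc hcube hlaw hind hκ
  · rwa [min_eq_right h]

end Risk

/-! ### Reasoning about programs -/

namespace Store

/-- Write an integer register. -/
def setNat (s : Store) (r v : ℕ) : Store := { s with natReg := Function.update s.natReg r v }

/-- Write a real register. -/
def setReal (s : Store) (r : ℕ) (v : ℝ) : Store :=
  { s with realReg := Function.update s.realReg r v }

/-- Write an entry of an integer array. -/
def setNatArr (s : Store) (A i j v : ℕ) : Store :=
  { s with natArr := updateEntry s.natArr A i j v }

/-- Write an entry of a real array. -/
def setRealArr (s : Store) (A i j : ℕ) (v : ℝ) : Store :=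
  { s with realArr := updateEntry s.realArr A i j v }

/-- Count a uniform draw. -/
def stepUnif (s : Store) : Store := { s with unifPos := s.unifPos + 1 }

/-- Count a Gaussian draw. -/
def stepGauss (s : Store) : Store := { s with gaussPos := s.gaussPos + 1 }

variable (s : Store) (r v A i j : ℕ) (x : ℝ)

@[simp] theorem setNat_natReg (q : ℕ) :
    (s.setNat r v).natReg q = if q = r then v else s.natReg q := by
  simp [setNat, Function.update_apply]
@[simp] theorem setNat_realReg : (s.setNat r v).realReg = s.realReg := rfl
@[simp] theorem setNat_natArr : (s.setNat r v).natArr = s.natArr := rfl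
@[simp] theorem setNat_realArr : (s.setNat r v).realArr = s.realArr := rfl
@[simp] theorem setNat_unifPos : (s.setNat r v).unifPos = s.unifPos := rfl
@[simp] theorem setNat_gaussPos : (s.setNat r v).gaussPos = s.gaussPos := rfl

@[simp] theorem setReal_realReg (q : ℕ) :
    (s.setReal r x).realReg q = if q = r then x else s.realReg q := by
  simp [setReal, Function.update_apply]
@[simp] theorem setReal_natReg : (s.setReal r x).natReg = s.natReg := rfl
@[simp] theorem setReal_natArr : (s.setReal r x).natArr = s.natArr := rfl
@[simp] theorem setReal_realArr : (s.setReal r x).realArr = s.realArr := rfl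
@[simp] theorem setReal_unifPos : (s.setReal r x).unifPos = s.unifPos := rfl
@[simp] theorem setReal_gaussPos : (s.setReal r x).gaussPos = s.gaussPos := rfl

theorem _root_.StochasticOT.updateEntry_apply {α : Type} (f : ℕ → ℕ → ℕ → α) (A i j : ℕ) (v : α)
    (A' i' j' : ℕ) :
    updateEntry f A i j v A' i' j' = if A' = A ∧ i' = i ∧ j' = j then v else f A' i' j' := by
  unfold updateEntry
  by_cases h1 : A' = A
  · subst h1
    by_cases h2 : i' = i
    · subst h2
      by_cases h3 : j' = j
      · subst h3; simp
      · simp [h3]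
    · simp [h2]
  · simp [h1]

@[simp] theorem setNatArr_natArr (A' i' j' : ℕ) : (s.setNatArr A i j v).natArr A' i' j' =
    if A' = A ∧ i' = i ∧ j' = j then v else s.natArr A' i' j' :=
  updateEntry_apply ..
@[simp] theorem setNatArr_natReg : (s.setNatArr A i j v).natReg = s.natReg := rfl
@[simp] theorem setNatArr_realReg : (s.setNatArr A i j v).realReg = s.realReg := rfl
@[simp] theorem setNatArr_realArr : (s.setNatArr A i j v).realArr = s.realArr := rfl
@[simp] theorem setNatArr_unifPos : (s.setNatArr A i j v).unifPos = s.unifPos := rfl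
@[simp] theorem setNatArr_gaussPos : (s.setNatArr A i j v).gaussPos = s.gaussPos := rfl

@[simp] theorem setRealArr_realArr (A' i' j' : ℕ) : (s.setRealArr A i j x).realArr A' i' j' =
    if A' = A ∧ i' = i ∧ j' = j then x else s.realArr A' i' j' :=
  updateEntry_apply ..
@[simp] theorem setRealArr_natReg : (s.setRealArr A i j x).natReg = s.natReg := rfl
@[simp] theorem setRealArr_realReg : (s.setRealArr A i j x).realReg = s.realReg := rfl
@[simp] theorem setRealArr_natArr : (s.setRealArr A i j x).natArr = s.natArr := rfl
@[simp] theorem setRealArr_unifPos : (s.setRealArr A i j x).unifPos = s.unifPos := rfl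
@[simp] theorem setRealArr_gaussPos : (s.setRealArr A i j x).gaussPos = s.gaussPos := rfl

@[simp] theorem stepUnif_natReg : s.stepUnif.natReg = s.natReg := rfl
@[simp] theorem stepUnif_realReg : s.stepUnif.realReg = s.realReg := rfl
@[simp] theorem stepUnif_natArr : s.stepUnif.natArr = s.natArr := rfl
@[simp] theorem stepUnif_realArr : s.stepUnif.realArr = s.realArr := rfl
@[simp] theorem stepUnif_unifPos : s.stepUnif.unifPos = s.unifPos + 1 := rfl
@[simp] theorem stepUnif_gaussPos : s.stepUnif.gaussPos = s.gaussPos := rfl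

@[simp] theorem stepGauss_natReg : s.stepGauss.natReg = s.natReg := rfl
@[simp] theorem stepGauss_realReg : s.stepGauss.realReg = s.realReg := rfl
@[simp] theorem stepGauss_natArr : s.stepGauss.natArr = s.natArr := rfl
@[simp] theorem stepGauss_realArr : s.stepGauss.realArr = s.realArr := rfl
@[simp] theorem stepGauss_unifPos : s.stepGauss.unifPos = s.unifPos := rfl
@[simp] theorem stepGauss_gaussPos : s.stepGauss.gaussPos = s.gaussPos + 1 := rfl

end Store

namespace Prog

/-- The integer registers that a program may write. -/
def natRegs : Prog → List ℕ
  | setNat r _ => [r]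
  | seq p q => p.natRegs ++ q.natRegs
  | ite _ p q => p.natRegs ++ q.natRegs
  | loop _ p => p.natRegs
  | _ => []

/-- The real registers that a program may write. -/
def realRegs : Prog → List ℕ
  | setReal r _ => [r]
  | drawUnif r => [r]
  | drawGauss r => [r]
  | seq p q => p.realRegs ++ q.realRegs
  | ite _ p q => p.realRegs ++ q.realRegs
  | loop _ p => p.realRegs
  | _ => []

/-- The integer arrays that a program may write. -/
def natArrs : Prog → List ℕ
  | setNatArr A _ _ _ => [A]
  | seq p q => p.natArrs ++ q.natArrs
  | ite _ p q => p.natArrs ++ q.natArrs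
  | loop _ p => p.natArrs
  | _ => []

/-- The real arrays that a program may write. -/
def realArrs : Prog → List ℕ
  | setRealArr A _ _ _ => [A]
  | seq p q => p.realArrs ++ q.realArrs
  | ite _ p q => p.realArrs ++ q.realArrs
  | loop _ p => p.realArrs
  | _ => []

/-- Whether a program contains a uniform draw. -/
def usesUnif : Prog → Bool
  | drawUnif _ => true
  | seq p q => p.usesUnif || q.usesUnif
  | ite _ p q => p.usesUnif || q.usesUnif
  | loop _ p => p.usesUnif
  | _ => false

/-- Whether a program contains a Gaussian draw. -/
def usesGauss : Prog → Bool
  | drawGauss _ => true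
  | seq p q => p.usesGauss || q.usesGauss
  | ite _ p q => p.usesGauss || q.usesGauss
  | loop _ p => p.usesGauss
  | _ => false

end Prog

/-- The two memories agree on everything that `p` does not write. -/
structure Frame (p : Prog) (s s' : Store) : Prop where
  natReg : ∀ r, r ∉ p.natRegs → s'.natReg r = s.natReg r
  realReg : ∀ r, r ∉ p.realRegs → s'.realReg r = s.realReg r
  natArr : ∀ A, A ∉ p.natArrs → s'.natArr A = s.natArr A
  realArr : ∀ A, A ∉ p.realArrs → s'.realArr A = s.realArr A
  unifPos : p.usesUnif = false → s'.unifPos = s.unifPos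
  gaussPos : p.usesGauss = false → s'.gaussPos = s.gaussPos

theorem Frame.refl (p : Prog) (s : Store) : Frame p s s :=
  ⟨fun _ _ => rfl, fun _ _ => rfl, fun _ _ => rfl, fun _ _ => rfl, fun _ => rfl, fun _ => rfl⟩

theorem Frame.trans {p : Prog} {s s' s'' : Store} (h : Frame p s s') (h' : Frame p s' s'') :
    Frame p s s'' :=
  ⟨fun r hr => (h'.natReg r hr).trans (h.natReg r hr),
    fun r hr => (h'.realReg r hr).trans (h.realReg r hr),
    fun r hr => (h'.natArr r hr).trans (h.natArr r hr),
    fun r hr => (h'.realArr r hr).trans (h.realArr r hr),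
    fun h0 => (h'.unifPos h0).trans (h.unifPos h0),
    fun h0 => (h'.gaussPos h0).trans (h.gaussPos h0)⟩

theorem Frame.mono {p q : Prog} {s s' : Store} (h : Frame p s s') (h1 : p.natRegs ⊆ q.natRegs)
    (h2 : p.realRegs ⊆ q.realRegs) (h3 : p.natArrs ⊆ q.natArrs) (h4 : p.realArrs ⊆ q.realArrs)
    (h5 : q.usesUnif = false → p.usesUnif = false)
    (h6 : q.usesGauss = false → p.usesGauss = false) : Frame q s s' :=
  ⟨fun r hr => h.natReg r fun h => hr (h1 h), fun r hr => h.realReg r fun h => hr (h2 h),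
    fun r hr => h.natArr r fun h => hr (h3 h), fun r hr => h.realArr r fun h => hr (h4 h),
    fun h0 => h.unifPos (h5 h0), fun h0 => h.gaussPos (h6 h0)⟩

theorem Frame.seq_left {p q : Prog} {s s' : Store} (h : Frame p s s') : Frame (.seq p q) s s' :=
  h.mono (by simp [Prog.natRegs]) (by simp [Prog.realRegs]) (by simp [Prog.natArrs])
    (by simp [Prog.realArrs]) (by simp +contextual [Prog.usesUnif])
    (by simp +contextual [Prog.usesGauss])

theorem Frame.seq_right {p q : Prog} {s s' : Store} (h : Frame q s s') : Frame (.seq p q) s s' :=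
  h.mono (by simp [Prog.natRegs]) (by simp [Prog.realRegs]) (by simp [Prog.natArrs])
    (by simp [Prog.realArrs]) (by simp +contextual [Prog.usesUnif])
    (by simp +contextual [Prog.usesGauss])

theorem Frame.ite_left {b : BoolExpr} {p q : Prog} {s s' : Store} (h : Frame p s s') :
    Frame (.ite b p q) s s' :=
  h.mono (by simp [Prog.natRegs]) (by simp [Prog.realRegs]) (by simp [Prog.natArrs])
    (by simp [Prog.realArrs]) (by simp +contextual [Prog.usesUnif])
    (by simp +contextual [Prog.usesGauss])

theorem Frame.ite_right {b : BoolExpr} {p q : Prog} {s s' : Store} (h : Frame q s s') :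
    Frame (.ite b p q) s s' :=
  h.mono (by simp [Prog.natRegs]) (by simp [Prog.realRegs]) (by simp [Prog.natArrs])
    (by simp [Prog.realArrs]) (by simp +contextual [Prog.usesUnif])
    (by simp +contextual [Prog.usesGauss])

theorem Frame.loop {b : BoolExpr} {p : Prog} {s s' : Store} (h : Frame p s s') :
    Frame (.loop b p) s s' :=
  h.mono (by simp [Prog.natRegs]) (by simp [Prog.realRegs]) (by simp [Prog.natArrs])
    (by simp [Prog.realArrs]) (by simp [Prog.usesUnif]) (by simp [Prog.usesGauss])

/-- A program changes only what it mentions. -/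
theorem Exec.frame {w : Tape} {p : Prog} {s s' : Store} {t : ℕ} (h : Exec w p s t s') :
    Frame p s s' := by
  induction h with
  | skip s => exact Frame.refl _ _
  | setNat s r a =>
    refine ⟨fun q hq => ?_, fun _ _ => rfl, fun _ _ => rfl, fun _ _ => rfl, fun _ => rfl,
      fun _ => rfl⟩
    exact Function.update_of_ne (by simpa [Prog.natRegs] using hq) _ _
  | setReal s r a =>
    refine ⟨fun _ _ => rfl, fun q hq => ?_, fun _ _ => rfl, fun _ _ => rfl, fun _ => rfl,
      fun _ => rfl⟩
    exact Function.update_of_ne (by simpa [Prog.realRegs] using hq) _ _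
  | setNatArr s A i j a =>
    refine ⟨fun _ _ => rfl, fun _ _ => rfl, fun q hq => ?_, fun _ _ => rfl, fun _ => rfl,
      fun _ => rfl⟩
    exact Function.update_of_ne (by simpa [Prog.natArrs] using hq) _ _
  | setRealArr s A i j a =>
    refine ⟨fun _ _ => rfl, fun _ _ => rfl, fun _ _ => rfl, fun q hq => ?_, fun _ => rfl,
      fun _ => rfl⟩
    exact Function.update_of_ne (by simpa [Prog.realArrs] using hq) _ _
  | drawUnif s r =>
    refine ⟨fun _ _ => rfl, fun q hq => ?_, fun _ _ => rfl, fun _ _ => rfl, fun h => ?_,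
      fun _ => rfl⟩
    · exact Function.update_of_ne (by simpa [Prog.realRegs] using hq) _ _
    · simp [Prog.usesUnif] at h
  | drawGauss s r =>
    refine ⟨fun _ _ => rfl, fun q hq => ?_, fun _ _ => rfl, fun _ _ => rfl, fun _ => rfl,
      fun h => ?_⟩
    · exact Function.update_of_ne (by simpa [Prog.realRegs] using hq) _ _
    · simp [Prog.usesGauss] at h
  | seq _ _ ih1 ih2 => exact ih1.seq_left.trans ih2.seq_right
  | iteTrue _ _ ih => exact ih.ite_left
  | iteFalse _ _ ih => exact ih.ite_right
  | loopDone _ => exact Frame.refl _ _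
  | loopStep _ _ _ ih1 ih2 => exact ih1.loop.trans ih2

/-- Total correctness with a step count: with random source `w`, the program `p` started on `s`
halts within `B` steps, in a memory that satisfies `Q`. -/
def Runs (w : Tape) (p : Prog) (s : Store) (B : ℕ) (Q : Store → Prop) : Prop :=
  ∃ (t : ℕ) (s' : Store), Exec w p s t s' ∧ t ≤ B ∧ Q s'

section Runs

variable {w : Tape} {s : Store} {Q Q' : Store → Prop} {B B' : ℕ} {p q : Prog}

theorem Runs.mono (h : Runs w p s B Q) (hB : B ≤ B') : Runs w p s B' Q := by
  obtain ⟨t, s', h1, h2, h3⟩ := h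
  exact ⟨t, s', h1, h2.trans hB, h3⟩

/-- The rule of consequence, in which everything that is not written is known to be unchanged. -/
theorem Runs.conseq (h : Runs w p s B Q) (hQ : ∀ s', Frame p s s' → Q s' → Q' s') :
    Runs w p s B Q' := by
  obtain ⟨t, s', h1, h2, h3⟩ := h
  exact ⟨t, s', h1, h2, hQ s' h1.frame h3⟩

theorem Runs.skip (h : Q s) : Runs w .skip s 1 Q := ⟨_, _, .skip s, le_rfl, h⟩

theorem Runs.setNat {r : ℕ} {a : NatExpr} (h : Q (s.setNat r (a.eval s))) :
    Runs w (.setNat r a) s (a.cost + 1) Q := ⟨_, _, .setNat s r a, le_rfl, h⟩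

theorem Runs.setReal {r : ℕ} {a : RealExpr} (h : Q (s.setReal r (a.eval s))) :
    Runs w (.setReal r a) s (a.cost + 1) Q := ⟨_, _, .setReal s r a, le_rfl, h⟩

theorem Runs.setNatArr {A : ℕ} {i j a : NatExpr}
    (h : Q (s.setNatArr A (i.eval s) (j.eval s) (a.eval s))) :
    Runs w (.setNatArr A i j a) s (i.cost + j.cost + a.cost + 1) Q :=
  ⟨_, _, .setNatArr s A i j a, le_rfl, h⟩

theorem Runs.setRealArr {A : ℕ} {i j : NatExpr} {a : RealExpr}
    (h : Q (s.setRealArr A (i.eval s) (j.eval s) (a.eval s))) :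
    Runs w (.setRealArr A i j a) s (i.cost + j.cost + a.cost + 1) Q :=
  ⟨_, _, .setRealArr s A i j a, le_rfl, h⟩

theorem Runs.drawUnif {r : ℕ} (h : Q (s.setReal r (w.1 s.unifPos : ℝ)).stepUnif) :
    Runs w (.drawUnif r) s 1 Q := ⟨_, _, .drawUnif s r, le_rfl, h⟩

theorem Runs.drawGauss {r : ℕ} (h : Q (s.setReal r (w.2 s.gaussPos)).stepGauss) :
    Runs w (.drawGauss r) s 1 Q := ⟨_, _, .drawGauss s r, le_rfl, h⟩

theorem Runs.seq (h : Runs w p s B fun s' => Runs w q s' B' Q) :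
    Runs w (.seq p q) s (B + B') Q := by
  obtain ⟨t, s', h1, h2, t', s'', h3, h4, h5⟩ := h
  exact ⟨_, _, .seq h1 h3, add_le_add h2 h4, h5⟩

theorem Runs.ite {b : BoolExpr} (h1 : b.Holds s → Runs w p s B Q)
    (h2 : ¬ b.Holds s → Runs w q s B Q) : Runs w (.ite b p q) s (b.cost + B) Q := by
  by_cases hb : b.Holds s
  · obtain ⟨t, s', h3, h4, h5⟩ := h1 hb
    exact ⟨_, _, .iteTrue hb h3, by omega, h5⟩
  · obtain ⟨t, s', h3, h4, h5⟩ := h2 hb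
    exact ⟨_, _, .iteFalse hb h3, by omega, h5⟩

/-- A loop whose invariant counts the iterations, and bounds their number. -/
theorem Runs.loop {b : BoolExpr} {c T : ℕ} (I : ℕ → Store → Prop) (h0 : I 0 s)
    (hbound : ∀ t s', I t s' → t ≤ T)
    (hstep : ∀ t s', Frame (.loop b p) s s' → I t s' → b.Holds s' → Runs w p s' c (I (t + 1))) :
    Runs w (.loop b p) s (T * (b.cost + c) + b.cost)
      fun s' => (∃ t, I t s') ∧ ¬ b.Holds s' := by
  -- induction on the number `k` of iterations that are still possible
  have key : ∀ k t s', t + k = T → Frame (.loop b p) s s' → I t s' →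
      Runs w (.loop b p) s' (k * (b.cost + c) + b.cost) fun s' => (∃ t, I t s') ∧ ¬ b.Holds s' := by
    intro k
    induction k with
    | zero =>
      intro t s' hk hf hI
      by_cases hb : b.Holds s'
      · obtain ⟨u, s'', _, _, h3⟩ := hstep t s' hf hI hb
        have := hbound _ _ h3
        omega
      · exact ⟨_, _, .loopDone hb, by simp, ⟨t, hI⟩, hb⟩
    | succ k ih =>
      intro t s' hk hf hI
      by_cases hb : b.Holds s'
      · obtain ⟨u, s'', h1, h2, h3⟩ := hstep t s' hf hI hb
        obtain ⟨u', s3, h4, h5, h6⟩ := ih (t + 1) s'' (by omega) (hf.trans h1.frame.loop) h3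
        refine ⟨_, _, .loopStep hb h1 h4, ?_, h6⟩
        rw [add_mul, one_mul]
        omega
      · exact ⟨_, _, .loopDone hb, by omega, ⟨t, hI⟩, hb⟩
  exact key T 0 s (by omega) (Frame.refl _ _) h0

/-- Run `body` with the register `r` taking the values below the content of the register `R`. -/
def forLoop (r R : ℕ) (body : Prog) : Prog :=
  .seq (.setNat r (.lit 0)) (.loop (.natLt (.reg r) (.reg R))
    (.seq body (.setNat r (.add (.reg r) (.lit 1)))))

/-- The rule for `forLoop`: the invariant `I i` holds before the `i`-th iteration. The `7` further
steps of an iteration are spent on the test and on the increment. -/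
theorem Runs.forLoop {r R c N : ℕ} {body : Prog} (I : ℕ → Store → Prop)
    (hr : r ∉ body.natRegs) (hR : R ∉ body.natRegs) (hne : R ≠ r) (hN : s.natReg R = N)
    (h0 : I 0 (s.setNat r 0))
    (hstep : ∀ i < N, ∀ s', Frame (forLoop r R body) s s' → s'.natReg r = i → I i s' →
      Runs w body s' c fun s'' => I (i + 1) (s''.setNat r (i + 1))) :
    Runs w (forLoop r R body) s (N * (c + 7) + 5) fun s' => I N s' := by
  have hf0 : Frame (StochasticOT.forLoop r R body) s (s.setNat r 0) :=
    Frame.seq_left (Exec.setNat (w := w) s r (.lit 0)).frame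
  have hRr : R ∉ (StochasticOT.forLoop r R body).natRegs := by
    simp [StochasticOT.forLoop, Prog.natRegs, hR, hne]
  refine Runs.mono (Runs.seq (Runs.setNat (Runs.conseq (Runs.loop (c := c + 4) (T := N)
    (fun t s' => s'.natReg r = t ∧ t ≤ N ∧ I t s') ⟨by simp [NatExpr.eval], Nat.zero_le _, h0⟩
    (fun t s' h => h.2.1) ?_) ?_))) ?_
  · rintro t s' hf ⟨h1, h2, h3⟩ hb
    have hf' : Frame (StochasticOT.forLoop r R body) s s' := hf0.trans hf.seq_right
    have hlt : t < N := by
      have : s'.natReg r < s'.natReg R := hb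
      rw [hf'.natReg R hRr, hN, h1] at this
      exact this
    refine Runs.mono (Runs.seq (Runs.conseq (hstep t hlt s' hf' h1 h3) ?_)) (B := c + 4) le_rfl
    intro s'' hf'' h4
    have h5 : s''.natReg r = t := by rw [hf''.natReg r hr, h1]
    refine Runs.setNat ?_
    simp only [NatExpr.eval, h5]
    exact ⟨by simp, hlt, h4⟩
  · rintro s' hf ⟨⟨t, h1, h2, h3⟩, hb⟩
    have hf' : Frame (StochasticOT.forLoop r R body) s s' := hf0.trans hf.seq_right
    have : ¬ s'.natReg r < s'.natReg R := hb
    rw [hf'.natReg R hRr, hN, h1] at this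
    rwa [show N = t by omega]
  · simp only [NatExpr.cost, BoolExpr.cost]
    have : 1 + 1 + 1 + (c + 4) = c + 7 := by omega
    rw [this]
    omega

end Runs

/-! ### Subprograms for perturbation, nearest points and sampling -/

/-! Throughout, the integer registers `0`, `1`, `2` hold `n`, `d`, `m`; the real arrays `0` and `1`
hold the source and the target points. -/

section Programs

/-- Write into row `0` of the real array `5` the row `e` of the real array `A` plus `σ` times a
standard Gaussian vector; `σ` is in the real register `3`. -/
def perturb (A : ℕ) (e : NatExpr) : Prog :=
  forLoop 6 1 (.seq (.drawGauss 8) (.setRealArr 5 (.lit 0) (.reg 6)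
    (.add (.arr A e (.reg 6)) (.mul (.reg 3) (.reg 8)))))

/-- Compute in the real register `5` the squared distance between the row `i` of the real array
`A` and the row `j` of the real array `B`. -/
def sqDist (A : ℕ) (i : NatExpr) (B : ℕ) (j : NatExpr) : Prog :=
  .seq (.setReal 5 (.lit 0)) (forLoop 6 1 (.setReal 5 (.add (.reg 5)
    (.mul (.sub (.arr A i (.reg 6)) (.arr B j (.reg 6)))
      (.sub (.arr A i (.reg 6)) (.arr B j (.reg 6)))))))

/-- Compute in the integer register `7` the first of the indices below `n` at which row `0` of the
real array `7` is minimal. -/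
def argmin : Prog :=
  .seq (.setNat 7 (.lit 0)) (forLoop 14 0
    (.ite (.realLt (.arr 7 (.lit 0) (.reg 14)) (.arr 7 (.lit 0) (.reg 7)))
      (.setNat 7 (.reg 14)) .skip))

/-- Compute in the integer register `7` the index of the first source point nearest to the point
in row `0` of the real array `5`. -/
def nearest : Prog :=
  .seq (forLoop 15 0 (.seq (sqDist 5 (.lit 0) 0 (.reg 15))
    (.setRealArr 7 (.lit 0) (.reg 15) (.reg 5)))) argmin

/-- Compute in the integer register `8` the first index at which the partial sums of row `0` of the
real array `8` exceed the real register `6`. -/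
def scan : Prog :=
  .seq (.seq (.setNat 8 (.lit 0)) (.setReal 7 (.arr 8 (.lit 0) (.lit 0))))
    (.loop (.and (.natLt (.add (.reg 8) (.lit 1)) (.reg 0)) (.not (.realLt (.reg 6) (.reg 7))))
      (.seq (.setNat 8 (.add (.reg 8) (.lit 1)))
        (.setReal 7 (.add (.reg 7) (.arr 8 (.lit 0) (.reg 8))))))

end Programs

/-- The first index `a` below `n` with `u < v 0 + … + v a`, or `n - 1` if there is none. It is
encoded as the number of partial sums that are at most `u`, which agrees when `v` is
non-negative. -/
noncomputable def scanIndex (n : ℕ) (v : ℕ → ℝ) (u : ℝ) : ℕ :=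
  ((Finset.range (n - 1)).filter fun j => ∑ i ∈ Finset.range (j + 1), v i ≤ u).card

theorem scanIndex_lt {n : ℕ} (hn : 1 ≤ n) (v : ℕ → ℝ) (u : ℝ) : scanIndex n v u < n := by
  have h := Finset.card_filter_le (Finset.range (n - 1))
    fun j => ∑ i ∈ Finset.range (j + 1), v i ≤ u
  rw [Finset.card_range] at h
  unfold scanIndex
  omega

theorem scanIndex_eq {n a : ℕ} {v : ℕ → ℝ} {u : ℝ} (hv : ∀ j < n, 0 ≤ v j) (ha : a < n)
    (h1 : ∀ j < a, ∑ i ∈ Finset.range (j + 1), v i ≤ u)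
    (h2 : a + 1 < n → u < ∑ i ∈ Finset.range (a + 1), v i) : scanIndex n v u = a := by
  have : ((Finset.range (n - 1)).filter fun j => ∑ i ∈ Finset.range (j + 1), v i ≤ u) =
      Finset.range a := by
    ext j
    simp only [Finset.mem_filter, Finset.mem_range]
    refine ⟨fun ⟨h3, h4⟩ => ?_, fun h => ⟨by omega, h1 j h⟩⟩
    by_contra h5
    have h6 : ∑ i ∈ Finset.range (a + 1), v i ≤ ∑ i ∈ Finset.range (j + 1), v i := by
      refine Finset.sum_le_sum_of_subset_of_nonneg (Finset.range_mono (by omega)) ?_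
      intro i hi _
      exact hv i (by have := Finset.mem_range.1 hi; omega)
    exact absurd (h2 (by omega)) (not_lt.2 (h6.trans h4))
  rw [scanIndex, this, Finset.card_range]

theorem scanIndex_congr {n : ℕ} {v v' : ℕ → ℝ} (h : ∀ j < n, v j = v' j) (u : ℝ) :
    scanIndex n v u = scanIndex n v' u := by
  unfold scanIndex
  congr 1
  refine Finset.filter_congr fun k hk => ?_
  rw [Finset.sum_congr rfl fun i hi => ?_]
  exact h i (by have := Finset.mem_range.1 hi; have := Finset.mem_range.1 hk; omega)

section Specs

variable {w : Tape} {s : Store}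

theorem runs_perturb {A d : ℕ} {e : NatExpr} (hA : A ≠ 5) (hd : s.natReg 1 = d)
    (he : ∀ s', Frame (perturb A e) s s' → e.eval s' = e.eval s) :
    Runs w (perturb A e) s (d * (e.cost + 17) + 5) fun s' =>
      (∀ l < d, s'.realArr 5 0 l =
        s.realArr A (e.eval s) l + s.realReg 3 * w.2 (s.gaussPos + l)) ∧
      s'.gaussPos = s.gaussPos + d := by
  refine Runs.mono (Runs.forLoop (fun t s' =>
      (∀ l < t, s'.realArr 5 0 l =
        s.realArr A (e.eval s) l + s.realReg 3 * w.2 (s.gaussPos + l)) ∧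
      s'.gaussPos = s.gaussPos + t) (c := e.cost + 10) (by simp [Prog.natRegs])
      (by simp [Prog.natRegs]) (by decide) hd
      (by simp) ?_) (by gcongr)
  rintro t ht s' hf h6 ⟨h1, h2⟩
  refine Runs.mono (Runs.seq (Runs.drawGauss (Runs.setRealArr ?_))) ?_
  · have e1 : e.eval (s'.setReal 8 (w.2 s'.gaussPos)).stepGauss = e.eval s := by
      refine he _ (hf.trans ?_)
      have h3 : Frame (.drawGauss 8) s' (s'.setReal 8 (w.2 s'.gaussPos)).stepGauss :=
        (Exec.drawGauss s' 8).frame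
      exact h3.seq_left.seq_left.loop.seq_right
    have hA5 : s'.realArr A = s.realArr A :=
      hf.realArr A (by simp [forLoop, Prog.realArrs, hA])
    have h3 : s'.realReg 3 = s.realReg 3 := hf.realReg 3 (by simp [forLoop, Prog.realRegs])
    constructor
    · intro l hl
      simp only [NatExpr.eval, RealExpr.eval, e1, Store.setNat_realArr, Store.setRealArr_realArr,
        Store.stepGauss_natReg, Store.setReal_natReg, h6, Store.stepGauss_realArr,
        Store.setReal_realArr, hA5, Store.stepGauss_realReg, Store.setReal_realReg, h3]
      by_cases hlt : l = t
      · simp [hlt, h2]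
      · simpa [hlt] using h1 l (by omega)
    · simp only [Store.setNat_gaussPos, Store.setRealArr_gaussPos, Store.stepGauss_gaussPos,
        Store.setReal_gaussPos, h2, add_assoc]
  · simp only [NatExpr.cost, RealExpr.cost]; omega

theorem runs_sqDist {A B d : ℕ} {i j : NatExpr} (hd : s.natReg 1 = d)
    (hi : ∀ s', Frame (sqDist A i B j) s s' → i.eval s' = i.eval s)
    (hj : ∀ s', Frame (sqDist A i B j) s s' → j.eval s' = j.eval s) :
    Runs w (sqDist A i B j) s (d * (2 * i.cost + 2 * j.cost + 21) + 7) fun s' =>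
      s'.realReg 5 = ∑ l ∈ Finset.range d,
        (s.realArr A (i.eval s) l - s.realArr B (j.eval s) l) ^ 2 := by
  refine Runs.mono (Runs.seq (Runs.setReal (Runs.forLoop (fun t s' => s'.realReg 5 =
    ∑ l ∈ Finset.range t, (s.realArr A (i.eval s) l - s.realArr B (j.eval s) l) ^ 2)
    (c := 2 * i.cost + 2 * j.cost + 14) (N := d) (by simp [Prog.natRegs])
      (by simp [Prog.natRegs]) (by decide) hd
      (by simp [RealExpr.eval]) ?_))) (by
        simp only [RealExpr.cost]
        have : 2 * i.cost + 2 * j.cost + 14 + 7 = 2 * i.cost + 2 * j.cost + 21 := by omega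
        rw [this]; omega)
  intro t ht s' hf h6 h1
  have hf' : Frame (sqDist A i B j) s s' :=
    (Frame.seq_left (Exec.setReal (w := w) s 5 (.lit 0)).frame).trans hf.seq_right
  refine Runs.mono (Runs.setReal ?_) ?_
  · have hA : s'.realArr = s.realArr := by
      funext A
      exact hf'.realArr A (by simp [sqDist, forLoop, Prog.realArrs])
    simp only [NatExpr.eval, RealExpr.eval, hi s' hf', hj s' hf', hA, h6, h1, Store.setNat_realReg,
      Store.setReal_realReg, if_true, Finset.sum_range_succ]
    ring
  · simp only [NatExpr.cost, RealExpr.cost]; omega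

theorem runs_argmin {n : ℕ} (hn : 1 ≤ n) (h0 : s.natReg 0 = n) :
    Runs w argmin s (n * 17 + 7) fun s' => s'.natReg 7 < n ∧
      (∀ j < n, s.realArr 7 0 (s'.natReg 7) ≤ s.realArr 7 0 j) ∧
      ∀ j < s'.natReg 7, s.realArr 7 0 (s'.natReg 7) < s.realArr 7 0 j := by
  refine Runs.mono (Runs.seq (Runs.setNat (Runs.forLoop (fun t s' => s'.natReg 7 < n ∧
      (∀ j < t, s.realArr 7 0 (s'.natReg 7) ≤ s.realArr 7 0 j) ∧
      ∀ j < s'.natReg 7, s.realArr 7 0 (s'.natReg 7) < s.realArr 7 0 j)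
    (c := 10) (N := n) (by decide) (by decide) (by decide) (by simpa using h0)
      (by simp [NatExpr.eval]; omega) ?_))) (by simp only [NatExpr.cost]; omega)
  rintro t ht s' hf h14 ⟨h1, h2, h3⟩
  have hA : s'.realArr 7 = s.realArr 7 := hf.realArr 7 (by decide)
  refine Runs.mono (Runs.ite (B := 2) (fun hb => Runs.mono (Runs.setNat ?_) le_rfl)
    (fun hb => Runs.mono (Runs.skip ?_) one_le_two)) (by simp [BoolExpr.cost, RealExpr.cost,
      NatExpr.cost])
  · simp only [BoolExpr.Holds, RealExpr.eval, NatExpr.eval, hA, h14] at hb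
    simp only [NatExpr.eval, h14, Store.setNat_natReg]
    norm_num
    refine ⟨ht, fun j hj => ?_, fun j hj => hb.trans_le (h2 j hj)⟩
    rcases hj.lt_or_eq with h | rfl
    · exact hb.le.trans (h2 j h)
    · exact le_rfl
  · simp only [BoolExpr.Holds, RealExpr.eval, NatExpr.eval, hA, h14, not_lt] at hb
    simp only [Store.setNat_natReg]
    norm_num
    refine ⟨h1, fun j hj => ?_, h3⟩
    rcases hj.lt_or_eq with h | rfl
    · exact h2 j h
    · exact hb

theorem sum_range_eq_dist_sq {d : ℕ} (x y : Pt d) {f g : ℕ → ℝ} (hf : ∀ l : Fin d, f l = x l)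
    (hg : ∀ l : Fin d, g l = y l) :
    ∑ l ∈ Finset.range d, (f l - g l) ^ 2 = dist x y ^ 2 := by
  rw [EuclideanSpace.dist_eq, Real.sq_sqrt (by positivity), ← Fin.sum_univ_eq_sum_range
    (fun l => (f l - g l) ^ 2)]
  exact Finset.sum_congr rfl fun l _ => by rw [hf, hg, Real.dist_eq, sq_abs]

theorem padArr_apply {n d : ℕ} (S : Fin n → Pt d) (i : Fin n) (l : Fin d) :
    padArr S i l = S i l := by
  simp [padArr, pad]

theorem runs_nearest {n d : ℕ} (hn : 1 ≤ n) (hd : 1 ≤ d) (h0 : s.natReg 0 = n)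
    (h1 : s.natReg 1 = d)
    {S : Fin n → Pt d} (hS : s.realArr 0 = padArr S) {y : Pt d}
    (hy : ∀ l : Fin d, s.realArr 5 0 l = y l) :
    Runs w nearest s (80 * (n * d)) fun s' => s'.natReg 7 = nearestIndex hn S y := by
  refine Runs.mono (Runs.seq (Runs.conseq (Runs.forLoop (fun t s' =>
    ∀ i : Fin n, (i : ℕ) < t → s'.realArr 7 0 i = dist y (S i) ^ 2)
    (c := d * (2 * 1 + 2 * 1 + 21) + 7 + 4) (N := n) (by decide) (by decide) (by decide)
    h0 (by simp) ?_) ?_) (B' := n * 17 + 7)) ?_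
  · intro t ht s' hf h15 hI
    refine Runs.mono (Runs.seq (Runs.conseq (runs_sqDist (d := d) ?_ ?_ ?_) (B := _) ?_)
      (B' := 4)) (by simp [NatExpr.cost])
    · rw [hf.natReg 1 (by decide), h1]
    · intro _ _; rfl
    · intro s'' hf''
      exact hf''.natReg 15 (by decide)
    · intro s'' hf'' h5
      refine Runs.setRealArr ?_
      intro i hi
      have h7 : s''.realArr 7 = s'.realArr 7 := hf''.realArr 7 (by decide)
      have h15' : s''.natReg 15 = t := by rw [hf''.natReg 15 (by decide), h15]
      simp only [NatExpr.eval, RealExpr.eval, Store.setNat_realArr, Store.setRealArr_realArr, h15',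
        true_and]
      rcases Nat.lt_succ_iff_lt_or_eq.1 hi with h | h
      · rw [if_neg h.ne, h7]
        exact hI i h
      · rw [if_pos h, h5]
        refine sum_range_eq_dist_sq y (S i) (fun l => ?_) (fun l => ?_)
        · rw [hf.realArr 5 (by decide)]; exact hy l
        · rw [hf.realArr 0 (by decide), hS]
          simp only [NatExpr.eval, h15]
          rw [← h, padArr_apply]
  · intro s' hf hI
    refine Runs.conseq (runs_argmin hn (by rw [hf.natReg 0 (by decide), h0])) ?_
    rintro s'' - ⟨h2, h3, h4⟩
    have : (⟨s''.natReg 7, h2⟩ : Fin n) = nearestIndex hn S y := by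
      symm
      rw [nearestIndex_eq_iff]
      refine ⟨fun j => ?_, fun j hj => ?_⟩
      · have := h3 j j.2
        rw [hI j j.2, hI ⟨_, h2⟩ h2] at this
        exact (pow_le_pow_iff_left₀ dist_nonneg dist_nonneg two_ne_zero).1 this
      · have := h4 j hj
        rw [hI j j.2, hI ⟨_, h2⟩ h2] at this
        exact (pow_lt_pow_iff_left₀ dist_nonneg dist_nonneg two_ne_zero).1 this
    rw [← this]
  · have : 1 ≤ n * d := Nat.mul_pos hn hd
    have h2 : n ≤ n * d := Nat.le_mul_of_pos_right n hd
    nlinarith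

theorem runs_scan {n : ℕ} (hn : 1 ≤ n) (h0 : s.natReg 0 = n)
    (hv : ∀ j < n, 0 ≤ s.realArr 8 0 j) :
    Runs w scan s (n * 30) fun s' =>
      s'.natReg 8 = scanIndex n (s.realArr 8 0) (s.realReg 6) := by
  refine Runs.mono (Runs.seq (Runs.seq (Runs.setNat (Runs.setReal (Runs.conseq (Runs.loop
    (c := 10) (T := n - 1)
    (fun t s' => s'.natReg 8 = t ∧ t < n ∧ s'.realReg 7 =
      ∑ i ∈ Finset.range (t + 1), s.realArr 8 0 i ∧
      ∀ j < t, ∑ i ∈ Finset.range (j + 1), s.realArr 8 0 i ≤ s.realReg 6) ?_ ?_ ?_) ?_))))) ?_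
  · simp [RealExpr.eval, NatExpr.eval]; omega
  · intro t s' h; omega
  · rintro t s' hf ⟨h1, h2, h3, h4⟩ ⟨h5, h6⟩
    have e0 : s'.natReg 0 = n := by rw [hf.natReg 0 (by decide)]; simpa using h0
    have e6 : s'.realReg 6 = s.realReg 6 := by rw [hf.realReg 6 (by decide)]; simp
    have e8 : s'.realArr 8 = s.realArr 8 := by rw [hf.realArr 8 (by decide)]; simp
    simp only [BoolExpr.Holds, NatExpr.eval, RealExpr.eval, h1, e0, e6, h3, not_lt] at h5 h6
    refine Runs.mono (Runs.seq (Runs.setNat (Runs.setReal ?_))) (by simp [NatExpr.cost,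
      RealExpr.cost])
    refine ⟨by simp [NatExpr.eval, h1], h5, ?_, ?_⟩
    · simp only [NatExpr.eval, RealExpr.eval, h1, Store.setReal_realReg, if_true,
        Store.setNat_realReg, h3, Store.setNat_realArr, e8, Store.setNat_natReg]
      rw [Finset.sum_range_succ _ (t + 1)]
    · intro j hj
      rcases Nat.lt_succ_iff_lt_or_eq.1 hj with h | rfl
      · exact h4 j h
      · exact h6
  · rintro s' hf ⟨⟨t, h1, h2, h3, h4⟩, hb⟩
    have e0 : s'.natReg 0 = n := by rw [hf.natReg 0 (by decide)]; simpa using h0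
    have e6 : s'.realReg 6 = s.realReg 6 := by rw [hf.realReg 6 (by decide)]; simp
    simp only [BoolExpr.Holds, NatExpr.eval, RealExpr.eval, h1, e0, e6, h3, not_and, not_not] at hb
    rw [h1]
    exact (scanIndex_eq hv h2 h4 hb).symm
  · simp only [NatExpr.cost, RealExpr.cost, BoolExpr.cost]
    omega

end Specs

/-! ### The laws of the samples -/

section Sampling

variable {n d m : ℕ}

/-- The index `scanIndex n v u` as an element of `Fin n`. -/
noncomputable def sampleIndex (hn : 1 ≤ n) (v : ℕ → ℝ) (u : ℝ) : Fin n :=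
  ⟨scanIndex n v u, scanIndex_lt hn v u⟩

theorem measurable_sampleIndex (hn : 1 ≤ n) (v : ℕ → ℝ) :
    Measurable fun u : unitInterval => sampleIndex hn v u := by
  have h : Measurable fun u : unitInterval => scanIndex n v u := by
    unfold scanIndex
    simp_rw [Finset.card_filter]
    refine Finset.measurable_sum _ fun j _ => Measurable.ite ?_ measurable_const measurable_const
    exact measurableSet_le measurable_const measurable_subtype_coe
  refine measurable_to_countable' fun j => ?_
  have e : (fun u : unitInterval => sampleIndex hn v u) ⁻¹' {j} =
      (fun u : unitInterval => scanIndex n v u) ⁻¹' {(j : ℕ)} := by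
    ext u; simp [sampleIndex, Fin.ext_iff]
  rw [e]
  exact h (measurableSet_singleton _)

theorem le_scanIndex_iff {v : ℕ → ℝ} (hv : ∀ j < n, 0 ≤ v j) {j : ℕ} (hj : j < n)
    (u : unitInterval) : j ≤ scanIndex n v u ↔ ∑ i ∈ Finset.range j, v i ≤ u := by
  have hmono : ∀ a b, a ≤ b → b ≤ n →
      ∑ i ∈ Finset.range a, v i ≤ ∑ i ∈ Finset.range b, v i := fun a b hab hb =>
    Finset.sum_le_sum_of_subset_of_nonneg (Finset.range_mono hab) fun i hi _ =>
      hv i (by have := Finset.mem_range.1 hi; omega)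
  constructor
  · intro h
    by_contra hc
    have h0 : j ≠ 0 := by
      rintro rfl
      exact hc (by simpa using u.2.1)
    have hsub : ((Finset.range (n - 1)).filter
        fun k => ∑ i ∈ Finset.range (k + 1), v i ≤ u) ⊆ Finset.range (j - 1) := by
      intro k hk
      simp only [Finset.mem_filter, Finset.mem_range] at hk ⊢
      by_contra hkj
      exact hc ((hmono j (k + 1) (by omega) (by omega)).trans hk.2)
    have := Finset.card_le_card hsub
    rw [Finset.card_range] at this
    unfold scanIndex at h
    omega
  · intro h
    have hsub : Finset.range j ⊆ (Finset.range (n - 1)).filter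
        fun k => ∑ i ∈ Finset.range (k + 1), v i ≤ u := by
      intro k hk
      simp only [Finset.mem_filter, Finset.mem_range] at hk ⊢
      exact ⟨by omega, (hmono (k + 1) j (by omega) hj.le).trans h⟩
    have := Finset.card_le_card hsub
    rwa [Finset.card_range] at this

theorem volume_sampleIndex_eq (hn : 1 ≤ n) {v : ℕ → ℝ} (hv : ∀ j < n, 0 ≤ v j)
    (hs : ∑ i ∈ Finset.range n, v i = 1) (j : Fin n) :
    volume {u : unitInterval | sampleIndex hn v u = j} = ENNReal.ofReal (v j) := by
  have hle1 : ∀ b, b ≤ n → ∑ i ∈ Finset.range b, v i ≤ 1 := fun b hb => hs ▸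
    Finset.sum_le_sum_of_subset_of_nonneg (Finset.range_mono hb) fun i hi _ =>
      hv i (Finset.mem_range.1 hi)
  have hge0 : ∀ b, b ≤ n → 0 ≤ ∑ i ∈ Finset.range b, v i := fun b hb =>
    Finset.sum_nonneg fun i hi => hv i (by have := Finset.mem_range.1 hi; omega)
  have hvol : ∀ b, b ≤ n → volume {u : unitInterval | b ≤ scanIndex n v u} =
      ENNReal.ofReal (1 - ∑ i ∈ Finset.range b, v i) := by
    intro b hb
    rcases hb.lt_or_eq with h | rfl
    · have e : {u : unitInterval | b ≤ scanIndex n v u} =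
          Set.Ici ⟨∑ i ∈ Finset.range b, v i, hge0 b hb, hle1 b hb⟩ := by
        ext u
        rw [Set.mem_ofPred_eq, le_scanIndex_iff hv h]
        rfl
      rw [e, unitInterval.volume_Ici]
    · have e : {u : unitInterval | b ≤ scanIndex b v u} = ∅ := by
        ext u
        have := scanIndex_lt hn v u
        simp; omega
      rw [e, hs]; simp
  have e : {u : unitInterval | sampleIndex hn v u = j} =
      {u : unitInterval | (j : ℕ) ≤ scanIndex n v u} \
        {u : unitInterval | (j : ℕ) + 1 ≤ scanIndex n v u} := by
    ext u
    simp only [Set.mem_ofPred_eq, Set.mem_sdiff, sampleIndex, Fin.ext_iff]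
    omega
  have hmeas : MeasurableSet {u : unitInterval | (j : ℕ) + 1 ≤ scanIndex n v u} := by
    have := measurable_sampleIndex hn v (MeasurableSet.of_discrete (s := {i : Fin n | j < i}))
    exact this
  have hsub : {u : unitInterval | (j : ℕ) + 1 ≤ scanIndex n v u} ⊆
      {u : unitInterval | (j : ℕ) ≤ scanIndex n v u} := fun u hu => Nat.le_of_succ_le hu
  rw [e, measure_sdiff hsub hmeas.nullMeasurableSet (measure_ne_top _ _), hvol _ j.2.le, hvol _ j.2,
    ← ENNReal.ofReal_sub _ (by linarith [hle1 _ j.2]), Finset.sum_range_succ]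
  congr 1; ring

theorem lintegral_sampleIndex (hn : 1 ≤ n) {v : ℕ → ℝ} (hv : ∀ j < n, 0 ≤ v j)
    (hs : ∑ i ∈ Finset.range n, v i = 1) (f : Fin n → ℝ≥0∞) :
    ∫⁻ u : unitInterval, f (sampleIndex hn v u) = ∑ j : Fin n, ENNReal.ofReal (v j) * f j := by
  have hm := measurable_sampleIndex hn v
  rw [← lintegral_map (μ := volume) (measurable_from_top (f := f)) hm, lintegral_fintype]
  refine Finset.sum_congr rfl fun j _ => ?_
  rw [Measure.map_apply hm (measurableSet_singleton _), mul_comm]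
  congr 1
  exact volume_sampleIndex_eq hn hv hs j

/-- The `k`-th block of length `d` of a sequence. -/
noncomputable def block (d : ℕ) (g : ℕ → ℝ) (k : ℕ) : Pt d :=
  WithLp.toLp 2 fun l : Fin d => g (k * d + l)

theorem map_block (d m : ℕ) :
    (Measure.infinitePi fun _ : ℕ => gaussianReal 0 1).map
      (fun g (k : Fin m) => block d g k) = Measure.pi fun _ => stdGaussian (Pt d) := by
  have hinj : Function.Injective fun p : Fin m × Fin d => (p.1 : ℕ) * d + p.2 := by
    intro p q h
    have h' : (p.1 : ℕ) * d + p.2 = q.1 * d + q.2 := h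
    have e1 : (p.1 : ℕ) = q.1 := by
      have hd : 0 < d := p.2.pos
      have h1 : ∀ a b : ℕ, b < d → (a * d + b) / d = a := fun a b hb => by
        rw [mul_comm, Nat.mul_add_div hd, Nat.div_eq_of_lt hb, add_zero]
      rw [← h1 p.1 p.2 p.2.2, h', h1 q.1 q.2 q.2.2]
    have e2 : (p.2 : ℕ) = q.2 := by rw [e1] at h'; omega
    exact Prod.ext (Fin.ext e1) (Fin.ext e2)
  have h1 := Measure.map_infinitePi_infinitePi_of_inj (P := fun _ : ℕ => gaussianReal 0 1) hinj
  have h2 := Measure.infinitePi_map_curry fun (_ : Fin m) (_ : Fin d) => gaussianReal 0 1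
  have h3 := Measure.infinitePi_map_pi (fun _ : Fin m =>
    Measure.infinitePi fun _ : Fin d => gaussianReal 0 1)
    (f := fun _ => WithLp.toLp 2) (fun _ => by fun_prop)
  rw [← h2, ← h1, Measure.map_map (by fun_prop) (by fun_prop),
    Measure.map_map (by fun_prop) (by fun_prop)] at h3
  have h4 : (Measure.infinitePi fun _ : Fin d => gaussianReal 0 1).map (WithLp.toLp 2) =
      stdGaussian (Pt d) := by
    rw [Measure.infinitePi_eq_pi, map_pi_eq_stdGaussian]
  simp only [h4] at h3
  have h5 := Measure.infinitePi_eq_pi (μ := fun _ : Fin m => stdGaussian (Pt d))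
  exact h3.trans h5

theorem map_sampleIndex_uniform (hn : 1 ≤ n) :
    (volume : Measure unitInterval).map
      (fun u : unitInterval => sampleIndex hn (fun _ => 1 / (n : ℝ)) u) =
      uniformOn Set.univ := by
  have hn0 : (n : ℝ) ≠ 0 := by positivity
  have hm := measurable_sampleIndex hn fun _ => 1 / (n : ℝ)
  refine Measure.ext_of_lintegral _ fun f hf => ?_
  rw [lintegral_map hf hm, lintegral_sampleIndex hn (fun _ _ => by positivity)
    (by simp [hn0]), lintegral_uniformOn, Finset.mul_sum]
  refine Finset.sum_congr rfl fun j _ => ?_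
  rw [one_div, ENNReal.ofReal_inv_of_pos (by positivity), ENNReal.ofReal_natCast]

/-- The seed of the rounding step that is read off from a random source. -/
noncomputable def tapeSeed (hn : 1 ≤ n) (d m : ℕ) (w : Tape) : Seed n d m :=
  (fun k => sampleIndex hn (fun _ => 1 / (n : ℝ)) (w.1 k), fun k => block d w.2 k)

theorem measurePreserving_tapeSeed (hn : 1 ≤ n) (d m : ℕ) :
    MeasurePreserving (tapeSeed hn d m) tapeLaw (seedLaw n d m) := by
  have : NeZero n := ⟨by omega⟩
  have h1 : MeasurePreserving (fun (g : ℕ → ℝ) (k : Fin m) => block d g k)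
      (Measure.infinitePi fun _ : ℕ => gaussianReal 0 1)
      (Measure.pi fun _ => stdGaussian (Pt d)) :=
    ⟨by unfold block; fun_prop, map_block d m⟩
  have h2 : MeasurePreserving
      (fun (u : ℕ → unitInterval) (k : Fin m) => sampleIndex hn (fun _ => 1 / (n : ℝ)) (u k))
      (Measure.infinitePi fun _ : ℕ => (volume : Measure unitInterval))
      (Measure.pi fun _ => uniformOn (Set.univ : Set (Fin n))) := by
    have hm : Measurable fun u : unitInterval => sampleIndex hn (fun _ => 1 / (n : ℝ)) u :=
      measurable_sampleIndex hn _
    refine ⟨measurable_pi_lambda _ fun k => hm.comp (measurable_pi_apply _), ?_⟩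
    have h3 := Measure.map_infinitePi_infinitePi_of_inj
      (P := fun _ : ℕ => (volume : Measure unitInterval)) (Fin.val_injective (n := m))
    have h4 := Measure.infinitePi_map_pi (fun _ : Fin m => (volume : Measure unitInterval))
      (f := fun _ u => sampleIndex hn (fun _ => 1 / (n : ℝ)) (u : ℝ)) fun _ => hm
    have hm' : Measurable fun (u : Fin m → unitInterval) (k : Fin m) =>
        sampleIndex hn (fun _ => 1 / (n : ℝ)) (u k) :=
      measurable_pi_lambda _ fun k => hm.comp (measurable_pi_apply _)
    rw [← h3, Measure.map_map hm' (by fun_prop)] at h4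
    simp only [map_sampleIndex_uniform hn] at h4
    have h5 := Measure.infinitePi_eq_pi (μ := fun _ : Fin m => uniformOn (Set.univ : Set (Fin n)))
    exact h4.trans h5
  exact h2.prod h1

/-- The kernel that sends a point whose nearest source point is `S i` to `T j` with probability
`v i j`. -/
noncomputable def rowKernel (hn : 1 ≤ n) (S T : Fin n → Pt d) (v : Fin n → ℕ → ℝ) :
    Kernel (Pt d) (Pt d) :=
  (Kernel.ofFunOfCountable fun i : Fin n =>
    (volume : Measure unitInterval).map fun u : unitInterval => T (sampleIndex hn (v i) u)).comap
      (nearestIndex hn S) (measurable_nearestIndex_right hn S)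

theorem measurable_comp_sampleIndex (hn : 1 ≤ n) (T : Fin n → Pt d) (v : ℕ → ℝ) :
    Measurable fun u : unitInterval => T (sampleIndex hn v u) :=
  (measurable_from_top (f := T)).comp (measurable_sampleIndex hn v)

theorem rowKernel_apply (hn : 1 ≤ n) (S T : Fin n → Pt d) (v : Fin n → ℕ → ℝ) (x : Pt d) :
    rowKernel hn S T v x = (volume : Measure unitInterval).map
      fun u : unitInterval => T (sampleIndex hn (v (nearestIndex hn S x)) u) := rfl

theorem isMarkovKernel_rowKernel (hn : 1 ≤ n) (S T : Fin n → Pt d) (v : Fin n → ℕ → ℝ) :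
    IsMarkovKernel (rowKernel hn S T v) := by
  refine ⟨fun x => ?_⟩
  rw [rowKernel_apply]
  exact Measure.isProbabilityMeasure_map (measurable_comp_sampleIndex hn T _).aemeasurable

attribute [irreducible] rowKernel

theorem nearestIndex_nearest (hn : 1 ≤ n) (S : Fin n → Pt d) (z : Pt d) :
    nearestIndex hn S (S (nearestIndex hn S z)) = nearestIndex hn S z := by
  have h := isFirstNearest_nearestIndex hn S z
  rw [nearestIndex_eq_iff]
  refine ⟨fun j => by simp, fun j hj => ?_⟩
  rw [dist_self, dist_pos]
  intro he
  exact absurd (h.2 j hj) (by rw [← he]; exact lt_irrefl _)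

theorem lintegral_rowKernel (hn : 1 ≤ n) (S T : Fin n → Pt d) (v : Fin n → ℕ → ℝ) (x : Pt d)
    {f : Pt d → ℝ≥0∞} (hf : Measurable f) :
    ∫⁻ y, f y ∂(rowKernel hn S T v x) =
      ∫⁻ u : unitInterval, f (T (sampleIndex hn (v (nearestIndex hn S x)) u)) := by
  rw [rowKernel_apply, lintegral_map hf (measurable_comp_sampleIndex hn T _)]

/-- The output of a query at `x`, as a function of the random source. -/
noncomputable def queryOutput (hn : 1 ≤ n) (S T : Fin n → Pt d) (σ : ℝ) (v : Fin n → ℕ → ℝ)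
    (x : Pt d) (w : Tape) : Pt d :=
  T (sampleIndex hn (v (nearestIndex hn S (x + σ • block d w.2 0))) (w.1 0))

theorem measurable_query (hn : 1 ≤ n) (S T : Fin n → Pt d) (σ : ℝ) (v : Fin n → ℕ → ℝ)
    (x : Pt d) : Measurable fun p : unitInterval × Pt d =>
      T (sampleIndex hn (v (nearestIndex hn S (x + σ • p.2))) p.1) := by
  have h1 : Measurable fun q : unitInterval × Fin n => T (sampleIndex hn (v q.2) q.1) :=
    measurable_from_prod_countable_left fun i => measurable_comp_sampleIndex hn T (v i)
  have h2 : Measurable fun p : unitInterval × Pt d =>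
      (p.1, nearestIndex hn S (x + σ • p.2)) := by
    refine measurable_fst.prodMk ?_
    have h3 : Measurable fun p : unitInterval × Pt d => x + σ • p.2 := by fun_prop
    exact (measurable_nearestIndex_right hn S).comp h3
  exact h1.comp h2

theorem map_tape_query (d : ℕ) :
    tapeLaw.map (fun w => (w.1 0, block d w.2 0)) =
      (volume : Measure unitInterval).prod (stdGaussian (Pt d)) := by
  have hb : Measurable fun g : ℕ → ℝ => block d g 0 := by unfold block; fun_prop
  have h1 : (Measure.infinitePi fun _ : ℕ => gaussianReal 0 1).map (fun g => block d g 0) =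
      stdGaussian (Pt d) := by
    have h2 := congrArg (fun μ => μ.map fun f : Fin 1 → Pt d => f 0) (map_block d 1)
    have h3 : Measurable fun g : ℕ → ℝ => fun k : Fin 1 => block d g k := by
      unfold block; fun_prop
    simp only at h2
    rw [Measure.map_map (by fun_prop) h3, (measurePreserving_eval _ (0 : Fin 1)).map_eq] at h2
    exact h2
  rw [← h1, ← Measure.infinitePi_map_eval (fun _ : ℕ => (volume : Measure unitInterval)) 0]
  rw [Measure.map_prod_map _ _ (by fun_prop) hb]
  rfl

theorem measurable_queryOutput (hn : 1 ≤ n) (S T : Fin n → Pt d) (σ : ℝ) (v : Fin n → ℕ → ℝ)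
    (x : Pt d) : Measurable (queryOutput hn S T σ v x) := by
  have hb : Measurable fun w : Tape => (w.1 0, block d w.2 0) := by unfold block; fun_prop
  have hq := measurable_query hn S T σ v x
  have e : queryOutput hn S T σ v x = (fun p : unitInterval × Pt d =>
      T (sampleIndex hn (v (nearestIndex hn S (x + σ • p.2))) p.1)) ∘
        fun w : Tape => (w.1 0, block d w.2 0) := rfl
  rw [e]
  exact hq.comp hb

theorem map_queryOutput (hn : 1 ≤ n) (S T : Fin n → Pt d) (σ : ℝ) (v : Fin n → ℕ → ℝ)
    (x : Pt d) :
    tapeLaw.map (queryOutput hn S T σ v x) = outputKernel S σ (rowKernel hn S T v) x := by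
  have hb : Measurable fun w : Tape => (w.1 0, block d w.2 0) := by unfold block; fun_prop
  have hq := measurable_query hn S T σ v x
  have := isMarkovKernel_rowKernel hn S T v
  refine Measure.ext_of_lintegral _ fun f hf => ?_
  have hL : tapeLaw.map (queryOutput hn S T σ v x) =
      ((volume : Measure unitInterval).prod (stdGaussian (Pt d))).map fun p : unitInterval × Pt d =>
        T (sampleIndex hn (v (nearestIndex hn S (x + σ • p.2))) p.1) := by
    rw [← map_tape_query, Measure.map_map hq hb]
    rfl
  have hfq : Measurable fun p : unitInterval × Pt d =>
      f (T (sampleIndex hn (v (nearestIndex hn S (x + σ • p.2))) p.1)) := hf.comp hq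
  have hz : Measurable fun z : Pt d => x + σ • z := by fun_prop
  have hk : Measurable fun y => ∫⁻ c, f c ∂(rowKernel hn S T v y) := hf.lintegral_kernel
  have hkp : Measurable fun y => ∫⁻ c, f c ∂(rowKernel hn S T v (proj S y)) :=
    hk.comp (measurable_proj S)
  rw [hL, lintegral_map hf hq, lintegral_prod_symm _ hfq.aemeasurable, outputKernel_eq,
    Kernel.lintegral_comp _ _ _ hf, roundingKernel_apply, gaussConv_apply,
    lintegral_map hk (measurable_proj S), lintegral_map hkp hz]
  refine lintegral_congr fun z => ?_
  rw [lintegral_rowKernel hn S T v _ hf, proj_eq_nearestIndex hn, nearestIndex_nearest]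

end Sampling

/-! ### Evaluation of the learned kernel -/

/-- Perturb the query, find the nearest source point, and sample a target point with the weights in
the corresponding row of the real array `6`. -/
def evaluateProg : Prog :=
  .seq (perturb 2 (.lit 0)) (.seq nearest (.seq
    (forLoop 5 0 (.setRealArr 8 (.lit 0) (.reg 5) (.arr 6 (.reg 7) (.reg 5))))
    (.seq (.drawUnif 6) (.seq scan
      (forLoop 6 1 (.setRealArr 3 (.lit 0) (.reg 6) (.arr 1 (.reg 8) (.reg 6))))))))

/-- The memory that training leaves need only contain the sizes, the bandwidth, both families of
points and the non-negative weights. -/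
theorem samples_evaluateProg {n d : ℕ} (hn : 1 ≤ n) (hd : 1 ≤ d) {s : Store} {S T : Fin n → Pt d}
    {σ : ℝ} (h0 : s.natReg 0 = n) (h1 : s.natReg 1 = d) (h3 : s.realReg 3 = σ)
    (hS : s.realArr 0 = padArr S) (hT : s.realArr 1 = padArr T)
    (hv : ∀ i < n, ∀ j < n, 0 ≤ s.realArr 6 i j) :
    Samples evaluateProg s
      (outputKernel S σ (rowKernel hn S T fun i : Fin n => s.realArr 6 i)) (200 * (n * d)) := by
  intro x
  refine ⟨queryOutput hn S T σ (fun i : Fin n => s.realArr 6 i) x, measurable_queryOutput ..,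
    map_queryOutput .., fun w => ?_⟩
  set q := queryStore s x with hq
  set y : Pt d := x + σ • block d w.2 0 with hy
  set J := nearestIndex hn S y with hJ
  have q0 : q.natReg 0 = n := h0
  have q1 : q.natReg 1 = d := h1
  have q3 : q.realReg 3 = σ := h3
  have qA : ∀ A, A ≠ 2 → q.realArr A = s.realArr A := fun A hA => by
    simp [hq, queryStore, hA]
  have q2 : ∀ l : Fin d, q.realArr 2 0 l = x l := fun l => by simp [hq, queryStore, pad]
  have key : Runs w evaluateProg q (200 * (n * d)) fun s' =>
      answer d s' = queryOutput hn S T σ (fun i : Fin n => s.realArr 6 i) x w := by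
    refine Runs.mono (Runs.seq (Runs.conseq (runs_perturb (d := d) (by decide) q1
      fun _ _ => rfl) ?_)) (B := d * (1 + 17) + 5 + (80 * (n * d) + ((n * (6 + 7) + 5) +
        (1 + (n * 30 + (d * (6 + 7) + 5)))))) ?_
    swap
    · have e1 : n ≤ n * d := Nat.le_mul_of_pos_right n hd
      have e2 : d ≤ n * d := Nat.le_mul_of_pos_left d hn
      have e3 : 1 ≤ n * d := Nat.mul_pos hn hd
      omega
    rintro s1 f1 ⟨p1, -⟩
    refine Runs.seq (Runs.conseq (runs_nearest hn hd ((f1.natReg 0 (by decide)).trans q0)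
      ((f1.natReg 1 (by decide)).trans q1) (S := S) (y := y) ?_ ?_) ?_)
    · rw [f1.realArr 0 (by decide), qA 0 (by decide), hS]
    · intro l
      rw [p1 l l.2, q3]
      have e : q.realArr 2 (NatExpr.eval q (.lit 0)) l = x l := q2 l
      rw [e]
      simp [hy, block, hq, queryStore]
    intro s2 f2 p2
    have hv6 : s2.realArr 6 = s.realArr 6 := by
      rw [f2.realArr 6 (by decide), f1.realArr 6 (by decide), qA 6 (by decide)]
    have n2 : s2.natReg 0 = n := by rw [f2.natReg 0 (by decide), f1.natReg 0 (by decide), q0]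
    refine Runs.seq (Runs.conseq (Runs.forLoop (N := n) (c := 6) (fun t s' =>
      ∀ j < t, s'.realArr 8 0 j = s.realArr 6 J j) (by decide) (by decide) (by decide)
        n2 (by simp) ?_) ?_)
    · intro t ht s' f r5 I
      refine Runs.mono (Runs.setRealArr ?_) (by simp [NatExpr.cost, RealExpr.cost])
      intro j hj
      simp only [NatExpr.eval, RealExpr.eval, r5, Store.setNat_realArr, Store.setRealArr_realArr,
        true_and, f.natReg 7 (by decide), p2, f.realArr 6 (by decide), hv6]
      by_cases h : j = t
      · simp [h, hJ]
      · simpa [h] using I j (by omega)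
    intro s3 f3 p3
    refine Runs.seq (Runs.drawUnif ?_)
    refine Runs.seq (Runs.conseq (runs_scan (n := n) hn ?_ ?_) ?_)
    · simp [f3.natReg 0 (by decide), n2]
    · intro j hj
      simpa [p3 j hj] using hv J J.2 j hj
    intro s4 f4 p4
    have hu : (s3.setReal 6 (w.1 s3.unifPos)).stepUnif.realReg 6 = w.1 0 := by
      have : s3.unifPos = 0 := by
        rw [f3.unifPos (by decide), f2.unifPos (by decide), f1.unifPos (by decide)]; rfl
      simp [this]
    have hidx : s4.natReg 8 = sampleIndex hn (s.realArr 6 J) (w.1 0) := by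
      rw [p4, hu]
      exact scanIndex_congr p3 _
    refine Runs.conseq (Runs.forLoop (N := d) (c := 6) (fun t s' =>
      ∀ l < t, s'.realArr 3 0 l = s4.realArr 1 (s4.natReg 8) l) (by decide) (by decide)
        (by decide) ?_ (by simp) ?_) ?_
    · simp [f4.natReg 1 (by decide), f3.natReg 1 (by decide), f2.natReg 1 (by decide),
        f1.natReg 1 (by decide), q1]
    · intro t ht s' f r6 I
      refine Runs.mono (Runs.setRealArr ?_) (by simp [NatExpr.cost, RealExpr.cost])
      intro l hl
      simp only [NatExpr.eval, RealExpr.eval, r6, Store.setNat_realArr, Store.setRealArr_realArr,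
        true_and, f.natReg 8 (by decide), f.realArr 1 (by decide)]
      by_cases h : l = t
      · simp [h]
      · simpa [h] using I l (by omega)
    · intro s5 f5 p5
      have hT4 : s4.realArr 1 = padArr T := by
        rw [f4.realArr 1 (by decide)]
        simp only [Store.stepUnif_realArr, Store.setReal_realArr]
        rw [f3.realArr 1 (by decide),
          f2.realArr 1 (by decide), f1.realArr 1 (by decide), qA 1 (by decide), hT]
      ext l
      change s5.realArr 3 0 l = _
      rw [p5 l l.2, hidx, hT4, padArr_apply]
      rfl
  obtain ⟨t, s', e1, e2, e3⟩ := key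
  exact ⟨t, s', e1, by exact_mod_cast e2, e3⟩

/-! ### The auction algorithm for optimal transport -/

/-- The state of an auction between `n` sources and `n` targets, in which every target offers `B`
slots. Source `i` is named by `i + 1`, and `0` stands for nobody. The price of the target `j` is
proportional to `lvl j`; its slots are sold cyclically, and `lvl j` increases by one whenever all of
them have been sold at the current price. The sources bid one after the other for as many slots as
they demand. -/
structure Auction where
  /-- the owner of each slot of each target -/
  owner : ℕ → ℕ → ℕ
  /-- the next slot that each target sells -/
  ptr : ℕ → ℕ
  /-- the price levels -/
  lvl : ℕ → ℕ
  /-- `count o j` is the number of slots of the target `j` owned by `o`, for `o ≠ 0` -/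
  count : ℕ → ℕ → ℕ
  /-- the source that is to bid now, if any -/
  cur : ℕ
  /-- the source whose units are being introduced -/
  src : ℕ
  /-- the number of units of that source introduced so far -/
  unit : ℕ

namespace Auction

variable (a : Auction) (n B b : ℕ) (U : ℕ → ℕ) (c : ℕ → ℕ → ℝ) (ε : ℝ)

/-- A further unit of the present source enters the auction. -/
def introduce : Auction := { a with cur := a.src + 1, unit := a.unit + 1 }

/-- Pass to the next source. -/
def advance : Auction := { a with src := a.src + 1, unit := 0 }

/-- The present bidder takes the next slot of the target `b`, and its former owner becomes the
bidder. -/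
def bid : Auction where
  owner j s := if j = b ∧ s = a.ptr b then a.cur else a.owner j s
  ptr j := if j = b then if a.ptr b + 1 < B then a.ptr b + 1 else 0 else a.ptr j
  lvl j := if j = b then if a.ptr b + 1 < B then a.lvl b else a.lvl b + 1 else a.lvl j
  count o j :=
    let count' := fun o' j' => if o' = a.owner b (a.ptr b) ∧ j' = b then
      a.count (a.owner b (a.ptr b)) b - 1 else a.count o' j'
    if o = a.cur ∧ j = b then count' a.cur b + 1 else count' o j
  cur := a.owner b (a.ptr b)
  src := a.src
  unit := a.unit

/-- The invariants of the auction with demands `U`, costs `c` and price increment `ε`. -/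
structure Valid : Prop where
  ptr_lt : ∀ j < n, a.ptr j < B
  /-- the slots from the pointer on are empty as long as the price is zero -/
  empty : ∀ j < n, ∀ s < B, a.lvl j = 0 → a.ptr j ≤ s → a.owner j s = 0
  /-- all other slots have been sold, and a sold slot never becomes empty again -/
  filled : ∀ j < n, ∀ s < B, s < a.ptr j ∨ a.lvl j ≠ 0 → a.owner j s ≠ 0
  owner_le : ∀ j < n, ∀ s < B, a.owner j s ≤ n
  /-- every owner is content with its slot up to `ε`, and exactly if the slot was sold at the
  current price -/
  slack : ∀ j < n, ∀ s < B, ∀ j' < n, a.owner j s ≠ 0 →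
    c (a.owner j s - 1) j + ε * a.lvl j ≤
      c (a.owner j s - 1) j' + ε * a.lvl j' + if a.ptr j ≤ s then ε else 0
  count_eq : ∀ o, o ≠ 0 → ∀ j < n, a.count o j =
    ∑ s ∈ Finset.range B, if a.owner j s = o then 1 else 0
  /-- all units that have been introduced own a slot, except that of the present bidder -/
  total : ∀ i < n, ∑ j ∈ Finset.range n, a.count (i + 1) j + (if a.cur = i + 1 then 1 else 0) =
    if i < a.src then U i else if i = a.src then a.unit else 0
  unit_le : a.src < n → a.unit ≤ U a.src
  src_le : a.src ≤ n
  cur_le : a.cur ≤ n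
  /-- after the last source nobody is left without a slot -/
  done : a.src = n → a.cur = 0 ∧ a.unit = 0
  lvl_le : ∀ j < n, a.lvl j ≤ B + 1

/-- The number of steps that led to a state. -/
def clock : ℕ :=
  ∑ j ∈ Finset.range n, (B * a.lvl j + a.ptr j) + ∑ i ∈ Finset.range a.src, U i + a.unit + a.src

variable {a n B b U c ε}

theorem Valid.introduce (h : a.Valid n B U c ε) (hcur : a.cur = 0) (hsrc : a.src < n)
    (hu : a.unit < U a.src) : a.introduce.Valid n B U c ε where
  ptr_lt := h.ptr_lt
  empty := h.empty
  filled := h.filled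
  owner_le := h.owner_le
  slack := h.slack
  count_eq := h.count_eq
  total i hi := by
    have := h.total i hi
    simp only [Auction.introduce, hcur, add_left_inj, (Nat.succ_ne_zero i).symm, if_false] at this ⊢
    rcases lt_trichotomy i a.src with h3 | h3 | h3
    · simpa [h3, h3.ne'] using this
    · subst h3; simpa using this
    · have e1 : ¬ i < a.src := by omega
      simpa [e1, h3.ne, h3.ne'] using this
  unit_le _ := hu
  src_le := h.src_le
  cur_le := hsrc
  done h' := absurd h' hsrc.ne
  lvl_le := h.lvl_le

theorem clock_introduce : a.introduce.clock n B U = a.clock n B U + 1 := by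
  simp only [clock, introduce]; omega

theorem Valid.advance (h : a.Valid n B U c ε) (hcur : a.cur = 0) (hsrc : a.src < n)
    (hu : ¬ a.unit < U a.src) : a.advance.Valid n B U c ε where
  ptr_lt := h.ptr_lt
  empty := h.empty
  filled := h.filled
  owner_le := h.owner_le
  slack := h.slack
  count_eq := h.count_eq
  total i hi := by
    have h1 := h.total i hi
    have h2 := h.unit_le hsrc
    simp only [Auction.advance, hcur] at h1 ⊢
    rw [h1]
    rcases lt_trichotomy i a.src with h3 | h3 | h3
    · simp [h3, h3.trans (Nat.lt_succ_self _)]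
    · subst h3; simp; omega
    · have e1 : ¬ i < a.src := by omega
      have e2 : ¬ i = a.src := by omega
      have e3 : ¬ i < a.src + 1 := by omega
      simp [e1, e2, e3]
  unit_le _ := Nat.zero_le _
  src_le := hsrc
  cur_le := by simp [Auction.advance, hcur]
  done _ := ⟨hcur, rfl⟩
  lvl_le := h.lvl_le

theorem clock_advance (h : a.Valid n B U c ε) (hsrc : a.src < n) (hu : ¬ a.unit < U a.src) :
    a.advance.clock n B U = a.clock n B U + 1 := by
  have := h.unit_le hsrc
  simp only [clock, Auction.advance, Finset.sum_range_succ]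
  omega

/-- Every slot with an owner is counted once. -/
theorem sum_owner_eq (f : ℕ → ℕ) {B : ℕ} (hf : ∀ s < B, f s ≤ n) (hf0 : ∀ s < B, f s ≠ 0) :
    ∑ i ∈ Finset.range n, ∑ s ∈ Finset.range B, (if f s = i + 1 then 1 else 0) = B := by
  rw [Finset.sum_comm]
  have : ∀ s ∈ Finset.range B, ∑ i ∈ Finset.range n, (if f s = i + 1 then 1 else 0) = 1 := by
    intro s hs
    have h1 := hf s (Finset.mem_range.1 hs)
    have h2 := hf0 s (Finset.mem_range.1 hs)
    rw [Finset.sum_eq_single (f s - 1)]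
    · rw [if_pos (by omega)]
    · intro i _ hi
      rw [if_neg (by omega)]
    · intro hi
      exact absurd (Finset.mem_range.2 (by omega)) hi
  rw [Finset.sum_congr rfl this]
  simp

theorem Valid.sum_total (h : a.Valid n B U c ε) :
    ∑ i ∈ Finset.range n, (if i < a.src then U i else if i = a.src then a.unit else 0) ≤
      ∑ i ∈ Finset.range n, U i := by
  refine Finset.sum_le_sum fun i hi => ?_
  have hi' := Finset.mem_range.1 hi
  split_ifs with h1 h2
  · exact le_rfl
  · subst h2; exact h.unit_le hi'
  · exact Nat.zero_le _

/-- While somebody bids, the demand is not met, and therefore some target has empty slots, which are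
free. -/
theorem Valid.exists_lvl_eq_zero (h : a.Valid n B U c ε)
    (hU : ∑ i ∈ Finset.range n, U i ≤ n * B) (hcur : a.cur ≠ 0) : ∃ j < n, a.lvl j = 0 := by
  by_contra! hcon
  have h1 : ∑ i ∈ Finset.range n, ∑ j ∈ Finset.range n, a.count (i + 1) j = n * B := by
    rw [Finset.sum_comm]
    have : ∀ j ∈ Finset.range n, ∑ i ∈ Finset.range n, a.count (i + 1) j = B := by
      intro j hj
      have hj' := Finset.mem_range.1 hj
      rw [Finset.sum_congr rfl fun i _ => h.count_eq (i + 1) (Nat.succ_ne_zero i) j hj']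
      exact sum_owner_eq _ (h.owner_le j hj') fun s hs =>
        h.filled j hj' s hs (Or.inr (hcon j hj'))
    rw [Finset.sum_congr rfl this]
    simp
  have h2 := Finset.sum_congr (rfl : Finset.range n = Finset.range n) fun i hi =>
    h.total i (Finset.mem_range.1 hi)
  rw [Finset.sum_add_distrib, h1] at h2
  have h3 : ∑ i ∈ Finset.range n, (if a.cur = i + 1 then 1 else 0) = 1 := by
    have hc := h.cur_le
    rw [Finset.sum_eq_single (a.cur - 1)]
    · rw [if_pos (by omega)]
    · intro i _ hi
      rw [if_neg (by omega)]
    · intro hi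
      exact absurd (Finset.mem_range.2 (by omega)) hi
  have h4 := h.sum_total
  omega

theorem sum_update_slot (f : ℕ → ℕ) {B p : ℕ} (hp : p < B) (v o : ℕ) :
    (∑ s ∈ Finset.range B, if (if s = p then v else f s) = o then 1 else 0) +
        (if f p = o then 1 else 0) =
      (∑ s ∈ Finset.range B, if f s = o then 1 else 0) + if v = o then 1 else 0 := by
  have hm := Finset.mem_range.2 hp
  rw [← Finset.add_sum_erase _ _ hm,
    ← Finset.add_sum_erase _ (fun s => if f s = o then 1 else 0) hm]
  have : ∀ s ∈ (Finset.range B).erase p, (if (if s = p then v else f s) = o then 1 else 0) =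
      if f s = o then 1 else 0 := fun s hs => by rw [if_neg (Finset.ne_of_mem_erase hs)]
  rw [Finset.sum_congr rfl this]
  simp only [if_true]
  omega

/-- The new owner of the slot gains one, the former owner loses one, and nothing changes if they are
the same. -/
theorem Valid.count_bid (h : a.Valid n B U c ε) (hb : b < n) {o : ℕ} (ho : o ≠ 0) :
    (a.bid B b).count o b + (if a.owner b (a.ptr b) = o then 1 else 0) =
      a.count o b + if a.cur = o then 1 else 0 := by
  have h1 : a.owner b (a.ptr b) = o → 1 ≤ a.count o b := by
    intro h2
    rw [h.count_eq o ho b hb]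
    have := Finset.single_le_sum (f := fun s => if a.owner b s = o then 1 else 0)
      (fun _ _ => Nat.zero_le _) (Finset.mem_range.2 (h.ptr_lt b hb))
    simpa [h2] using this
  simp only [bid, and_true]
  by_cases h2 : a.owner b (a.ptr b) = o
  · have := h1 h2
    by_cases h3 : a.cur = o
    · subst h3; simp [h2]
      omega
    · have h3' : ¬ o = a.cur := fun h => h3 h.symm
      simp [h2, h3, h3']; omega
  · have h2' : ¬ o = a.owner b (a.ptr b) := fun h => h2 h.symm
    by_cases h3 : a.cur = o
    · subst h3; simp [h2, h2']
    · have h3' : ¬ o = a.cur := fun h => h3 h.symm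
      simp [h2, h2', h3, h3']

theorem lvl_le_bid (j : ℕ) : a.lvl j ≤ (a.bid B b).lvl j := by
  simp only [bid]
  split_ifs with h1 h2
  · rw [h1]
  · rw [h1]; omega
  · exact le_rfl

/-- A bid at a cheapest target preserves the invariants. Here `ε B` bounds the variation of the
costs of a source, so that the price of a cheapest target is at most `ε B` while there are free
slots. -/
theorem Valid.bid (h : a.Valid n B U c ε) (hε : 0 < ε)
    (hU : ∑ i ∈ Finset.range n, U i ≤ n * B)
    (hc : ∀ i < n, ∀ j < n, ∀ j' < n, c i j ≤ c i j' + ε * B) (hcur : a.cur ≠ 0)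
    (hsrc : a.src < n) (hb : b < n)
    (hmin : ∀ j < n, c (a.cur - 1) b + ε * a.lvl b ≤ c (a.cur - 1) j + ε * a.lvl j) :
    (a.bid B b).Valid n B U c ε where
  ptr_lt j hj := by
    have := h.ptr_lt j hj
    simp only [Auction.bid]
    split_ifs <;> omega
  empty j hj s hs h1 h2 := by
    simp only [Auction.bid] at h1 h2 ⊢
    by_cases hjb : j = b
    · subst hjb
      simp only [if_true, true_and] at h1 h2 ⊢
      split_ifs at h1 h2 ⊢ with h3 h4
      · omega
      · exact h.empty j hj s hs h1 (by omega)
    · simp only [hjb, if_false, false_and] at h1 h2 ⊢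
      exact h.empty j hj s hs h1 h2
  filled j hj s hs h1 := by
    have hp := h.ptr_lt j hj
    simp only [Auction.bid] at h1 ⊢
    by_cases hjb : j = b
    · subst hjb
      simp only [if_true, true_and] at h1 ⊢
      by_cases hs' : s = a.ptr j
      · rw [if_pos hs']; exact hcur
      · rw [if_neg hs']
        refine h.filled j hj s hs ?_
        split_ifs at h1 <;> omega
    · simp only [hjb, if_false, false_and] at h1 ⊢
      exact h.filled j hj s hs h1
  owner_le j hj s hs := by
    simp only [Auction.bid]
    split_ifs
    · exact h.cur_le
    · exact h.owner_le j hj s hs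
  slack j hj s hs j' hj' := by
    have hp := h.ptr_lt j hj
    have hl : ε * (a.lvl j' : ℝ) ≤ ε * ((a.bid B b).lvl j' : ℝ) :=
      mul_le_mul_of_nonneg_left (by exact_mod_cast lvl_le_bid j') hε.le
    intro ho
    by_cases hslot : j = b ∧ s = a.ptr b
    · obtain ⟨rfl, rfl⟩ := hslot
      have h1 := hmin j' hj'
      have e1 : (a.bid B j).owner j (a.ptr j) = a.cur := by simp [Auction.bid]
      rw [e1]
      by_cases hw : a.ptr j + 1 < B
      · have e2 : (a.bid B j).lvl j = a.lvl j := by simp [Auction.bid, hw]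
        rw [e2]
        have : (0 : ℝ) ≤ if (a.bid B j).ptr j ≤ a.ptr j then ε else 0 := by
          split_ifs <;> simp [hε.le]
        linarith
      · -- the last slot has been sold, so the price rises at once, and the slack `ε` is allowed
        have e2 : (a.bid B j).lvl j = a.lvl j + 1 := by simp [Auction.bid, hw]
        have e3 : (a.bid B j).ptr j = 0 := by simp [Auction.bid, hw]
        rw [e2, e3, if_pos (Nat.zero_le _)]
        push_cast
        linarith
    · have e1 : (a.bid B b).owner j s = a.owner j s := by simp [Auction.bid, hslot]
      rw [e1] at ho ⊢
      have h1 := h.slack j hj s hs j' hj' ho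
      by_cases hjb : j = b
      · subst hjb
        have hsp : s ≠ a.ptr j := fun h => hslot ⟨rfl, h⟩
        by_cases hw : a.ptr j + 1 < B
        · have e2 : (a.bid B j).lvl j = a.lvl j := by simp [Auction.bid, hw]
          have e3 : (a.bid B j).ptr j = a.ptr j + 1 := by simp [Auction.bid, hw]
          rw [e2, e3]
          split_ifs at h1 ⊢ <;> first | linarith | omega
        · have e2 : (a.bid B j).lvl j = a.lvl j + 1 := by simp [Auction.bid, hw]
          have e3 : (a.bid B j).ptr j = 0 := by simp [Auction.bid, hw]
          rw [e2, e3, if_pos (Nat.zero_le _)]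
          rw [if_neg (by omega)] at h1
          push_cast
          linarith
      · have e2 : (a.bid B b).lvl j = a.lvl j := by simp [Auction.bid, hjb]
        have e3 : (a.bid B b).ptr j = a.ptr j := by simp [Auction.bid, hjb]
        rw [e2, e3]
        linarith
  count_eq o ho j hj := by
    by_cases hjb : j = b
    · subst hjb
      have h1 := h.count_bid hb ho (B := B) (b := j)
      have h2 := sum_update_slot (a.owner j) (h.ptr_lt j hj) a.cur o
      rw [← h.count_eq o ho j hj] at h2
      have e : ∀ s, (a.bid B j).owner j s = if s = a.ptr j then a.cur else a.owner j s :=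
        fun s => by simp [Auction.bid]
      simp only [e]
      omega
    · have e1 : (a.bid B b).count o j = a.count o j := by simp [Auction.bid, hjb]
      have e2 : ∀ s, (a.bid B b).owner j s = a.owner j s := fun s => by simp [Auction.bid, hjb]
      simp only [e1, e2]
      exact h.count_eq o ho j hj
  total i hi := by
    have h1 := h.total i hi
    have h2 := h.count_bid hb (Nat.succ_ne_zero i) (B := B)
    have hm := Finset.mem_range.2 hb
    have e1 : ∀ j ∈ (Finset.range n).erase b, (a.bid B b).count (i + 1) j = a.count (i + 1) j :=
      fun j hj => by simp [Auction.bid, Finset.ne_of_mem_erase hj]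
    have s1 : (a.bid B b).count (i + 1) b +
          ∑ j ∈ (Finset.range n).erase b, (a.bid B b).count (i + 1) j =
        ∑ j ∈ Finset.range n, (a.bid B b).count (i + 1) j := Finset.add_sum_erase _ _ hm
    have s2 : a.count (i + 1) b + ∑ j ∈ (Finset.range n).erase b, a.count (i + 1) j =
        ∑ j ∈ Finset.range n, a.count (i + 1) j := Finset.add_sum_erase _ _ hm
    have s3 : ∑ j ∈ (Finset.range n).erase b, (a.bid B b).count (i + 1) j =
        ∑ j ∈ (Finset.range n).erase b, a.count (i + 1) j := Finset.sum_congr rfl e1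
    have e2 : (a.bid B b).cur = a.owner b (a.ptr b) := rfl
    have e3 : (a.bid B b).src = a.src := rfl
    have e4 : (a.bid B b).unit = a.unit := rfl
    rw [e2, e3, e4, ← h1]
    simp only [Nat.succ_eq_add_one] at h2
    omega
  unit_le := h.unit_le
  src_le := h.src_le
  cur_le := h.owner_le b hb _ (h.ptr_lt b hb)
  done h' := absurd h' hsrc.ne
  lvl_le j hj := by
    -- compare with a target that still has price `0`
    have h1 : a.lvl b ≤ B := by
      obtain ⟨j₀, hj₀, h0⟩ := h.exists_lvl_eq_zero hU hcur
      have h2 := hmin j₀ hj₀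
      have h3 := hc (a.cur - 1) (by have := h.cur_le; omega) j₀ hj₀ b hb
      rw [h0] at h2
      have h4 : ε * (a.lvl b : ℝ) ≤ ε * B := by push_cast at h2; linarith
      exact_mod_cast le_of_mul_le_mul_left h4 hε
    have := h.lvl_le j hj
    simp only [Auction.bid]
    split_ifs <;> omega

theorem clock_bid (h : a.Valid n B U c ε) (hb : b < n) :
    (a.bid B b).clock n B U = a.clock n B U + 1 := by
  have hm := Finset.mem_range.2 hb
  have hp := h.ptr_lt b hb
  have e1 : ∀ j ∈ (Finset.range n).erase b, B * (a.bid B b).lvl j + (a.bid B b).ptr j =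
      B * a.lvl j + a.ptr j :=
    fun j hj => by simp [Auction.bid, Finset.ne_of_mem_erase hj]
  have e2 : B * (a.bid B b).lvl b + (a.bid B b).ptr b = B * a.lvl b + a.ptr b + 1 := by
    simp only [Auction.bid, if_true]
    split_ifs
    · omega
    · rw [mul_add]; omega
  have e3 : (a.bid B b).src = a.src := rfl
  have e4 : (a.bid B b).unit = a.unit := rfl
  rw [clock, clock, ← Finset.add_sum_erase _ _ hm, ← Finset.add_sum_erase _ (fun j =>
    B * a.lvl j + a.ptr j) hm, Finset.sum_congr rfl e1, e2, e3, e4]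
  omega

/-- The levels, the demands and the number of sources bound the clock, hence the number of steps. -/
theorem Valid.clock_le (h : a.Valid n B U c ε) (hU : ∑ i ∈ Finset.range n, U i ≤ n * B) :
    a.clock n B U ≤ n * (B * (B + 2)) + n * B + n := by
  have h1 : ∑ j ∈ Finset.range n, (B * a.lvl j + a.ptr j) ≤ n * (B * (B + 2)) := by
    refine (Finset.sum_le_card_nsmul _ _ (B * (B + 2)) fun j hj => ?_).trans (by simp)
    have hj' := Finset.mem_range.1 hj
    have h2 := Nat.mul_le_mul_left B (h.lvl_le j hj')
    have h3 := h.ptr_lt j hj'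
    have : B * (B + 2) = B * (B + 1) + B := by ring
    omega
  have h2 : ∑ i ∈ Finset.range a.src, U i + a.unit ≤ ∑ i ∈ Finset.range n, U i := by
    rcases h.src_le.lt_or_eq with h3 | h3
    · have h4 := h.unit_le h3
      have h5 : ∑ i ∈ Finset.range (a.src + 1), U i ≤ ∑ i ∈ Finset.range n, U i :=
        Finset.sum_le_sum_of_subset (Finset.range_mono h3)
      rw [Finset.sum_range_succ] at h5
      omega
    · rw [(h.done h3).2, h3, add_zero]
  have h3 := h.src_le
  unfold clock
  omega

/-- The auction before the first step. -/
def start : Auction := ⟨fun _ _ => 0, fun _ => 0, fun _ => 0, fun _ _ => 0, 0, 0, 0⟩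

theorem valid_start (hB : 1 ≤ B) : start.Valid n B U c ε where
  ptr_lt _ _ := hB
  empty _ _ _ _ _ _ := rfl
  filled j hj s hs h := by simp [start] at h
  owner_le _ _ _ _ := Nat.zero_le _
  slack j hj s hs j' hj' h := absurd rfl h
  count_eq o ho j hj := by
    have : ¬ 0 = o := fun h => ho h.symm
    simp [start, this]
  total i hi := by
    simp only [start]
    by_cases h : i = 0 <;> simp [h]
  unit_le _ := Nat.zero_le _
  src_le := Nat.zero_le _
  cur_le := Nat.zero_le _
  done _ := ⟨rfl, rfl⟩
  lvl_le _ _ := Nat.zero_le _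

theorem clock_start : start.clock n B U = 0 := by simp [clock, start]

end Auction

/-! ### From the auction to a transport plan -/

section Plan

variable (n B m : ℕ) (k : ℕ → ℕ) (N : ℕ → ℕ → ℕ)

/-- The mass at the source `i` that has not been assigned, when a slot holds the mass `1 / (n B)`
and `N i j` slots of the target `j` belong to the source `i`. -/
noncomputable def srcRest (i : ℕ) : ℝ :=
  (k i : ℝ) / m - ∑ j ∈ Finset.range n, (N i j : ℝ) / ((n : ℝ) * B)

/-- The mass that the target `j` still misses. -/
noncomputable def tgtRest (j : ℕ) : ℝ :=
  1 / (n : ℝ) - ∑ i ∈ Finset.range n, (N i j : ℝ) / ((n : ℝ) * B)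

/-- The transport plan of the assigned slots, completed by the product of the remainders. -/
noncomputable def plan (i j : ℕ) : ℝ :=
  (N i j : ℝ) / ((n : ℝ) * B) +
    srcRest n B m k N i * tgtRest n B N j / ∑ j ∈ Finset.range n, tgtRest n B N j

variable {n B m k N}

theorem sum_srcRest (hm : 1 ≤ m) (hk : ∑ i ∈ Finset.range n, k i = m) (hn : 1 ≤ n) :
    ∑ i ∈ Finset.range n, srcRest n B m k N i = ∑ j ∈ Finset.range n, tgtRest n B N j := by
  have hm0 : (m : ℝ) ≠ 0 := by positivity
  have hn0 : (n : ℝ) ≠ 0 := by positivity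
  unfold srcRest tgtRest
  rw [Finset.sum_sub_distrib, Finset.sum_sub_distrib, Finset.sum_comm (s := Finset.range n)
    (f := fun j i => (N i j : ℝ) / ((n : ℝ) * B)), ← Finset.sum_div, ← Nat.cast_sum, hk]
  simp [hm0, hn0]

theorem tgtRest_nonneg (hn : 1 ≤ n) (hB : 1 ≤ B)
    (hN : ∀ j < n, ∑ i ∈ Finset.range n, N i j ≤ B) {j : ℕ} (hj : j < n) :
    0 ≤ tgtRest n B N j := by
  have hn0 : (0 : ℝ) < n := by positivity
  have hB0 : (0 : ℝ) < B := by positivity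
  have h : ((∑ i ∈ Finset.range n, N i j : ℕ) : ℝ) ≤ B := by exact_mod_cast hN j hj
  push_cast at h
  rw [tgtRest, ← Finset.sum_div, sub_nonneg, div_le_div_iff₀ (by positivity) hn0]
  nlinarith

theorem srcRest_mem (hn : 1 ≤ n) (hB : 1 ≤ B) (hm : 1 ≤ m)
    (hN : ∀ i < n, ∑ j ∈ Finset.range n, N i j = k i * (n * B) / m) {i : ℕ} (hi : i < n) :
    0 ≤ srcRest n B m k N i ∧ srcRest n B m k N i ≤ 1 / ((n : ℝ) * B) := by
  have hn0 : (0 : ℝ) < n := by positivity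
  have hB0 : (0 : ℝ) < B := by positivity
  have hm0 : (0 : ℝ) < m := by positivity
  set u := k i * (n * B) / m with hu
  have h : ((∑ j ∈ Finset.range n, N i j : ℕ) : ℝ) = u := by rw [hN i hi]
  push_cast at h
  have h1 : (u : ℝ) * m ≤ k i * (n * B) := by exact_mod_cast Nat.div_mul_le_self _ _
  have h2 : (k i : ℝ) * (n * B) ≤ (u + 1) * m := by
    have := (Nat.div_lt_iff_lt_mul (Nat.pos_of_ne_zero (by omega : m ≠ 0))).1
      (Nat.lt_succ_self (k i * (n * B) / m))
    exact_mod_cast this.le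
  rw [srcRest, ← Finset.sum_div, h]
  constructor
  · rw [sub_nonneg, div_le_div_iff₀ (by positivity) hm0]
    exact h1
  · rw [sub_le_iff_le_add, ← add_div, div_le_div_iff₀ hm0 (by positivity)]
    linarith

theorem plan_nonneg (hr : ∀ i < n, 0 ≤ srcRest n B m k N i) (hq : ∀ j < n, 0 ≤ tgtRest n B N j)
    {i j : ℕ} (hi : i < n) (hj : j < n) : 0 ≤ plan n B m k N i j := by
  have h1 := hr i hi
  have h2 := hq j hj
  have h3 : 0 ≤ ∑ j ∈ Finset.range n, tgtRest n B N j :=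
    Finset.sum_nonneg fun j hj => hq j (Finset.mem_range.1 hj)
  unfold plan
  positivity

theorem sum_plan_row (hn : 1 ≤ n) (hm : 1 ≤ m) (hk : ∑ i ∈ Finset.range n, k i = m)
    (hr : ∀ i < n, 0 ≤ srcRest n B m k N i) {i : ℕ} (hi : i < n) :
    ∑ j ∈ Finset.range n, plan n B m k N i j = (k i : ℝ) / m := by
  unfold plan
  rw [Finset.sum_add_distrib, ← Finset.sum_div, ← Finset.sum_div, ← Finset.mul_sum]
  have : srcRest n B m k N i * (∑ j ∈ Finset.range n, tgtRest n B N j) /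
      (∑ j ∈ Finset.range n, tgtRest n B N j) = srcRest n B m k N i := by
    by_cases h0 : ∑ j ∈ Finset.range n, tgtRest n B N j = 0
    · rw [← sum_srcRest hm hk hn] at h0
      have := (Finset.sum_eq_zero_iff_of_nonneg fun i hi => hr i (Finset.mem_range.1 hi)).1 h0 i
        (Finset.mem_range.2 hi)
      rw [this]; simp
    · exact mul_div_cancel_right₀ _ h0
  rw [this, srcRest, Finset.sum_div]
  ring

theorem sum_plan_col (hn : 1 ≤ n) (hm : 1 ≤ m) (hk : ∑ i ∈ Finset.range n, k i = m)
    (hq : ∀ j < n, 0 ≤ tgtRest n B N j) {j : ℕ} (hj : j < n) :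
    ∑ i ∈ Finset.range n, plan n B m k N i j = 1 / (n : ℝ) := by
  unfold plan
  rw [Finset.sum_add_distrib, ← Finset.sum_div, ← Finset.sum_div, ← Finset.sum_mul,
    sum_srcRest hm hk hn]
  have : (∑ j ∈ Finset.range n, tgtRest n B N j) * tgtRest n B N j /
      (∑ j ∈ Finset.range n, tgtRest n B N j) = tgtRest n B N j := by
    by_cases h0 : ∑ j ∈ Finset.range n, tgtRest n B N j = 0
    · have := (Finset.sum_eq_zero_iff_of_nonneg fun i hi => hq i (Finset.mem_range.1 hi)).1 h0 j
        (Finset.mem_range.2 hj)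
      rw [this]; simp
    · exact mul_div_cancel_left₀ _ h0
  rw [this, tgtRest, Finset.sum_div]
  ring

/-- Approximate complementary slackness: the assigned mass is almost content, and the remaining mass
is so small that a slack of `D` does not matter for it. -/
theorem plan_cost_le (hn : 1 ≤ n) (hB : 1 ≤ B) (hm : 1 ≤ m)
    (hk : ∑ i ∈ Finset.range n, k i = m)
    (hr : ∀ i < n, 0 ≤ srcRest n B m k N i ∧ srcRest n B m k N i ≤ 1 / ((n : ℝ) * B))
    (hq : ∀ j < n, 0 ≤ tgtRest n B N j) {c : ℕ → ℕ → ℝ} {φ : ℕ → ℝ} {ε D : ℝ} (hε : 0 ≤ ε)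
    (hD : 0 ≤ D) (hDB : D ≤ ε * B)
    (h1 : ∀ i < n, ∀ j < n, N i j ≠ 0 → c i j ≤ φ i + ε)
    (h2 : ∀ i < n, ∀ j < n, tgtRest n B N j ≠ 0 → c i j ≤ φ i + D) :
    ∑ i ∈ Finset.range n, ∑ j ∈ Finset.range n, plan n B m k N i j * c i j ≤
      ∑ i ∈ Finset.range n, (k i : ℝ) / m * φ i + 2 * ε := by
  have hn0 : (0 : ℝ) < n := by positivity
  have hB0 : (0 : ℝ) < B := by positivity
  set R := ∑ j ∈ Finset.range n, tgtRest n B N j with hR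
  have hR0 : 0 ≤ R := Finset.sum_nonneg fun j hj => hq j (Finset.mem_range.1 hj)
  have hRB : R ≤ 1 / B := by
    rw [hR, ← sum_srcRest hm hk hn]
    refine (Finset.sum_le_card_nsmul _ _ _ fun i hi => (hr i (Finset.mem_range.1 hi)).2).trans ?_
    rw [Finset.card_range, nsmul_eq_mul]
    refine le_of_eq ?_
    field_simp
  have hentry : ∀ i ∈ Finset.range n, ∀ j ∈ Finset.range n,
      plan n B m k N i j * c i j ≤ plan n B m k N i j * φ i + ε * ((N i j : ℝ) / ((n : ℝ) * B)) +
        D * (srcRest n B m k N i * tgtRest n B N j / R) := by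
    intro i hi j hj
    have hi' := Finset.mem_range.1 hi
    have hj' := Finset.mem_range.1 hj
    have e1 : (N i j : ℝ) / ((n : ℝ) * B) * c i j ≤ (N i j : ℝ) / ((n : ℝ) * B) * (φ i + ε) := by
      by_cases h0 : N i j = 0
      · simp [h0]
      · exact mul_le_mul_of_nonneg_left (h1 i hi' j hj' h0) (by positivity)
    have e2 : srcRest n B m k N i * tgtRest n B N j / R * c i j ≤
        srcRest n B m k N i * tgtRest n B N j / R * (φ i + D) := by
      by_cases h0 : tgtRest n B N j = 0
      · simp [h0]
      · exact mul_le_mul_of_nonneg_left (h2 i hi' j hj' h0)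
          (div_nonneg (mul_nonneg (hr i hi').1 (hq j hj')) hR0)
    unfold plan
    rw [← hR]
    linarith
  refine (Finset.sum_le_sum fun i hi => Finset.sum_le_sum (hentry i hi)).trans ?_
  have s1 : ∑ i ∈ Finset.range n, ∑ j ∈ Finset.range n, plan n B m k N i j * φ i =
      ∑ i ∈ Finset.range n, (k i : ℝ) / m * φ i := by
    refine Finset.sum_congr rfl fun i hi => ?_
    rw [← Finset.sum_mul, sum_plan_row hn hm hk (fun i hi => (hr i hi).1) (Finset.mem_range.1 hi)]
  have s2 : ∑ i ∈ Finset.range n, ∑ j ∈ Finset.range n,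
      srcRest n B m k N i * tgtRest n B N j / R ≤ R := by
    simp_rw [← Finset.sum_div, ← Finset.mul_sum, ← hR]
    rw [← Finset.sum_mul, sum_srcRest hm hk hn, ← hR]
    by_cases h0 : R = 0
    · simp [h0]
    · rw [mul_div_cancel_right₀ _ h0]
  have s3 : ∑ i ∈ Finset.range n, ∑ j ∈ Finset.range n, (N i j : ℝ) / ((n : ℝ) * B) ≤ 1 := by
    rw [Finset.sum_comm]
    refine (Finset.sum_le_card_nsmul _ _ (1 / (n : ℝ)) fun j hj => ?_).trans ?_
    · have := hq j (Finset.mem_range.1 hj)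
      unfold tgtRest at this
      linarith
    · rw [Finset.card_range, nsmul_eq_mul]
      refine le_of_eq ?_
      field_simp
  have s4 : D * R ≤ ε := by
    calc D * R ≤ D * (1 / B) := mul_le_mul_of_nonneg_left hRB hD
      _ ≤ ε * B * (1 / B) := mul_le_mul_of_nonneg_right hDB (by positivity)
      _ = ε := by field_simp
  simp only [Finset.sum_add_distrib, ← Finset.mul_sum]
  rw [s1]
  have t1 := mul_le_mul_of_nonneg_left s3 hε
  have t2 := mul_le_mul_of_nonneg_left s2 hD
  linarith

end Plan

section Kernel

variable {n d m : ℕ} {S T : Fin n → Pt d}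

/-- The number of points of the tuple `J` of indices that equal `i`. -/
def hits (J : Fin m → Fin n) (i : ℕ) : ℕ := ∑ a, if (J a : ℕ) = i then 1 else 0

theorem sum_hits (J : Fin m → Fin n) : ∑ i ∈ Finset.range n, hits J i = m := by
  unfold hits
  rw [Finset.sum_comm]
  simp

/-- Averaging over the rounded points with the conditional laws of a plan is summation over the
plan. -/
theorem average_conditional (hm : 1 ≤ m) (J : Fin m → Fin n) {P : ℕ → ℕ → ℝ}
    (hP : ∀ i < n, ∀ j < n, 0 ≤ P i j)
    (hrow : ∀ i < n, ∑ j ∈ Finset.range n, P i j = (hits J i : ℝ) / m)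
    (g : Fin n → Fin n → ℝ≥0∞) :
    (m : ℝ≥0∞)⁻¹ * ∑ a, ∑ j : Fin n, ENNReal.ofReal (P (J a) j * m / hits J (J a)) * g (J a) j =
      ∑ i : Fin n, ∑ j : Fin n, ENNReal.ofReal (P i j) * g i j := by
  have hm0 : (0 : ℝ) < m := by positivity
  have e1 : ∀ a, ∑ j : Fin n, ENNReal.ofReal (P (J a) j * m / hits J (J a)) * g (J a) j =
      ∑ i : Fin n, (if (J a : ℕ) = i then 1 else 0) *
        ∑ j : Fin n, ENNReal.ofReal (P i j * m / hits J i) * g i j := by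
    intro a
    symm
    rw [Finset.sum_eq_single (J a)]
    · simp
    · intro i _ hi
      have h' : ¬ (J a : ℕ) = i := fun h => hi (Fin.ext h).symm
      rw [if_neg h', zero_mul]
    · simp
  rw [Finset.sum_congr rfl fun a _ => e1 a, Finset.sum_comm, Finset.mul_sum]
  refine Finset.sum_congr rfl fun i _ => ?_
  rw [← Finset.sum_mul, ← mul_assoc, Finset.mul_sum]
  refine Finset.sum_congr rfl fun j _ => ?_
  rw [← mul_assoc]
  congr 1
  have e2 : (∑ a, if (J a : ℕ) = i then (1 : ℝ≥0∞) else 0) = ENNReal.ofReal (hits J i) := by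
    rw [ENNReal.ofReal_natCast, hits]
    push_cast
    rfl
  rw [e2, ← ENNReal.ofReal_natCast, ← ENNReal.ofReal_inv_of_pos hm0,
    ← ENNReal.ofReal_mul (by positivity), ← ENNReal.ofReal_mul (by positivity)]
  congr 1
  by_cases h0 : hits J i = 0
  · have h1 := hrow i i.2
    rw [h0, Nat.cast_zero, zero_div] at h1
    have h2 := (Finset.sum_eq_zero_iff_of_nonneg fun j hj => hP i i.2 j (Finset.mem_range.1 hj)).1
      h1 j (Finset.mem_range.2 j.2)
    rw [h2]; simp
  · have : (hits J i : ℝ) ≠ 0 := by exact_mod_cast h0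
    field_simp

/-- A plan that is optimal up to `τ` for some prices gives an admissible kernel. The function `φ` is
the potential on the side of the sources that belongs to the prices `p`. -/
theorem isApproxOTKernel_rowKernel (hn : 1 ≤ n) (hm : 1 ≤ m) (J : Fin m → Fin n)
    (hJ : ∀ a, nearestIndex hn S (S (J a)) = J a) {P : ℕ → ℕ → ℝ}
    (hP : ∀ i < n, ∀ j < n, 0 ≤ P i j)
    (hrow : ∀ i < n, ∑ j ∈ Finset.range n, P i j = (hits J i : ℝ) / m)
    (hcol : ∀ j < n, ∑ i ∈ Finset.range n, P i j = 1 / (n : ℝ))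
    {p : ℕ → ℝ} (hp : ∀ j, 0 ≤ p j) {φ : Pt d → ℝ} (hφ0 : ∀ x, 0 ≤ φ x)
    (hφ : ∀ x y, φ x ≤ φ y + dist x y) (hφT : ∀ j : Fin n, φ (T j) ≤ p j) {τ : ℝ} (hτ : 0 ≤ τ)
    (hcost : ∑ i : Fin n, ∑ j : Fin n, P i j * (dist (S i) (T j) + p j) ≤
      ∑ i : Fin n, (hits J i : ℝ) / m * φ (S i) + τ) :
    IsApproxOTKernel (fun a => S (J a)) T τ
      (rowKernel hn S T fun i j => P i j * m / hits J i) := by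
  have hmk := isMarkovKernel_rowKernel hn S T fun i j => P i j * m / hits J i
  have hm0 : (0 : ℝ) < m := by positivity
  have hn0 : (0 : ℝ) < n := by positivity
  have hlin : ∀ (a : Fin m) {f : Pt d → ℝ≥0∞}, Measurable f →
      ∫⁻ y, f y ∂(rowKernel hn S T (fun i j => P i j * m / hits J i) (S (J a))) =
        ∑ j : Fin n, ENNReal.ofReal (P (J a) j * m / hits J (J a)) * f (T j) := by
    intro a f hf
    have hpos : (0 : ℝ) < hits J (J a) := by
      have : 0 < hits J (J a) :=
        Finset.sum_pos' (fun _ _ => Nat.zero_le _) ⟨a, Finset.mem_univ _, by simp⟩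
      exact_mod_cast this
    rw [lintegral_rowKernel hn S T _ _ hf, hJ]
    refine lintegral_sampleIndex hn (fun j hj => ?_) ?_ fun j => f (T j)
    · have := hP (J a) (J a).2 j hj
      positivity
    · rw [← Finset.sum_div, ← Finset.sum_mul, hrow _ (J a).2]
      field_simp
  refine ⟨hmk, fun x => ?_, ?_, ?_⟩
  · rw [rowKernel_apply, Measure.map_apply (measurable_comp_sampleIndex hn T _)
      (Set.finite_range T).measurableSet.compl]
    convert measure_empty (μ := (volume : Measure unitInterval))
    ext u
    simp
  · refine Measure.ext_of_lintegral _ fun f hf => ?_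
    rw [Measure.lintegral_bind (Kernel.aemeasurable _) hf.aemeasurable, lintegral_empirical,
      lintegral_empirical, Finset.sum_congr rfl fun a _ => hlin a hf,
      average_conditional hm J hP hrow fun _ j => f (T j), Finset.sum_comm, Finset.mul_sum]
    refine Finset.sum_congr rfl fun j _ => ?_
    rw [← Finset.sum_mul,
      ← ENNReal.ofReal_sum_of_nonneg fun i _ => hP _ (Fin.is_lt _) _ (Fin.is_lt _),
      Fin.sum_univ_eq_sum_range (fun i => P i j), hcol j j.2, one_div,
      ENNReal.ofReal_inv_of_pos hn0, ENNReal.ofReal_natCast]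
  · have hc1 : kernelCost (rowKernel hn S T fun i j => P i j * m / hits J i)
        (empirical fun a => S (J a)) =
        ENNReal.ofReal (∑ i : Fin n, ∑ j : Fin n, P i j * dist (S i) (T j)) := by
      rw [kernelCost, lintegral_empirical, Finset.sum_congr rfl fun a _ => hlin a (by fun_prop),
        average_conditional hm J hP hrow fun i j => edist (S i) (T j),
        ENNReal.ofReal_sum_of_nonneg fun i _ => Finset.sum_nonneg fun j _ =>
          mul_nonneg (hP _ (Fin.is_lt _) _ (Fin.is_lt _)) dist_nonneg]
      refine Finset.sum_congr rfl fun i _ => ?_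
      rw [ENNReal.ofReal_sum_of_nonneg fun j _ =>
        mul_nonneg (hP _ (Fin.is_lt _) _ (Fin.is_lt _)) dist_nonneg]
      refine Finset.sum_congr rfl fun j _ => ?_
      rw [ENNReal.ofReal_mul (hP _ (Fin.is_lt _) _ (Fin.is_lt _)), edist_dist]
    rw [hc1]
    set L := ∑ j : Fin n, 1 / (n : ℝ) * p j with hL
    have hL0 : 0 ≤ L := Finset.sum_nonneg fun j _ => mul_nonneg (by positivity) (hp _)
    have hsplit : ∑ i : Fin n, ∑ j : Fin n, P i j * (dist (S i) (T j) + p j) =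
        ∑ i : Fin n, ∑ j : Fin n, P i j * dist (S i) (T j) + L := by
      simp only [mul_add, Finset.sum_add_distrib]
      congr 1
      rw [Finset.sum_comm, hL]
      refine Finset.sum_congr rfl fun j _ => ?_
      rw [← Finset.sum_mul, Fin.sum_univ_eq_sum_range (fun i => P i j), hcol j j.2]
    have hφm : Measurable φ :=
      (LipschitzWith.of_le_add hφ).continuous.measurable
    -- weak duality: the dual value of the prices is a lower bound of the Wasserstein distance
    have hdual : ENNReal.ofReal (∑ i : Fin n, (hits J i : ℝ) / m * φ (S i)) ≤
        W1 (empirical fun a => S (J a)) (empirical T) + ENNReal.ofReal L := by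
      have e1 : ENNReal.ofReal (∑ i : Fin n, (hits J i : ℝ) / m * φ (S i)) =
          ∫⁻ x, ENNReal.ofReal (φ x) ∂(empirical fun a => S (J a)) := by
        have := average_conditional hm J hP hrow fun i _ => ENNReal.ofReal (φ (S i))
        have e2 : ∀ a : Fin m, ∫⁻ y, (fun _ => ENNReal.ofReal (φ (S (J a)))) y
            ∂(rowKernel hn S T (fun i j => P i j * m / hits J i) (S (J a))) =
            ENNReal.ofReal (φ (S (J a))) := fun a => by simp
        rw [lintegral_empirical, ← Finset.sum_congr rfl fun a _ => e2 a,
          Finset.sum_congr rfl fun a _ => hlin a measurable_const, this,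
          ENNReal.ofReal_sum_of_nonneg fun i _ => mul_nonneg (by positivity) (hφ0 _)]
        refine Finset.sum_congr rfl fun i _ => ?_
        rw [← Finset.sum_mul,
          ← ENNReal.ofReal_sum_of_nonneg fun j _ => hP _ (Fin.is_lt _) _ (Fin.is_lt _),
          Fin.sum_univ_eq_sum_range (fun j => P i j), hrow i i.2,
          ENNReal.ofReal_mul (by positivity)]
      have e3 : ∫⁻ y, ENNReal.ofReal (φ y) ∂(empirical T) ≤ ENNReal.ofReal L := by
        rw [lintegral_empirical, hL, Finset.mul_sum,
          ENNReal.ofReal_sum_of_nonneg fun j _ => mul_nonneg (by positivity) (hp _)]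
        refine Finset.sum_le_sum fun j _ => ?_
        rw [ENNReal.ofReal_mul (by positivity), one_div, ENNReal.ofReal_inv_of_pos hn0,
          ENNReal.ofReal_natCast]
        gcongr
        exact hφT j
      rw [e1]
      have e4 : ∀ π, IsCoupling (empirical fun a => S (J a)) (empirical T) π →
          ∫⁻ x, ENNReal.ofReal (φ x) ∂(empirical fun a => S (J a)) ≤
            ∫⁻ z, edist z.1 z.2 ∂π + ENNReal.ofReal L := by
        intro π hπ
        have hof : Measurable fun x => ENNReal.ofReal (φ x) := hφm.ennreal_ofReal
        refine le_trans ?_ (add_le_add_right e3 _)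
        rw [← hπ.1, ← hπ.2, lintegral_map hof measurable_fst, lintegral_map hof measurable_snd,
          ← lintegral_add_left (by fun_prop)]
        refine lintegral_mono fun z => ?_
        rw [edist_dist, ← ENNReal.ofReal_add dist_nonneg (hφ0 _), add_comm]
        exact ENNReal.ofReal_le_ofReal (hφ z.1 z.2)
      rw [W1, ENNReal.iInf_add]
      refine le_iInf fun π => ?_
      rw [ENNReal.iInf_add]
      exact le_iInf fun hπ => e4 π hπ
    have hfin : ENNReal.ofReal (∑ i : Fin n, ∑ j : Fin n, P i j * dist (S i) (T j)) +
        ENNReal.ofReal L ≤ W1 (empirical fun a => S (J a)) (empirical T) + ENNReal.ofReal τ +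
          ENNReal.ofReal L := by
      rw [← ENNReal.ofReal_add (Finset.sum_nonneg fun i _ => Finset.sum_nonneg fun j _ =>
        mul_nonneg (hP _ (Fin.is_lt _) _ (Fin.is_lt _)) dist_nonneg) hL0, ← hsplit]
      refine (ENNReal.ofReal_le_ofReal hcost).trans ?_
      rw [ENNReal.ofReal_add (Finset.sum_nonneg fun i _ => mul_nonneg (by positivity) (hφ0 _)) hτ,
        add_right_comm]
      gcongr
    exact (ENNReal.add_le_add_iff_right ENNReal.ofReal_ne_top).1 hfin

end Kernel

section Potential

variable {n d : ℕ}

/-- The potential on the side of the sources that belongs to the prices `p` of the targets. -/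
noncomputable def potential [NeZero n] (T : Fin n → Pt d) (p : ℕ → ℝ) (x : Pt d) : ℝ :=
  Finset.univ.inf' Finset.univ_nonempty fun j : Fin n => dist x (T j) + p j

theorem potential_le [NeZero n] (T : Fin n → Pt d) (p : ℕ → ℝ) (x : Pt d) (j : Fin n) :
    potential T p x ≤ dist x (T j) + p j :=
  Finset.inf'_le _ (Finset.mem_univ j)

theorem exists_potential_eq [NeZero n] (T : Fin n → Pt d) (p : ℕ → ℝ) (x : Pt d) :
    ∃ j : Fin n, potential T p x = dist x (T j) + p j := by
  obtain ⟨j, -, hj⟩ := Finset.exists_mem_eq_inf' Finset.univ_nonempty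
    fun j : Fin n => dist x (T j) + p j
  exact ⟨j, hj⟩

theorem potential_le_add_dist [NeZero n] (T : Fin n → Pt d) (p : ℕ → ℝ) (x y : Pt d) :
    potential T p x ≤ potential T p y + dist x y := by
  obtain ⟨j, hj⟩ := exists_potential_eq T p y
  have h1 := potential_le T p x j
  have h2 := dist_triangle x y (T j)
  linarith

end Potential

namespace Auction.Valid

variable {n d m B : ℕ} {a : Auction} {U : ℕ → ℕ} {c : ℕ → ℕ → ℝ} {ε : ℝ}

theorem sum_count_le (h : a.Valid n B U c ε) {j : ℕ} (hj : j < n) :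
    ∑ i ∈ Finset.range n, a.count (i + 1) j ≤ B := by
  rw [Finset.sum_congr rfl fun i _ => h.count_eq (i + 1) (Nat.succ_ne_zero i) j hj,
    Finset.sum_comm]
  refine (Finset.sum_le_card_nsmul _ _ 1 fun s _ => ?_).trans (by simp)
  rw [← Finset.card_filter]
  refine Finset.card_le_one.2 fun x hx y hy => ?_
  have h1 := (Finset.mem_filter.1 hx).2
  have h2 := (Finset.mem_filter.1 hy).2
  omega

/-- At the end of the auction, the plan of the sold slots is optimal up to `2 ε`. -/
theorem isApproxOTKernel (h : a.Valid n B U c ε) (hn : 1 ≤ n) (hB : 1 ≤ B) (hm : 1 ≤ m)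
    (hε : 0 ≤ ε) (hsrc : a.src = n) {S T : Fin n → Pt d} (hT : ∀ j, T j ∈ unitCube d)
    (hc : ∀ i j : Fin n, c i j = dist (S i) (T j)) (J : Fin m → Fin n)
    (hJ : ∀ a, nearestIndex hn S (S (J a)) = J a)
    (hU : ∀ i < n, U i = hits J i * (n * B) / m) (hD : √d ≤ ε * B) :
    (∀ i < n, ∀ j < n, 0 ≤ plan n B m (hits J) (fun i j => a.count (i + 1) j) i j) ∧
    IsApproxOTKernel (fun a => S (J a)) T (2 * ε) (rowKernel hn S T fun i j =>
      plan n B m (hits J) (fun i j => a.count (i + 1) j) i j * m / hits J i) := by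
  have : NeZero n := ⟨by omega⟩
  have hn0 : (0 : ℝ) < n := by positivity
  have hB0 : (0 : ℝ) < B := by positivity
  set N : ℕ → ℕ → ℕ := fun i j => a.count (i + 1) j with hN
  have hrowN : ∀ i < n, ∑ j ∈ Finset.range n, N i j = hits J i * (n * B) / m := by
    intro i hi
    have h1 := h.total i hi
    rw [(h.done hsrc).1, hsrc, if_pos hi, hU i hi] at h1
    simpa using h1
  have hcolN : ∀ j < n, ∑ i ∈ Finset.range n, N i j ≤ B := fun j hj => h.sum_count_le hj
  have hr : ∀ i < n, 0 ≤ srcRest n B m (hits J) N i ∧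
      srcRest n B m (hits J) N i ≤ 1 / ((n : ℝ) * B) := fun i hi => srcRest_mem hn hB hm hrowN hi
  have hq : ∀ j < n, 0 ≤ tgtRest n B N j := fun j hj => tgtRest_nonneg hn hB hcolN hj
  have hk := sum_hits J
  have hpos : ∀ i < n, ∀ j < n, 0 ≤ plan n B m (hits J) N i j := fun i hi j hj =>
    plan_nonneg (fun i hi => (hr i hi).1) hq hi hj
  refine ⟨hpos, ?_⟩
  refine isApproxOTKernel_rowKernel hn hm J hJ hpos
    (fun i hi => sum_plan_row hn hm hk (fun i hi => (hr i hi).1) hi)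
    (fun j hj => sum_plan_col hn hm hk hq hj) (p := fun j => ε * a.lvl j)
    (fun j => by positivity) (φ := potential T fun j => ε * a.lvl j) ?_ ?_ ?_ (by positivity) ?_
  · intro x
    obtain ⟨j, hj⟩ := exists_potential_eq T (fun j => ε * a.lvl j) x
    rw [hj]
    positivity
  · exact potential_le_add_dist T _
  · intro j
    simpa using potential_le T (fun j => ε * a.lvl j) (T j) j
  · set φ : ℕ → ℝ := fun i =>
      if hi : i < n then potential T (fun j => ε * a.lvl j) (S ⟨i, hi⟩) else 0 with hφ
    -- a source is content with the slots that it owns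
    have h1 : ∀ i < n, ∀ j < n, N i j ≠ 0 → c i j + ε * a.lvl j ≤ φ i + ε := by
      intro i hi j hj h0
      rw [hN] at h0
      simp only [h.count_eq (i + 1) (Nat.succ_ne_zero i) j hj] at h0
      obtain ⟨s, hs, hs0⟩ := Finset.exists_ne_zero_of_sum_ne_zero h0
      have ho : a.owner j s = i + 1 := by
        by_contra hne
        simp [hne] at hs0
      obtain ⟨j', hj'⟩ := exists_potential_eq T (fun j => ε * a.lvl j) (S ⟨i, hi⟩)
      have h2 := h.slack j hj s (Finset.mem_range.1 hs) j' j'.2 (by omega)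
      rw [ho, Nat.add_sub_cancel] at h2
      have h3 := hc ⟨i, hi⟩ j'
      simp only at h3
      have h4 : (if a.ptr j ≤ s then ε else 0) ≤ ε := by split_ifs <;> simp [hε]
      rw [hφ]
      simp only [hi, dif_pos, hj']
      linarith
    -- a target with an empty slot has price `0`, and the costs of a source vary by at most `√d`
    have h2 : ∀ i < n, ∀ j < n, tgtRest n B N j ≠ 0 → c i j + ε * a.lvl j ≤ φ i + √d := by
      intro i hi j hj h0
      have hl : a.lvl j = 0 := by
        by_contra hl
        refine h0 ?_
        have e : ∑ i ∈ Finset.range n, N i j = B := by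
          rw [Finset.sum_congr rfl fun i _ => h.count_eq (i + 1) (Nat.succ_ne_zero i) j hj]
          exact sum_owner_eq _ (h.owner_le j hj) fun s hs => h.filled j hj s hs (Or.inr hl)
        have e' : ∑ i ∈ Finset.range n, (N i j : ℝ) = B := by exact_mod_cast e
        rw [tgtRest, ← Finset.sum_div, e']
        field_simp
        ring
      obtain ⟨j', hj'⟩ := exists_potential_eq T (fun j => ε * a.lvl j) (S ⟨i, hi⟩)
      have h3 := hc ⟨i, hi⟩ ⟨j, hj⟩
      simp only at h3
      have h4 := dist_triangle (S ⟨i, hi⟩) (T j') (T ⟨j, hj⟩)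
      have h5 := dist_le_sqrt_of_mem_unitCube (hT j') (hT ⟨j, hj⟩)
      have h6 : 0 ≤ ε * (a.lvl j' : ℝ) := by positivity
      rw [hφ]
      simp only [hi, dif_pos, hj', hl, h3]
      push_cast
      linarith
    have key := plan_cost_le hn hB hm hk hr hq hε (Real.sqrt_nonneg _) hD h1 h2
    rw [← Fin.sum_univ_eq_sum_range (fun i => ∑ j ∈ Finset.range n,
      plan n B m (hits J) N i j * (c i j + ε * a.lvl j)),
      ← Fin.sum_univ_eq_sum_range (fun i => (hits J i : ℝ) / m * φ i)] at key
    refine le_trans (le_of_eq ?_) (key.trans (le_of_eq ?_))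
    · refine Finset.sum_congr rfl fun i _ => ?_
      rw [← Fin.sum_univ_eq_sum_range (fun j => plan n B m (hits J) N i j * (c i j + ε * a.lvl j))]
      exact Finset.sum_congr rfl fun j _ => by rw [hc]
    · congr 1
      exact Finset.sum_congr rfl fun i _ => by simp [hφ]

end Auction.Valid

/-! ### Training: parameters, rounding and costs -/

/-- Compute the bandwidth in the real register `3`, and half the accuracy, which is the price
increment of the auction, in the real register `4`. -/
def paramProg : Prog :=
  .seq (.setReal 3 (.add (.mul
      (.exp (.mul (.log (.lit 3)) (.div (.ofNat (.reg 1)) (.add (.ofNat (.reg 1)) (.lit 2)))))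
      (.exp (.mul (.log (.mul (.ofNat (.reg 0)) (.ofNat (.reg 1))))
        (.div (.lit (-1)) (.add (.ofNat (.reg 1)) (.lit 2))))))
      (.mul (.reg 2) (.sqrt (.reg 0)))))
    (.setReal 4 (.div (.exp (.mul (.log (.ofNat (.reg 0)))
      (.div (.lit (-1)) (.add (.ofNat (.reg 1)) (.lit 2))))) (.lit 2)))

/-- Draw the rounded points, and count in row `0` of the integer array `0` how often every source
point occurs. -/
def roundProg : Prog :=
  .seq (forLoop 5 0 (.setRealArr 8 (.lit 0) (.reg 5) (.div (.lit 1) (.ofNat (.reg 0)))))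
    (forLoop 3 2 (.seq (.drawUnif 6) (.seq scan (.seq (perturb 0 (.reg 8)) (.seq nearest
      (.setNatArr 0 (.lit 0) (.reg 7) (.add (.arr 0 (.lit 0) (.reg 7)) (.lit 1))))))))

/-- Compute all distances between source and target points in the real array `4`. -/
def costProg : Prog :=
  forLoop 4 0 (forLoop 5 0 (.seq (sqDist 0 (.reg 4) 1 (.reg 5))
    (.setRealArr 4 (.reg 4) (.reg 5) (.sqrt (.reg 5)))))

/-- Compute in the integer register `9` the least `B` with `√d ≤ B ε`, where `ε` is in the real
register `4`. -/
def slotProg : Prog :=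
  .seq (.setNat 9 (.lit 0)) (.loop (.realLt (.mul (.ofNat (.reg 9)) (.reg 4))
    (.sqrt (.ofNat (.reg 1)))) (.setNat 9 (.add (.reg 9) (.lit 1))))

section Specs

variable {w : Tape} {s : Store} {n d m : ℕ}

/-- Powers are computed as `x ^ y = exp (log x * y)`. -/
theorem runs_paramProg (hn : 1 ≤ n) (hd : 1 ≤ d) (h0 : s.natReg 0 = n) (h1 : s.natReg 1 = d) :
    Runs w paramProg s 60 fun s' =>
      s'.realReg 3 = bandwidth n d (s.realReg 0) (s.realReg 2) ∧
      s'.realReg 4 = accuracy n d / 2 := by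
  refine Runs.mono (Runs.seq (Runs.setReal (Runs.setReal ⟨?_, ?_⟩)))
    (by simp [RealExpr.cost, NatExpr.cost])
  · have hnd : (0 : ℝ) < (n : ℝ) * d := by positivity
    simp only [RealExpr.eval, NatExpr.eval, Store.setReal_realReg, h0, h1, bandwidth]
    rw [Real.rpow_def_of_pos (by norm_num : (0 : ℝ) < 3), Real.rpow_def_of_pos hnd]
    norm_num
  · have hn0 : (0 : ℝ) < n := by positivity
    simp only [RealExpr.eval, NatExpr.eval, Store.setReal_realReg, Store.setReal_natReg, h0, h1,
      accuracy]
    rw [Real.rpow_def_of_pos hn0]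
    norm_num

/-- The index of the source point to which the `a`-th draw is rounded. -/
noncomputable def roundIndex (hn : 1 ≤ n) (S : Fin n → Pt d) (σ : ℝ) (w : Tape) (a : ℕ) : Fin n :=
  nearestIndex hn S (S (sampleIndex hn (fun _ => 1 / (n : ℝ)) (w.1 a)) + σ • block d w.2 a)

/-- The `a`-th pass of the loop uses the `a`-th uniform number and the `a`-th block of `d` Gaussian
numbers of the random source. -/
theorem runs_roundProg (hn : 1 ≤ n) (hd : 1 ≤ d) (h0 : s.natReg 0 = n) (h1 : s.natReg 1 = d)
    (h2 : s.natReg 2 = m) {S : Fin n → Pt d} (hS : s.realArr 0 = padArr S)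
    (hA : ∀ i, s.natArr 0 0 i = 0) (hu : s.unifPos = 0) (hg : s.gaussPos = 0) :
    Runs w roundProg s (180 * (d * m * n) + 40 * n) fun s' =>
      ∀ i < n, s'.natArr 0 0 i =
        hits (fun a : Fin m => roundIndex hn S (s.realReg 3) w a) i := by
  refine Runs.mono (Runs.seq (Runs.conseq (Runs.forLoop (N := n) (c := 7) (fun t s' =>
      ∀ j < t, s'.realArr 8 0 j = 1 / (n : ℝ)) (by decide) (by decide) (by decide) h0
      (by simp) ?_) ?_) (B' := m * ((1 + (n * 30 + (d * 18 + 5 + (80 * (n * d) + 8)))) + 7) + 5)) ?_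
  · intro t ht s' f r5 I
    refine Runs.mono (Runs.setRealArr ?_) (by simp [NatExpr.cost, RealExpr.cost])
    intro j hj
    simp only [NatExpr.eval, RealExpr.eval, r5, Store.setNat_realArr, Store.setRealArr_realArr,
      true_and, f.natReg 0 (by decide), h0]
    by_cases h : j = t
    · simp [h]
    · simpa [h] using I j (by omega)
  · intro s1 f1 p1
    set σ := s.realReg 3 with hσ
    have hcount : ∀ i : ℕ, hits (fun a : Fin m => roundIndex hn S σ w a) i =
        ∑ a ∈ Finset.range m, if (roundIndex hn S σ w a : ℕ) = i then 1 else 0 := fun i =>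
      Fin.sum_univ_eq_sum_range (fun a => if (roundIndex hn S σ w a : ℕ) = i then 1 else 0) m
    simp only [hcount]
    refine Runs.conseq (Runs.forLoop (N := m)
      (c := 1 + (n * 30 + (d * 18 + 5 + (80 * (n * d) + 8)))) (fun t s' =>
      s'.unifPos = t ∧ s'.gaussPos = t * d ∧ ∀ i < n, s'.natArr 0 0 i =
        ∑ a ∈ Finset.range t, if (roundIndex hn S σ w a : ℕ) = i then 1 else 0)
      (by decide) (by decide) (by decide) ?_ ?_ ?_) fun s' _ h => h.2.2
    · rw [f1.natReg 2 (by decide), h2]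
    · refine ⟨?_, ?_, fun i hi => ?_⟩
      · simp [f1.unifPos (by decide), hu]
      · simp [f1.gaussPos (by decide), hg]
      · simp [f1.natArr 0 (by decide), hA]
    · rintro t ht s2 f2 r3 ⟨u2, g2, I⟩
      have n2 : s2.natReg 0 = n := by rw [f2.natReg 0 (by decide), f1.natReg 0 (by decide), h0]
      have d2 : s2.natReg 1 = d := by rw [f2.natReg 1 (by decide), f1.natReg 1 (by decide), h1]
      have σ2 : s2.realReg 3 = σ := by rw [f2.realReg 3 (by decide), f1.realReg 3 (by decide)]
      have S2 : s2.realArr 0 = padArr S := by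
        rw [f2.realArr 0 (by decide), f1.realArr 0 (by decide), hS]
      have v2 : ∀ j < n, s2.realArr 8 0 j = 1 / (n : ℝ) := fun j hj => by
        rw [f2.realArr 8 (by decide), p1 j hj]
      refine Runs.seq (Runs.drawUnif ?_)
      refine Runs.seq (Runs.conseq (runs_scan (n := n) hn ?_ ?_) ?_)
      · simpa using n2
      · intro j hj
        simp only [Store.stepUnif_realArr, Store.setReal_realArr, v2 j hj]
        positivity
      intro s3 f3 p3
      have hidx : s3.natReg 8 = sampleIndex hn (fun _ => 1 / (n : ℝ)) (w.1 t) := by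
        rw [p3]
        simp only [Store.stepUnif_realArr, Store.setReal_realArr, Store.stepUnif_realReg,
          Store.setReal_realReg, if_true, u2]
        exact scanIndex_congr v2 _
      refine Runs.seq (Runs.conseq (Runs.mono (runs_perturb (d := d) (by decide) ?_ ?_)
        (B' := d * 18 + 5) (by simp [NatExpr.cost])) ?_)
      · simp [f3.natReg 1 (by decide), d2]
      · intro s' f
        exact f.natReg 8 (by decide)
      rintro s4 f4 ⟨p4, g4⟩
      have n4 : s4.natReg 0 = n := by
        simp [f4.natReg 0 (by decide), f3.natReg 0 (by decide), n2]
      refine Runs.seq (Runs.conseq (runs_nearest hn hd n4 ?_ (S := S)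
        (y := S (sampleIndex hn (fun _ => 1 / (n : ℝ)) (w.1 t)) + σ • block d w.2 t) ?_ ?_) ?_)
      · simp [f4.natReg 1 (by decide), f3.natReg 1 (by decide), d2]
      · rw [f4.realArr 0 (by decide), f3.realArr 0 (by decide)]
        simpa using S2
      · intro l
        rw [p4 l l.2]
        simp only [NatExpr.eval, hidx, f3.realArr 0 (by decide), f3.realReg 3 (by decide),
          f3.gaussPos (by decide), Store.stepUnif_realArr, Store.setReal_realArr,
          Store.stepUnif_realReg, Store.setReal_realReg, Store.stepUnif_gaussPos,
          Store.setReal_gaussPos, S2, σ2, g2, padArr_apply]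
        simp [block]
      intro s5 f5 p5
      refine Runs.mono (Runs.setNatArr ?_) (B := 8) (by simp)
      have hnat : s5.natArr 0 = s2.natArr 0 := by
        rw [f5.natArr 0 (by decide), f4.natArr 0 (by decide), f3.natArr 0 (by decide)]
        rfl
      refine ⟨?_, ?_, ?_⟩
      · simp [f5.unifPos (by decide), f4.unifPos (by decide), f3.unifPos (by decide), u2]
      · simp [f5.gaussPos (by decide), g4, f3.gaussPos (by decide), g2, add_mul]
      · intro i hi
        have p5' : s5.natReg 7 = roundIndex hn S σ w t := p5
        simp only [NatExpr.eval, p5', Store.setNat_natArr, Store.setNatArr_natArr, hnat, true_and,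
          Finset.sum_range_succ]
        by_cases h : i = roundIndex hn S σ w t
        · rw [if_pos h, ← h, I i hi, if_pos rfl]
        · rw [if_neg h, I i hi, if_neg fun h' => h h'.symm]
          rfl
  · have e1 : m * n ≤ d * m * n := by
      rw [mul_assoc]; exact Nat.le_mul_of_pos_left _ hd
    have e2 : m * d ≤ d * m * n := by
      rw [mul_comm m d]; exact Nat.le_mul_of_pos_right _ hn
    have e3 : m ≤ m * n := Nat.le_mul_of_pos_right _ hn
    have e4 : m * ((1 + (n * 30 + (d * 18 + 5 + (80 * (n * d) + 8)))) + 7) =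
      21 * m + 30 * (m * n) + 18 * (m * d) + 80 * (d * m * n) := by ring
    rw [e4]
    omega

theorem runs_costProg (hn : 1 ≤ n) (hd : 1 ≤ d) (h0 : s.natReg 0 = n) (h1 : s.natReg 1 = d)
    {S T : Fin n → Pt d} (hS : s.realArr 0 = padArr S) (hT : s.realArr 1 = padArr T) :
    Runs w costProg s (70 * (d * (n * n))) fun s' =>
      ∀ i j : Fin n, s'.realArr 4 i j = dist (S i) (T j) := by
  refine Runs.mono (Runs.conseq (Runs.forLoop (N := n) (c := n * ((d * 25 + 7 + 5) + 7) + 5)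
    (fun t s' => ∀ i j : Fin n, (i : ℕ) < t → s'.realArr 4 i j = dist (S i) (T j))
    (by decide) (by decide) (by decide) h0 (by simp) ?_) fun s' _ h i j => h i j i.2) ?_
  · intro t ht s1 f1 r4 I
    refine Runs.conseq (Runs.forLoop (N := n) (c := d * 25 + 7 + 5)
      (fun u s' => (∀ i j : Fin n, (i : ℕ) < t → s'.realArr 4 i j = dist (S i) (T j)) ∧
        ∀ i j : Fin n, (i : ℕ) = t → (j : ℕ) < u → s'.realArr 4 i j = dist (S i) (T j))
      (by decide) (by decide) (by decide) ?_ ?_ ?_) ?_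
    · rw [f1.natReg 0 (by decide), h0]
    · exact ⟨fun i j hi => by simpa using I i j hi, fun i j _ h => absurd h (by simp)⟩
    · rintro u hu s2 f2 r5 ⟨I1, I2⟩
      have r4' : s2.natReg 4 = t := by rw [f2.natReg 4 (by decide), r4]
      refine Runs.seq (Runs.conseq (Runs.mono (runs_sqDist (d := d) ?_ ?_ ?_)
        (B' := d * 25 + 7) (by simp [NatExpr.cost])) ?_)
      · rw [f2.natReg 1 (by decide), f1.natReg 1 (by decide), h1]
      · intro s' f; exact f.natReg 4 (by decide)
      · intro s' f; exact f.natReg 5 (by decide)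
      intro s3 f3 p3
      have h4 : s3.realArr 4 = s2.realArr 4 := f3.realArr 4 (by decide)
      have r4'' : s3.natReg 4 = t := by rw [f3.natReg 4 (by decide), r4']
      have r5'' : s3.natReg 5 = u := by rw [f3.natReg 5 (by decide), r5]
      refine Runs.mono (Runs.setRealArr ?_) (B := 5) le_rfl
      refine ⟨fun i j hi => ?_, fun i j hi hj => ?_⟩
      · simp only [NatExpr.eval, RealExpr.eval, Store.setNat_realArr, Store.setRealArr_realArr,
          r4'', h4]
        rw [if_neg (by omega)]
        exact I1 i j hi
      · simp only [NatExpr.eval, RealExpr.eval, Store.setNat_realArr, Store.setRealArr_realArr,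
          r4'', r5'', h4, hi, true_and]
        by_cases h : (j : ℕ) = u
        · rw [if_pos h, p3, sum_range_eq_dist_sq (S i) (T j), Real.sqrt_sq dist_nonneg]
          · intro l
            simp only [NatExpr.eval, r4', ← hi]
            rw [f2.realArr 0 (by decide), f1.realArr 0 (by decide), hS, padArr_apply]
          · intro l
            simp only [NatExpr.eval, r5, ← h]
            rw [f2.realArr 1 (by decide), f1.realArr 1 (by decide), hT, padArr_apply]
        · rw [if_neg h, ← hi]
          exact I2 i j hi (by omega)
    · rintro s2 f2 ⟨I1, I2⟩ i j hi
      simp only [Store.setNat_realArr]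
      rcases Nat.lt_succ_iff_lt_or_eq.1 hi with h | h
      · exact I1 i j h
      · exact I2 i j h j.2
  · have e1 : n ≤ n * n := Nat.le_mul_of_pos_left _ hn
    have e2 : n * n ≤ d * (n * n) := Nat.le_mul_of_pos_left _ hd
    have e3 : 1 ≤ n * n := Nat.mul_pos hn hn
    have e4 : n * (n * (d * 25 + 7 + 5 + 7) + 5 + 7) + 5 =
      25 * (d * (n * n)) + 19 * (n * n) + 12 * n + 5 := by ring
    rw [e4]
    omega

theorem runs_slotProg (h1 : s.natReg 1 = d) (hε : 0 < s.realReg 4) :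
    Runs w slotProg s (12 * ⌈√d / s.realReg 4⌉₊ + 12) fun s' =>
      s'.natReg 9 = ⌈√d / s.realReg 4⌉₊ := by
  refine Runs.mono (Runs.seq (Runs.setNat (Runs.conseq (Runs.loop (c := 4)
    (T := ⌈√d / s.realReg 4⌉₊) (fun t s' => s'.natReg 9 = t ∧ t ≤ ⌈√d / s.realReg 4⌉₊)
    ?_ ?_ ?_) ?_))) ?_
  · simp [NatExpr.eval]
  · exact fun t s' h => h.2
  · rintro t s' f ⟨h2, h3⟩ hb
    have e4 : s'.realReg 4 = s.realReg 4 := by rw [f.realReg 4 (by decide)]; rfl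
    have e1 : s'.natReg 1 = d := by rw [f.natReg 1 (by decide)]; simp [h1]
    simp only [BoolExpr.Holds, RealExpr.eval, NatExpr.eval, h2, e4, e1] at hb
    refine Runs.mono (Runs.setNat ?_) le_rfl
    refine ⟨by simp [NatExpr.eval, h2], ?_⟩
    rw [Nat.succ_le_iff, Nat.lt_ceil, lt_div_iff₀ hε]
    exact hb
  · rintro s' f ⟨⟨t, h2, h3⟩, hb⟩
    have e4 : s'.realReg 4 = s.realReg 4 := by rw [f.realReg 4 (by decide)]; rfl
    have e1 : s'.natReg 1 = d := by rw [f.natReg 1 (by decide)]; simp [h1]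
    simp only [BoolExpr.Holds, RealExpr.eval, NatExpr.eval, h2, e4, e1, not_lt] at hb
    rw [h2]
    refine le_antisymm h3 (Nat.ceil_le.2 ?_)
    rwa [div_le_iff₀ hε]
  · simp only [NatExpr.cost, RealExpr.cost, BoolExpr.cost]
    omega

end Specs

/-! ### Training: the auction and its plan -/

/-- One bid: find the cheapest target for the bidder, sell it the next slot of that target, and let
the former owner of the slot be the next bidder. -/
def bidProg : Prog :=
  .seq (forLoop 5 0 (.setRealArr 7 (.lit 0) (.reg 5)
    (.add (.arr 4 (.sub (.reg 11) (.lit 1)) (.reg 5))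
      (.mul (.reg 4) (.ofNat (.arr 1 (.lit 0) (.reg 5)))))))
  (.seq argmin
  (.seq (.setNat 12 (.arr 3 (.reg 7) (.arr 2 (.lit 0) (.reg 7))))
  (.seq (.setNatArr 4 (.reg 12) (.reg 7) (.sub (.arr 4 (.reg 12) (.reg 7)) (.lit 1)))
  (.seq (.setNatArr 4 (.reg 11) (.reg 7) (.add (.arr 4 (.reg 11) (.reg 7)) (.lit 1)))
  (.seq (.setNatArr 3 (.reg 7) (.arr 2 (.lit 0) (.reg 7)) (.reg 11))
  (.seq (.setNat 11 (.reg 12))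
  (.ite (.natLt (.add (.arr 2 (.lit 0) (.reg 7)) (.lit 1)) (.reg 9))
    (.setNatArr 2 (.lit 0) (.reg 7) (.add (.arr 2 (.lit 0) (.reg 7)) (.lit 1)))
    (.seq (.setNatArr 2 (.lit 0) (.reg 7) (.lit 0))
      (.setNatArr 1 (.lit 0) (.reg 7) (.add (.arr 1 (.lit 0) (.reg 7)) (.lit 1)))))))))))

/-- The auction. The demand of the source `i` is the integer part of `k n B / m`, where `k` is the
number of rounded points at this source; a further unit is introduced as long as the number of
units does not exceed this. -/
def auctionProg : Prog :=
  .seq (.setNat 4 (.lit 0)) (.loop (.natLt (.reg 4) (.reg 0))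
    (.ite (.natLt (.lit 0) (.reg 11)) bidProg
    (.ite (.realLt (.mul (.ofNat (.arr 0 (.lit 0) (.reg 4)))
        (.mul (.ofNat (.reg 0)) (.ofNat (.reg 9))))
        (.mul (.ofNat (.add (.reg 10) (.lit 1))) (.ofNat (.reg 2))))
      (.seq (.setNat 4 (.add (.reg 4) (.lit 1))) (.setNat 10 (.lit 0)))
      (.seq (.setNat 11 (.add (.reg 4) (.lit 1))) (.setNat 10 (.add (.reg 10) (.lit 1)))))))

/-- The mass that the source `i` has bought from the target `j`. -/
def boughtMass (i j : NatExpr) : RealExpr :=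
  .div (.ofNat (.arr 4 (.add i (.lit 1)) j)) (.mul (.ofNat (.reg 0)) (.ofNat (.reg 9)))

/-- Compute the unassigned masses of the sources in row `0` of the real array `9`. -/
def srcRestProg : Prog :=
  forLoop 4 0 (.seq (.setReal 5 (.div (.ofNat (.arr 0 (.lit 0) (.reg 4))) (.ofNat (.reg 2))))
    (.seq (forLoop 5 0 (.setReal 5 (.sub (.reg 5) (boughtMass (.reg 4) (.reg 5)))))
      (.setRealArr 9 (.lit 0) (.reg 4) (.reg 5))))

/-- Compute the missing masses of the targets in row `1` of the real array `9`, and their sum in the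
real register `10`. -/
def tgtRestProg : Prog :=
  .seq (.setReal 10 (.lit 0)) (forLoop 5 0 (.seq (.setReal 5 (.div (.lit 1) (.ofNat (.reg 0))))
    (.seq (forLoop 4 0 (.setReal 5 (.sub (.reg 5) (boughtMass (.reg 4) (.reg 5)))))
      (.seq (.setRealArr 9 (.lit 1) (.reg 5) (.reg 5)) (.setReal 10 (.add (.reg 10) (.reg 5)))))))

/-- Compute the conditional laws of the plan in the real array `6`. -/
def weightProg : Prog :=
  forLoop 4 0 (forLoop 5 0 (.setRealArr 6 (.reg 4) (.reg 5)
    (.div (.mul (.add (boughtMass (.reg 4) (.reg 5))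
      (.div (.mul (.arr 9 (.lit 0) (.reg 4)) (.arr 9 (.lit 1) (.reg 5))) (.reg 10)))
      (.ofNat (.reg 2))) (.ofNat (.arr 0 (.lit 0) (.reg 4))))))

/-- The state of the auction that is stored in a memory. -/
def Store.auction (s : Store) : Auction where
  owner := s.natArr 3
  ptr := s.natArr 2 0
  lvl := s.natArr 1 0
  count := s.natArr 4
  cur := s.natReg 11
  src := s.natReg 4
  unit := s.natReg 10

attribute [ext] Auction

section Specs

variable {w : Tape} {s : Store} {n m B : ℕ}

/-- The program realizes one `Auction.bid` at a cheapest target. -/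
theorem runs_bidProg (hn : 1 ≤ n) (h0 : s.natReg 0 = n) (h9 : s.natReg 9 = B) :
    Runs w bidProg s (120 * n) fun s' => ∃ b < n,
      (∀ j < n, s.realArr 4 (s.auction.cur - 1) b + s.realReg 4 * s.auction.lvl b ≤
        s.realArr 4 (s.auction.cur - 1) j + s.realReg 4 * s.auction.lvl j) ∧
      s'.auction = s.auction.bid B b := by
  obtain ⟨a, ha⟩ : ∃ a, a = s.auction := ⟨_, rfl⟩
  have a1 : s.natArr 3 = a.owner := by rw [ha]; rfl
  have a2 : s.natArr 2 0 = a.ptr := by rw [ha]; rfl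
  have a3 : s.natArr 1 0 = a.lvl := by rw [ha]; rfl
  have a4 : s.natArr 4 = a.count := by rw [ha]; rfl
  have a5 : s.natReg 11 = a.cur := by rw [ha]; rfl
  have a6 : s.natReg 4 = a.src := by rw [ha]; rfl
  have a7 : s.natReg 10 = a.unit := by rw [ha]; rfl
  rw [← ha]
  refine Runs.mono (Runs.seq (Runs.conseq (Runs.forLoop (N := n) (c := 15) (fun t s' =>
      ∀ j < t, s'.realArr 7 0 j = s.realArr 4 (a.cur - 1) j +
        s.realReg 4 * a.lvl j) (by decide) (by decide) (by decide) h0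
      (by simp) ?_) ?_) (B' := n * 17 + 7 + 60)) (by omega)
  · intro t ht s' f r5 I
    refine Runs.mono (Runs.setRealArr ?_) (by simp [NatExpr.cost, RealExpr.cost])
    intro j hj
    simp only [NatExpr.eval, RealExpr.eval, r5, Store.setNat_realArr, Store.setRealArr_realArr,
      true_and, f.natReg 11 (by decide), f.realArr 4 (by decide), f.realReg 4 (by decide),
      f.natArr 1 (by decide), a3, a5]
    by_cases h : j = t
    · simp [h]
    · simpa [h] using I j (by omega)
  intro s1 f1 p1
  refine Runs.mono (Runs.seq (Runs.conseq (runs_argmin hn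
    ((f1.natReg 0 (by decide)).trans h0)) ?_) (B' := 60)) le_rfl
  rintro s2 f2 ⟨hb, hmin, -⟩
  set b := s2.natReg 7 with hbdef
  have hA : s2.natArr = s.natArr := by
    funext A
    rw [f2.natArr A (by simp [argmin, forLoop, Prog.natArrs]),
      f1.natArr A (by simp [forLoop, Prog.natArrs])]
  have hcur : s2.natReg 11 = a.cur := by
    rw [f2.natReg 11 (by decide), f1.natReg 11 (by decide), a5]
  have hsrc : s2.natReg 4 = a.src := by
    rw [f2.natReg 4 (by decide), f1.natReg 4 (by decide), a6]
  have hunit : s2.natReg 10 = a.unit := by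
    rw [f2.natReg 10 (by decide), f1.natReg 10 (by decide), a7]
  have hB : s2.natReg 9 = B := by
    rw [f2.natReg 9 (by decide), f1.natReg 9 (by decide), h9]
  have hmin' : ∀ j < n, s.realArr 4 (a.cur - 1) b + s.realReg 4 * a.lvl b ≤
      s.realArr 4 (a.cur - 1) j + s.realReg 4 * a.lvl j := by
    intro j hj
    have := hmin j hj
    rwa [p1 b hb, p1 j hj] at this
  refine Runs.mono (Runs.seq (Runs.setNat (Runs.seq (Runs.setNatArr (Runs.seq (Runs.setNatArr
    (Runs.seq (Runs.setNatArr (Runs.seq (Runs.setNat (Runs.ite (B := 15) (fun hlt =>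
      Runs.mono (Runs.setNatArr ⟨b, hb, hmin', ?_⟩) ?_)
      (fun hlt => Runs.mono (Runs.seq (Runs.setNatArr (Runs.setNatArr ⟨b, hb, hmin', ?_⟩)))
        ?_)))))))))))) ?_
  · simp only [BoolExpr.Holds, NatExpr.eval, Store.setNat_natReg, Store.setNatArr_natReg,
      Store.setNat_natArr, Store.setNatArr_natArr, ← hbdef, hA, hB, a2] at hlt
    norm_num at hlt
    ext <;> simp only [Store.auction, Auction.bid, NatExpr.eval, Store.setNat_natReg,
      Store.setNatArr_natReg, Store.setNat_natArr, Store.setNatArr_natArr, ← hbdef, hA, hcur,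
      hsrc, hunit, a1, a2, a3, a4] <;> simp +contextual [hlt]
  · simp [NatExpr.cost]
  · simp only [BoolExpr.Holds, NatExpr.eval, Store.setNat_natReg, Store.setNatArr_natReg,
      Store.setNat_natArr, Store.setNatArr_natArr, ← hbdef, hA, hB, a2] at hlt
    norm_num at hlt
    ext <;> simp only [Store.auction, Auction.bid, NatExpr.eval, Store.setNat_natReg,
      Store.setNatArr_natReg, Store.setNat_natArr, Store.setNatArr_natArr, ← hbdef, hA, hcur,
      hsrc, hunit, a1, a2, a3, a4] <;> simp +contextual [Nat.not_lt.2 hlt]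
  · simp [NatExpr.cost]
  · simp [NatExpr.cost, BoolExpr.cost]

/-- The loop invariant says that the state is valid and that its clock shows the number of steps
made so far; as the clock is bounded, so is the number of steps. -/
theorem runs_auctionProg (hn : 1 ≤ n) (hB : 1 ≤ B) (hm : 1 ≤ m) (h0 : s.natReg 0 = n)
    (h2 : s.natReg 2 = m) (h9 : s.natReg 9 = B) (h10 : s.natReg 10 = 0) (h11 : s.natReg 11 = 0)
    (hA : ∀ A, A ≠ 0 → s.natArr A = fun _ _ => 0)
    (hk : ∑ i ∈ Finset.range n, s.natArr 0 0 i = m) (hε : 0 < s.realReg 4)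
    (hc : ∀ i < n, ∀ j < n, ∀ j' < n, s.realArr 4 i j ≤ s.realArr 4 i j' + s.realReg 4 * B) :
    Runs w auctionProg s (800 * (n * n * (B * B))) fun s' =>
      s'.auction.Valid n B (fun i => s.natArr 0 0 i * (n * B) / m) (s.realArr 4) (s.realReg 4) ∧
      s'.auction.src = n := by
  set U : ℕ → ℕ := fun i => s.natArr 0 0 i * (n * B) / m with hU
  have hUsum : ∑ i ∈ Finset.range n, U i ≤ n * B := by
    have h1 : (∑ i ∈ Finset.range n, U i) * m ≤ (n * B) * m := by
      rw [Finset.sum_mul]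
      refine (Finset.sum_le_sum fun i _ => Nat.div_mul_le_self _ _).trans ?_
      rw [← Finset.sum_mul, hk, mul_comm]
    exact Nat.le_of_mul_le_mul_right h1 hm
  have hstart : (s.setNat 4 0).auction = Auction.start := by
    ext <;> simp [Store.auction, Auction.start, hA, h10, h11]
  refine Runs.mono (Runs.seq (Runs.setNat (Runs.conseq (Runs.loop
    (T := n * (B * (B + 2)) + n * B + n) (c := 3 + (17 + 120 * n)) (fun t s' =>
      s'.auction.Valid n B U (s.realArr 4) (s.realReg 4) ∧ s'.auction.clock n B U = t)
    ?_ ?_ ?_) ?_))) ?_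
  · simp only [NatExpr.eval]
    rw [hstart]
    exact ⟨Auction.valid_start hB, Auction.clock_start⟩
  · rintro t s' ⟨hv, rfl⟩
    exact hv.clock_le hUsum
  · rintro t s' f ⟨hv, ht⟩ hb
    have n' : s'.natReg 0 = n := by rw [f.natReg 0 (by decide)]; simp [h0]
    have m' : s'.natReg 2 = m := by rw [f.natReg 2 (by decide)]; simp [h2]
    have B' : s'.natReg 9 = B := by rw [f.natReg 9 (by decide)]; simp [h9]
    have k' : s'.natArr 0 = s.natArr 0 := by rw [f.natArr 0 (by decide)]; rfl
    have c' : s'.realArr 4 = s.realArr 4 := by rw [f.realArr 4 (by decide)]; rfl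
    have ε' : s'.realReg 4 = s.realReg 4 := by rw [f.realReg 4 (by decide)]; rfl
    have hsrc : s'.auction.src < n := by
      have hb' : s'.natReg 4 < s'.natReg 0 := hb
      rw [n'] at hb'
      exact hb'
    refine Runs.mono (Runs.ite (B := 17 + 120 * n) (fun hcur => ?_) fun hcur => ?_) le_rfl
    · have hcur' : s'.auction.cur ≠ 0 := by
        have : 0 < s'.auction.cur := hcur
        omega
      refine Runs.mono (Runs.conseq (runs_bidProg hn n' B') ?_) (by omega)
      rintro s'' - ⟨b, hbn, hmin, hbid⟩
      rw [c', ε'] at hmin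
      rw [hbid]
      exact ⟨hv.bid hε hUsum hc hcur' hsrc hbn hmin, by rw [Auction.clock_bid hv hbn, ht]⟩
    · have hcur' : s'.auction.cur = 0 := by
        have : ¬ 0 < s'.auction.cur := hcur
        omega
      refine Runs.mono (Runs.ite (B := 8) (fun hlt => ?_) fun hlt => ?_)
        (by simp only [BoolExpr.cost, RealExpr.cost, NatExpr.cost]; omega)
      · have hu : ¬ s'.auction.unit < U s'.auction.src := by
          simp only [BoolExpr.Holds, RealExpr.eval, NatExpr.eval, k', n', B', m'] at hlt
          have hlt' : s.natArr 0 0 s'.auction.src * (n * B) < (s'.auction.unit + 1) * m := by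
            exact_mod_cast hlt
          have := (Nat.div_lt_iff_lt_mul hm).2 hlt'
          change U s'.auction.src < _ at this
          omega
        refine Runs.mono (Runs.seq (Runs.setNat (Runs.setNat ?_)))
          (by simp [NatExpr.cost])
        have e : ((s'.setNat 4 ((NatExpr.add (.reg 4) (.lit 1)).eval s')).setNat 10
            ((NatExpr.lit 0).eval (s'.setNat 4 ((NatExpr.add (.reg 4) (.lit 1)).eval s')))).auction
            = s'.auction.advance := by
          ext <;> simp [Store.auction, Auction.advance, NatExpr.eval]
        rw [e]
        exact ⟨hv.advance hcur' hsrc hu, by rw [Auction.clock_advance hv hsrc hu, ht]⟩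
      · have hu : s'.auction.unit < U s'.auction.src := by
          simp only [BoolExpr.Holds, RealExpr.eval, NatExpr.eval, k', n', B', m', not_lt] at hlt
          have hlt' : (s'.auction.unit + 1) * m ≤ s.natArr 0 0 s'.auction.src * (n * B) := by
            exact_mod_cast hlt
          exact (Nat.le_div_iff_mul_le hm).2 hlt'
        refine Runs.mono (Runs.seq (Runs.setNat (Runs.setNat ?_)))
          (by simp [NatExpr.cost])
        have e : ((s'.setNat 11 ((NatExpr.add (.reg 4) (.lit 1)).eval s')).setNat 10
            ((NatExpr.add (.reg 10) (.lit 1)).eval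
              (s'.setNat 11 ((NatExpr.add (.reg 4) (.lit 1)).eval s')))).auction
            = s'.auction.introduce := by
          ext <;> simp [Store.auction, Auction.introduce, NatExpr.eval]
        rw [e]
        exact ⟨hv.introduce hcur' hsrc hu, by rw [Auction.clock_introduce, ht]⟩
  · rintro s' f ⟨⟨t, hv, -⟩, hb⟩
    have n' : s'.natReg 0 = n := by rw [f.natReg 0 (by decide)]; simp [h0]
    have : ¬ s'.auction.src < n := by
      have hb' : ¬ s'.natReg 4 < s'.natReg 0 := hb
      rw [n'] at hb'
      exact hb'
    exact ⟨hv, le_antisymm hv.src_le (not_lt.1 this)⟩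
  · simp only [BoolExpr.cost, NatExpr.cost]
    have hBB : 1 ≤ B * B := Nat.mul_pos hB hB
    have h1 : n * (B * (B + 2)) + n * B + n ≤ 5 * (n * (B * B)) := by
      have : B ≤ B * B := Nat.le_mul_of_pos_left _ hB
      have e1 : n * B ≤ n * (B * B) := Nat.mul_le_mul_left _ this
      have e2 : n ≤ n * (B * B) := Nat.le_mul_of_pos_right _ hBB
      have e3 : n * (B * (B + 2)) = n * (B * B) + 2 * (n * B) := by ring
      omega
    have h2 : 1 ≤ n * n * (B * B) := Nat.mul_pos (Nat.mul_pos hn hn) hBB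
    have h3 : 1 + 1 + 1 + (3 + (17 + 120 * n)) ≤ 143 * n := by omega
    have h4 := Nat.mul_le_mul h1 h3
    have h5 : 5 * (n * (B * B)) * (143 * n) = 715 * (n * n * (B * B)) := by ring
    omega

theorem runs_srcRestProg (hn : 1 ≤ n) (h0 : s.natReg 0 = n) (h2 : s.natReg 2 = m)
    (h9 : s.natReg 9 = B) :
    Runs w srcRestProg s (60 * (n * n)) fun s' => ∀ i < n, s'.realArr 9 0 i =
      srcRest n B m (s.natArr 0 0) (fun i j => s.natArr 4 (i + 1) j) i := by
  refine Runs.mono (Runs.forLoop (N := n) (c := 8 + ((n * (15 + 7) + 5) + 4)) (fun t s' =>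
    ∀ i < t, s'.realArr 9 0 i =
      srcRest n B m (s.natArr 0 0) (fun i j => s.natArr 4 (i + 1) j) i)
    (by decide) (by decide) (by decide) h0 (by simp) ?_) ?_
  · intro t ht s1 f1 r4 I
    refine Runs.mono (Runs.seq (Runs.setReal ?_)) le_rfl
    refine Runs.seq (Runs.conseq (Runs.forLoop (N := n) (c := 15) (fun u s' => s'.realReg 5 =
      (s.natArr 0 0 t : ℝ) / m - ∑ j ∈ Finset.range u, (s.natArr 4 (t + 1) j : ℝ) / ((n : ℝ) * B))
      (by decide) (by decide) (by decide) ?_ ?_ ?_) ?_)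
    · simp [f1.natReg 0 (by decide), h0]
    · simp [RealExpr.eval, NatExpr.eval, r4, f1.natArr 0 (by decide), f1.natReg 2 (by decide), h2]
    · intro u hu s2 f2 r5 I2
      refine Runs.mono (Runs.setReal ?_)
        (by simp [boughtMass, RealExpr.cost, NatExpr.cost])
      simp only [boughtMass, RealExpr.eval, NatExpr.eval, Store.setNat_realReg,
        Store.setReal_realReg, if_true, I2, r5, f2.natReg 4 (by decide), f2.natReg 0 (by decide),
        f2.natReg 9 (by decide), f2.natArr 4 (by decide), Store.setReal_natReg,
        Store.setReal_natArr, r4, f1.natReg 0 (by decide), f1.natReg 9 (by decide),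
        f1.natArr 4 (by decide), h0, h9, Finset.sum_range_succ]
      ring
    · intro s2 f2 p2
      refine Runs.mono (Runs.setRealArr ?_) (B := 4) le_rfl
      intro i hi
      simp only [RealExpr.eval, NatExpr.eval, Store.setNat_realArr, Store.setRealArr_realArr,
        true_and, f2.natReg 4 (by decide), Store.setReal_natReg, r4, f2.realArr 9 (by decide),
        Store.setReal_realArr]
      by_cases h : i = t
      · rw [if_pos h, p2, h]
        rfl
      · rw [if_neg h]
        exact I i (by omega)
  · have e1 : n ≤ n * n := Nat.le_mul_of_pos_left _ hn
    have e2 : n * (8 + (n * (15 + 7) + 5 + 4) + 7) + 5 = 22 * (n * n) + 24 * n + 5 := by ring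
    rw [e2]
    omega

theorem runs_tgtRestProg (hn : 1 ≤ n) (h0 : s.natReg 0 = n) (h9 : s.natReg 9 = B) :
    Runs w tgtRestProg s (70 * (n * n)) fun s' =>
      (∀ j < n, s'.realArr 9 1 j = tgtRest n B (fun i j => s.natArr 4 (i + 1) j) j) ∧
      (∀ i, s'.realArr 9 0 i = s.realArr 9 0 i) ∧
      s'.realReg 10 =
        ∑ j ∈ Finset.range n, tgtRest n B (fun i j => s.natArr 4 (i + 1) j) j := by
  refine Runs.mono (Runs.seq (Runs.setReal (Runs.forLoop (N := n)
    (c := 5 + ((n * (15 + 7) + 5) + (4 + 4))) (fun t s' =>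
    (∀ j < t, s'.realArr 9 1 j = tgtRest n B (fun i j => s.natArr 4 (i + 1) j) j) ∧
      (∀ i, s'.realArr 9 0 i = s.realArr 9 0 i) ∧
      s'.realReg 10 =
        ∑ j ∈ Finset.range t, tgtRest n B (fun i j => s.natArr 4 (i + 1) j) j)
    (by decide) (by decide) (by decide) h0 (by simp [RealExpr.eval]) ?_))) ?_
  · rintro t ht s1 f1 r5 ⟨I1, I2, I3⟩
    refine Runs.mono (Runs.seq (Runs.setReal ?_)) le_rfl
    refine Runs.seq (Runs.conseq (Runs.forLoop (N := n) (c := 15) (fun u s' => s'.realReg 5 =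
      1 / (n : ℝ) - ∑ i ∈ Finset.range u, (s.natArr 4 (i + 1) t : ℝ) / ((n : ℝ) * B))
      (by decide) (by decide) (by decide) ?_ ?_ ?_) ?_)
    · simp [f1.natReg 0 (by decide), h0]
    · simp [RealExpr.eval, NatExpr.eval, f1.natReg 0 (by decide), h0]
    · intro u hu s2 f2 r4 J
      refine Runs.mono (Runs.setReal ?_)
        (by simp [boughtMass, RealExpr.cost, NatExpr.cost])
      simp only [boughtMass, RealExpr.eval, NatExpr.eval, Store.setNat_realReg,
        Store.setReal_realReg, if_true, J, r4, f2.natReg 5 (by decide), f2.natReg 0 (by decide),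
        f2.natReg 9 (by decide), f2.natArr 4 (by decide), Store.setReal_natReg,
        Store.setReal_natArr, r5, f1.natReg 0 (by decide), f1.natReg 9 (by decide),
        f1.natArr 4 (by decide), h0, h9, Finset.sum_range_succ]
      ring
    · intro s2 f2 p2
      have p2' : s2.realReg 5 = tgtRest n B (fun i j => s.natArr 4 (i + 1) j) t := p2
      refine Runs.mono (Runs.seq (Runs.setRealArr (Runs.setReal ⟨?_, ?_, ?_⟩))) (B := 4 + 4) le_rfl
      · intro j hj
        simp only [RealExpr.eval, NatExpr.eval, Store.setNat_realArr, Store.setRealArr_realArr,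
          true_and, f2.natReg 5 (by decide), Store.setReal_natReg, r5, f2.realArr 9 (by decide),
          Store.setReal_realArr, p2']
        by_cases h : j = t
        · rw [if_pos h, h]
        · rw [if_neg h]
          exact I1 j (by omega)
      · intro i
        simp [NatExpr.eval, f2.realArr 9 (by decide), I2]
      · simp only [RealExpr.eval, Store.setNat_realReg, Store.setReal_realReg, if_true,
          Store.setRealArr_realReg, p2', f2.realReg 10 (by decide), Finset.sum_range_succ]
        simp [I3]
  · have e1 : n ≤ n * n := Nat.le_mul_of_pos_left _ hn
    have e2 : n * (5 + (n * (15 + 7) + 5 + (4 + 4)) + 7) + 5 = 22 * (n * n) + 25 * n + 5 := by ring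
    rw [e2]
    simp only [RealExpr.cost]
    omega

/-- The conditional law of the source `i` is its row of the plan times `m / k i`. For a source
without rounded points the row consists of zeros, since `x / 0 = 0`; `scanIndex` then selects the
last target, which is admissible because the kernel is arbitrary outside the rounded points. -/
theorem runs_weightProg (hn : 1 ≤ n) (h0 : s.natReg 0 = n) (h2 : s.natReg 2 = m)
    (h9 : s.natReg 9 = B)
    (hr : ∀ i < n, s.realArr 9 0 i =
      srcRest n B m (s.natArr 0 0) (fun i j => s.natArr 4 (i + 1) j) i)
    (hq : ∀ j < n, s.realArr 9 1 j = tgtRest n B (fun i j => s.natArr 4 (i + 1) j) j)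
    (hR : s.realReg 10 =
      ∑ j ∈ Finset.range n, tgtRest n B (fun i j => s.natArr 4 (i + 1) j) j) :
    Runs w weightProg s (70 * (n * n)) fun s' => ∀ i < n, ∀ j < n, s'.realArr 6 i j =
      plan n B m (s.natArr 0 0) (fun i j => s.natArr 4 (i + 1) j) i j * m / s.natArr 0 0 i := by
  set W : ℕ → ℕ → ℝ := fun i j =>
    plan n B m (s.natArr 0 0) (fun i j => s.natArr 4 (i + 1) j) i j * m / s.natArr 0 0 i with hW
  refine Runs.mono (Runs.forLoop (N := n) (c := n * (36 + 7) + 5) (fun t s' =>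
    ∀ i < t, ∀ j < n, s'.realArr 6 i j = W i j)
    (by decide) (by decide) (by decide) h0 (by simp) ?_) ?_
  · intro t ht s1 f1 r4 I
    refine Runs.conseq (Runs.forLoop (N := n) (c := 36) (fun u s' =>
      (∀ i < t, ∀ j < n, s'.realArr 6 i j = W i j) ∧ ∀ j < u, s'.realArr 6 t j = W t j)
      (by decide) (by decide) (by decide) ?_ ?_ ?_) ?_
    · rw [f1.natReg 0 (by decide), h0]
    · exact ⟨I, by simp⟩
    · rintro u hu s2 f2 r5 ⟨I1, I2⟩
      refine Runs.mono (Runs.setRealArr ⟨fun i hi j hj => ?_, fun j hj => ?_⟩)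
        (by simp [boughtMass, RealExpr.cost, NatExpr.cost])
      · simp only [NatExpr.eval, f2.natReg 4 (by decide), r4, Store.setNat_realArr,
          Store.setRealArr_realArr]
        rw [if_neg (by omega)]
        exact I1 i hi j hj
      · simp only [boughtMass, RealExpr.eval, NatExpr.eval, Store.setNat_realArr,
          Store.setRealArr_realArr, true_and, r5, f2.natReg 4 (by decide),
          f2.natReg 0 (by decide), f2.natReg 2 (by decide), f2.natReg 9 (by decide),
          f2.natArr 4 (by decide), f2.natArr 0 (by decide), f2.realArr 9 (by decide),
          f2.realReg 10 (by decide), r4, f1.natReg 0 (by decide), f1.natReg 2 (by decide),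
          f1.natReg 9 (by decide), f1.natArr 4 (by decide), f1.natArr 0 (by decide),
          f1.realArr 9 (by decide), f1.realReg 10 (by decide), h0, h2, h9, hr t ht, hq u hu, hR]
        by_cases h : j = u
        · rw [if_pos h, h, hW]
          rfl
        · rw [if_neg h]
          exact I2 j (by omega)
    · rintro s2 f2 ⟨I1, I2⟩ i hi j hj
      simp only [Store.setNat_realArr]
      rcases Nat.lt_succ_iff_lt_or_eq.1 hi with h | h
      · exact I1 i h j hj
      · rw [h]; exact I2 j hj
  · have e1 : n ≤ n * n := Nat.le_mul_of_pos_left _ hn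
    have e2 : n * (n * (36 + 7) + 5 + 7) + 5 = 43 * (n * n) + 12 * n + 5 := by ring
    rw [e2]
    omega

end Specs

/-! ### The training program and its running time -/

/-- The training program. -/
def trainProg : Prog :=
  .seq paramProg (.seq roundProg (.seq costProg (.seq slotProg (.seq auctionProg
    (.seq srcRestProg (.seq tgtRestProg weightProg))))))

section Train

variable {n d m : ℕ}

theorem rowKernel_congr (hn : 1 ≤ n) (S T : Fin n → Pt d) {v v' : Fin n → ℕ → ℝ}
    (h : ∀ i, ∀ j < n, v i j = v' i j) : rowKernel hn S T v = rowKernel hn S T v' := by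
  refine Kernel.ext fun x => ?_
  rw [rowKernel_apply, rowKernel_apply]
  congr 1
  funext u
  congr 1
  exact Fin.ext (scanIndex_congr (h _) _)

theorem roundedPoints_tapeSeed (hn : 1 ≤ n) (S : Fin n → Pt d) (σ : ℝ) (w : Tape) :
    roundedPoints S σ (tapeSeed hn d m w) = fun a : Fin m => S (roundIndex hn S σ w a) := by
  funext a
  exact proj_eq_nearestIndex hn S _

theorem accuracy_pos (hn : 1 ≤ n) : 0 < accuracy n d :=
  Real.rpow_pos_of_pos (by positivity) _

/-- The memory after training. Its kernel is an admissible choice for the rounded points that are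
determined by the random source. -/
theorem runs_trainProg (hn : 1 ≤ n) (hd : 1 ≤ d) (hm : 1 ≤ m) (ρ ε c : ℝ) (S T : Fin n → Pt d)
    (hT : ∀ j, T j ∈ unitCube d) (w : Tape) :
    Runs w trainProg (inputStore m ρ ε c S T)
      (60 + ((180 * (d * m * n) + 40 * n) + (70 * (d * (n * n)) +
        ((12 * ⌈√d / (accuracy n d / 2)⌉₊ + 12) +
          (800 * (n * n * (⌈√d / (accuracy n d / 2)⌉₊ * ⌈√d / (accuracy n d / 2)⌉₊)) +
            (60 * (n * n) + (70 * (n * n) + 70 * (n * n)))))))) fun s =>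
      s.natReg 0 = n ∧ s.natReg 1 = d ∧ s.realReg 3 = bandwidth n d ρ c ∧
      s.realArr 0 = padArr S ∧ s.realArr 1 = padArr T ∧
      (∀ i < n, ∀ j < n, 0 ≤ s.realArr 6 i j) ∧
      IsApproxOTKernel (roundedPoints S (bandwidth n d ρ c) (tapeSeed hn d m w)) T
        (accuracy n d) (rowKernel hn S T fun i : Fin n => s.realArr 6 i) := by
  set s := inputStore m ρ ε c S T with hs
  set B := ⌈√d / (accuracy n d / 2)⌉₊ with hB
  have hε : 0 < accuracy n d / 2 := half_pos (accuracy_pos hn)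
  have hDB : √d ≤ accuracy n d / 2 * B := by
    have := Nat.le_ceil (√d / (accuracy n d / 2))
    rw [div_le_iff₀ hε] at this
    rw [mul_comm]
    exact this
  have hB1 : 1 ≤ B := by
    refine Nat.one_le_iff_ne_zero.2 fun h0 => ?_
    rw [h0, Nat.cast_zero, mul_zero] at hDB
    have : 0 < √(d : ℝ) := Real.sqrt_pos.2 (by positivity)
    linarith
  have s0 : s.natReg 0 = n := by simp [hs, inputStore]
  have s1 : s.natReg 1 = d := by simp [hs, inputStore]
  have s2 : s.natReg 2 = m := by simp [hs, inputStore]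
  have sr0 : s.realReg 0 = ρ := by simp [hs, inputStore]
  have sr2 : s.realReg 2 = c := by simp [hs, inputStore]
  have sS : s.realArr 0 = padArr S := by funext i k; simp [hs, inputStore]
  have sT : s.realArr 1 = padArr T := by funext i k; simp [hs, inputStore]
  have sA : ∀ A, s.natArr A = fun _ _ => 0 := fun A => rfl
  have sreg : ∀ r, r ≠ 0 → r ≠ 1 → r ≠ 2 → s.natReg r = 0 := fun r h0 h1 h2 => by
    simp [hs, inputStore, h0, h1, h2]
  refine Runs.seq (Runs.conseq (runs_paramProg hn hd s0 s1) ?_)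
  rintro t1 f1 ⟨p1, p1'⟩
  rw [sr0, sr2] at p1
  refine Runs.seq (Runs.conseq (runs_roundProg (m := m) (S := S) hn hd ?_ ?_ ?_ ?_ ?_ ?_ ?_) ?_)
  · rw [f1.natReg 0 (by decide), s0]
  · rw [f1.natReg 1 (by decide), s1]
  · rw [f1.natReg 2 (by decide), s2]
  · rw [f1.realArr 0 (by decide), sS]
  · intro i; rw [f1.natArr 0 (by decide), sA]
  · rw [f1.unifPos (by decide)]; rfl
  · rw [f1.gaussPos (by decide)]; rfl
  intro t2 f2 p2
  rw [p1] at p2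
  set J : Fin m → Fin n := fun a => roundIndex hn S (bandwidth n d ρ c) w a with hJ
  refine Runs.seq (Runs.conseq (runs_costProg (S := S) (T := T) hn hd ?_ ?_ ?_ ?_) ?_)
  · rw [f2.natReg 0 (by decide), f1.natReg 0 (by decide), s0]
  · rw [f2.natReg 1 (by decide), f1.natReg 1 (by decide), s1]
  · rw [f2.realArr 0 (by decide), f1.realArr 0 (by decide), sS]
  · rw [f2.realArr 1 (by decide), f1.realArr 1 (by decide), sT]
  intro t3 f3 p3
  have e3 : t3.realReg 4 = accuracy n d / 2 := by
    rw [f3.realReg 4 (by decide), f2.realReg 4 (by decide), p1']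
  have sl := runs_slotProg (w := w) (s := t3) (d := d)
    (by rw [f3.natReg 1 (by decide), f2.natReg 1 (by decide), f1.natReg 1 (by decide), s1])
    (by rw [e3]; exact hε)
  rw [e3, ← hB] at sl
  refine Runs.seq (Runs.conseq sl ?_)
  intro t4 f4 p4
  have c4 : ∀ i j : Fin n, t4.realArr 4 i j = dist (S i) (T j) := fun i j => by
    rw [f4.realArr 4 (by decide), p3]
  have k4 : ∀ i < n, t4.natArr 0 0 i = hits J i := fun i hi => by
    rw [f4.natArr 0 (by decide), f3.natArr 0 (by decide), p2 i hi]
  have n4 : t4.natReg 0 = n := by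
    rw [f4.natReg 0 (by decide), f3.natReg 0 (by decide), f2.natReg 0 (by decide),
      f1.natReg 0 (by decide), s0]
  have d4 : t4.natReg 1 = d := by
    rw [f4.natReg 1 (by decide), f3.natReg 1 (by decide), f2.natReg 1 (by decide),
      f1.natReg 1 (by decide), s1]
  have m4 : t4.natReg 2 = m := by
    rw [f4.natReg 2 (by decide), f3.natReg 2 (by decide), f2.natReg 2 (by decide),
      f1.natReg 2 (by decide), s2]
  have ε4 : t4.realReg 4 = accuracy n d / 2 := by rw [f4.realReg 4 (by decide), e3]
  have σ4 : t4.realReg 3 = bandwidth n d ρ c := by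
    rw [f4.realReg 3 (by decide), f3.realReg 3 (by decide), f2.realReg 3 (by decide), p1]
  have S4 : t4.realArr 0 = padArr S := by
    rw [f4.realArr 0 (by decide), f3.realArr 0 (by decide), f2.realArr 0 (by decide),
      f1.realArr 0 (by decide), sS]
  have T4 : t4.realArr 1 = padArr T := by
    rw [f4.realArr 1 (by decide), f3.realArr 1 (by decide), f2.realArr 1 (by decide),
      f1.realArr 1 (by decide), sT]
  refine Runs.seq (Runs.conseq (runs_auctionProg (m := m) hn hB1 hm n4 m4 p4 ?_ ?_ ?_ ?_ ?_ ?_) ?_)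
  · rw [f4.natReg 10 (by decide), f3.natReg 10 (by decide), f2.natReg 10 (by decide),
      f1.natReg 10 (by decide), sreg 10 (by decide) (by decide) (by decide)]
  · rw [f4.natReg 11 (by decide), f3.natReg 11 (by decide), f2.natReg 11 (by decide),
      f1.natReg 11 (by decide), sreg 11 (by decide) (by decide) (by decide)]
  · intro A hA
    have h2 : A ∉ roundProg.natArrs := by
      have e : roundProg.natArrs = [0] := by decide
      simpa [e] using hA
    have h1 : paramProg.natArrs = [] := by decide
    have h3 : costProg.natArrs = [] := by decide
    have h4 : slotProg.natArrs = [] := by decide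
    rw [f4.natArr A (by simp [h4]), f3.natArr A (by simp [h3]), f2.natArr A h2,
      f1.natArr A (by simp [h1]), sA]
  · rw [Finset.sum_congr rfl fun i hi => k4 i (Finset.mem_range.1 hi), sum_hits]
  · rw [ε4]; exact hε
  · intro i hi j hj j' hj'
    have h1 := c4 ⟨i, hi⟩ ⟨j, hj⟩
    have h2 := c4 ⟨i, hi⟩ ⟨j', hj'⟩
    simp only at h1 h2
    rw [h1, h2, ε4]
    have h3 := dist_triangle (S ⟨i, hi⟩) (T ⟨j', hj'⟩) (T ⟨j, hj⟩)
    have h4 := dist_le_sqrt_of_mem_unitCube (hT ⟨j', hj'⟩) (hT ⟨j, hj⟩)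
    linarith
  rintro t5 f5 ⟨hv, hsrc⟩
  have k5 : t5.natArr 0 = t4.natArr 0 := f5.natArr 0 (by decide)
  have n5 : t5.natReg 0 = n := by rw [f5.natReg 0 (by decide), n4]
  have m5 : t5.natReg 2 = m := by rw [f5.natReg 2 (by decide), m4]
  have B5 : t5.natReg 9 = B := by rw [f5.natReg 9 (by decide), p4]
  refine Runs.seq (Runs.conseq (runs_srcRestProg hn n5 m5 B5) ?_)
  intro t6 f6 p6
  have N6 : t6.natArr = t5.natArr := by
    funext A
    have h : srcRestProg.natArrs = [] := by decide
    exact f6.natArr A (by simp [h])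
  have n6 : t6.natReg 0 = n := by rw [f6.natReg 0 (by decide), n5]
  have m6 : t6.natReg 2 = m := by rw [f6.natReg 2 (by decide), m5]
  have B6 : t6.natReg 9 = B := by rw [f6.natReg 9 (by decide), B5]
  refine Runs.seq (Runs.conseq (runs_tgtRestProg hn n6 B6) ?_)
  rintro t7 f7 ⟨p7, p7', p7''⟩
  have N7 : t7.natArr = t6.natArr := by
    funext A
    have h : tgtRestProg.natArrs = [] := by decide
    exact f7.natArr A (by simp [h])
  refine Runs.conseq (runs_weightProg (m := m) (B := B) hn ?_ ?_ ?_ ?_ ?_ ?_) ?_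
  · rw [f7.natReg 0 (by decide), n6]
  · rw [f7.natReg 2 (by decide), m6]
  · rw [f7.natReg 9 (by decide), B6]
  · intro i hi
    rw [p7', p6 i hi, N7, N6]
  · intro j hj
    rw [p7 j hj, N7]
  · rw [p7'', N7]
  intro t8 f8 p8
  rw [N7, N6] at p8
  have hfin := hv.isApproxOTKernel hn hB1 hm (by rw [ε4]; exact hε.le) hsrc hT c4 J
    (fun a => nearestIndex_nearest hn S _) (fun i hi => by rw [k4 i hi]) (by rw [ε4]; exact hDB)
  have hplan : ∀ i < n, ∀ j, plan n B m (t5.natArr 0 0) (fun i j => t5.natArr 4 (i + 1) j) i j =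
      plan n B m (hits J) (fun i j => t5.auction.count (i + 1) j) i j := by
    intro i hi j
    have : t5.natArr 0 0 i = hits J i := by rw [k5, k4 i hi]
    unfold plan srcRest
    rw [this]
    rfl
  have p8' : ∀ i < n, ∀ j < n, t8.realArr 6 i j =
      plan n B m (hits J) (fun i j => t5.auction.count (i + 1) j) i j * m / hits J i := by
    intro i hi j hj
    rw [p8 i hi j hj, hplan i hi, k5, k4 i hi]
  have keep : ∀ r, r = 0 ∨ r = 1 → t8.natReg r = t4.natReg r := by
    rintro r (rfl | rfl) <;>
    rw [f8.natReg _ (by decide), f7.natReg _ (by decide), f6.natReg _ (by decide),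
      f5.natReg _ (by decide)]
  have keepA : ∀ A, A = 0 ∨ A = 1 → t8.realArr A = t4.realArr A := by
    rintro r (rfl | rfl) <;>
    rw [f8.realArr _ (by decide), f7.realArr _ (by decide), f6.realArr _ (by decide),
      f5.realArr _ (by decide)]
  refine ⟨by rw [keep 0 (Or.inl rfl), n4], by rw [keep 1 (Or.inr rfl), d4], ?_,
    by rw [keepA 0 (Or.inl rfl), S4], by rw [keepA 1 (Or.inr rfl), T4], ?_, ?_⟩
  · rw [f8.realReg 3 (by decide), f7.realReg 3 (by decide), f6.realReg 3 (by decide),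
      f5.realReg 3 (by decide), σ4]
  · intro i hi j hj
    rw [p8' i hi j hj]
    have := hfin.1 i hi j hj
    positivity
  · rw [roundedPoints_tapeSeed, rowKernel_congr hn S T fun i j hj => p8' i i.2 j hj]
    have h2 : accuracy n d = 2 * t4.realReg 4 := by rw [ε4]; ring
    rw [h2]
    exact hfin.2

end Train

section RunningTime

variable {n d m : ℕ}

/-- The number of slots per target is `O(√d n ^ (1 / (d + 2)))`. -/
theorem slots_sq_le (hn : 1 ≤ n) (hd : 1 ≤ d) :
    (⌈√d / (accuracy n d / 2)⌉₊ : ℝ) ^ 2 ≤ 9 * (d * (n : ℝ) ^ ((2 : ℝ) / (d + 2))) := by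
  have hn1 : (1 : ℝ) ≤ n := by exact_mod_cast hn
  have hd1 : (1 : ℝ) ≤ √d := Real.one_le_sqrt.2 (by exact_mod_cast hd)
  set y := (n : ℝ) ^ ((1 : ℝ) / (d + 2)) with hy
  have hy1 : 1 ≤ y := Real.one_le_rpow hn1 (by positivity)
  have hacc : accuracy n d = y⁻¹ := by
    rw [accuracy, hy, ← Real.rpow_neg (by positivity)]
    congr 1; ring
  have hy2 : y ^ 2 = (n : ℝ) ^ ((2 : ℝ) / (d + 2)) := by
    rw [hy, ← Real.rpow_natCast, ← Real.rpow_mul (by positivity)]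
    congr 1; push_cast; ring
  have h1 : √d / (accuracy n d / 2) = 2 * (√d * y) := by
    rw [hacc]; field_simp
  have h2 : (⌈√d / (accuracy n d / 2)⌉₊ : ℝ) ≤ 3 * (√d * y) := by
    have h3 := (Nat.ceil_lt_add_one (a := √d / (accuracy n d / 2)) (by rw [h1]; positivity)).le
    rw [h1] at h3
    have h4 : 1 ≤ √d * y := one_le_mul_of_one_le_of_one_le hd1 hy1
    rw [h1]
    linarith
  calc (⌈√d / (accuracy n d / 2)⌉₊ : ℝ) ^ 2 ≤ (3 * (√d * y)) ^ 2 := by gcongr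
    _ = 9 * (√d ^ 2 * y ^ 2) := by ring
    _ = _ := by rw [Real.sq_sqrt (by positivity), hy2]

/-- With exponent `2 + 2 / (d + 2)`, the time of the auction is within the claimed bound. -/
theorem train_time_le (hn : 1 ≤ n) (hd : 1 ≤ d) {t : ℕ}
    (ht : t ≤ 60 + ((180 * (d * m * n) + 40 * n) + (70 * (d * (n * n)) +
        ((12 * ⌈√d / (accuracy n d / 2)⌉₊ + 12) +
          (800 * (n * n * (⌈√d / (accuracy n d / 2)⌉₊ * ⌈√d / (accuracy n d / 2)⌉₊)) +
            (60 * (n * n) + (70 * (n * n) + 70 * (n * n)))))))) :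
    (t : ℝ) ≤ 180 * (d * m * n) + 8000 * (d * (n : ℝ) ^ (2 + (2 : ℝ) / (d + 2))) := by
  have hn1 : (1 : ℝ) ≤ n := by exact_mod_cast hn
  have hd1 : (1 : ℝ) ≤ d := by exact_mod_cast hd
  have hB := slots_sq_le hn hd
  set B := ⌈√d / (accuracy n d / 2)⌉₊ with hBdef
  set Y := (n : ℝ) ^ ((2 : ℝ) / (d + 2)) with hY
  have hY1 : 1 ≤ Y := Real.one_le_rpow hn1 (by positivity)
  have hX : (n : ℝ) ^ (2 + (2 : ℝ) / (d + 2)) = n ^ 2 * Y := by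
    rw [Real.rpow_add (by positivity), hY]; norm_num
  rw [hX]
  have hn2 : (n : ℝ) ≤ n ^ 2 := by nlinarith
  have hdn : (n : ℝ) ^ 2 ≤ d * n ^ 2 := le_mul_of_one_le_left (by positivity) hd1
  have h1 : (d : ℝ) * n ^ 2 ≤ d * (n ^ 2 * Y) := by
    gcongr
    exact le_mul_of_one_le_right (by positivity) hY1
  have h2 : (n : ℝ) ^ 2 * (B : ℝ) ^ 2 ≤ 9 * (d * (n ^ 2 * Y)) := by
    calc (n : ℝ) ^ 2 * (B : ℝ) ^ 2 ≤ n ^ 2 * (9 * (d * Y)) := by gcongr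
      _ = _ := by ring
  have h3 : (B : ℝ) ≤ n ^ 2 * (B : ℝ) ^ 2 := by
    have e1 : (B : ℝ) ≤ (B : ℝ) ^ 2 := by
      exact_mod_cast Nat.le_self_pow two_ne_zero B
    have e2 : (B : ℝ) ^ 2 ≤ n ^ 2 * (B : ℝ) ^ 2 :=
      le_mul_of_one_le_left (by positivity) (by nlinarith)
    exact e1.trans e2
  have ht' : (t : ℝ) ≤ 60 + ((180 * (d * m * n) + 40 * n) + (70 * (d * (n * n)) +
        ((12 * (B : ℝ) + 12) + (800 * (n * n * (B * B)) +
            (60 * (n * n) + (70 * (n * n) + 70 * (n * n))))))) := by exact_mod_cast ht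
  have e1 : (n : ℝ) * n = n ^ 2 := by ring
  have e2 : (B : ℝ) * B = (B : ℝ) ^ 2 := by ring
  rw [e1, e2] at ht'
  linarith

/-- The exponents match: `(d + 4) / (d + 2) + 1 = 2 + 2 / (d + 2)`. -/
theorem roundingSize_mul_le (hn : 1 ≤ n) :
    (d : ℝ) * roundingSize n d * n ≤ 2 * (d * (n : ℝ) ^ (2 + (2 : ℝ) / (d + 2))) := by
  have hn1 : (1 : ℝ) ≤ n := by exact_mod_cast hn
  have h1 : (1 : ℝ) ≤ (n : ℝ) ^ (((d : ℝ) + 4) / (d + 2)) := Real.one_le_rpow hn1 (by positivity)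
  have h2 : (roundingSize n d : ℝ) ≤ 2 * (n : ℝ) ^ (((d : ℝ) + 4) / (d + 2)) := by
    have := (Nat.ceil_lt_add_one (a := (n : ℝ) ^ (((d : ℝ) + 4) / (d + 2))) (by positivity)).le
    rw [roundingSize]
    linarith
  have h3 : (n : ℝ) ^ (2 + (2 : ℝ) / (d + 2)) = (n : ℝ) ^ (((d : ℝ) + 4) / (d + 2)) * n := by
    rw [← Real.rpow_add_one (by positivity)]
    congr 1
    field_simp
    ring
  rw [h3]
  calc (d : ℝ) * roundingSize n d * n ≤ d * (2 * (n : ℝ) ^ (((d : ℝ) + 4) / (d + 2))) * n := by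
        gcongr
    _ = _ := by ring

theorem maxDist_nonneg (S T : Fin n → Pt d) : 0 ≤ maxDist S T :=
  Real.iSup_nonneg fun _ => norm_nonneg _

theorem tendsto_two_div : Tendsto (fun d : ℕ => (2 : ℝ) / (d + 2)) atTop (𝓝 0) :=
  tendsto_const_nhds.div_atTop
    (tendsto_atTop_add_const_right _ _ tendsto_natCast_atTop_atTop)

end RunningTime

end StochasticOT

theorem theorem5 :
    -- the risk bound, for every admissible solver
    (∃ (C : ℝ) (K : ℕ → ℝ), ∀ (n d m : ℕ) (ρ ε c : ℝ), 1 ≤ n → 1 ≤ d →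
      (n : ℝ) ^ (((d : ℝ) + 4) / (d + 2)) ≤ m → 0 ≤ ρ → 0 ≤ ε → ε ≤ 1 → 0 < c →
      ∀ (μ ν : Measure (Pt d)), IsProbabilityMeasure μ → IsProbabilityMeasure ν →
      IsOneSubGaussian μ → (∀ᵐ y ∂ν, y ∈ unitCube d) →
      ∀ (Ω : Type*) (_ : MeasurableSpace Ω) (P : Measure Ω), IsProbabilityMeasure P →
      ∀ (X Y X' Y' : Fin n → Ω → Pt d) (seed : Ω → Seed n d m)
        (κbar : Ω → Kernel (Pt d) (Pt d)),
      (∀ i, Measurable (X i)) → (∀ i, Measurable (Y i)) →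
      (∀ i, Measurable (X' i)) → (∀ i, Measurable (Y' i)) → Measurable seed →
      iIndepFun X P → (∀ i, P.map (X i) = μ) →
      iIndepFun Y P → (∀ i, P.map (Y i) = ν) →
      (∀ᵐ ω ∂P, IsCorruption ρ ε (fun i => X i ω) (fun i => X' i ω)) →
      (∀ᵐ ω ∂P, IsCorruption ρ ε (fun i => Y i ω) (fun i => Y' i ω)) →
      (∀ᵐ ω ∂P, ∀ i, Y' i ω ∈ unitCube d) →
      P.map seed = seedLaw n d m →
      IndepFun (fun ω => ((fun i => X i ω, fun i => Y i ω), (fun i => X' i ω, fun i => Y' i ω)))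
        seed P →
      (∀ᵐ ω ∂P, IsApproxOTKernel
        (roundedPoints (fun i => X' i ω) (bandwidth n d ρ c) (seed ω)) (fun i => Y' i ω)
        (accuracy n d) (κbar ω)) →
      outerExpectation P (fun ω =>
          transportError (outputKernel (fun i => X' i ω) (bandwidth n d ρ c) (κbar ω)) μ ν) ≤
        ENNReal.ofReal (C * min
          (√d * ε + max c c⁻¹ * √d * √ρ + ρ + K d * (n : ℝ) ^ (-(1 : ℝ) / (d + 2))) √d)) ∧
    -- the implementation, its running time, and the evaluation of its output
    (∃ (train evaluate : Prog) (K : ℝ) (e : ℕ → ℝ), Tendsto e atTop (𝓝 0) ∧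
      ∀ (n d m : ℕ) (ρ ε c : ℝ), 1 ≤ n → 1 ≤ d → 1 ≤ m → 0 ≤ ρ → 0 ≤ ε → ε ≤ 1 → 0 < c →
      ∀ (S T : Fin n → Pt d), (∀ j, T j ∈ unitCube d) →
      ∃ seed : Tape → Seed n d m, MeasurePreserving seed tapeLaw (seedLaw n d m) ∧
        ∀ w : Tape, ∃ (t : ℕ) (s : Store) (κbar : Kernel (Pt d) (Pt d)),
          Exec w train (inputStore m ρ ε c S T) t s ∧
          (t : ℝ) ≤ K * (d * m * n + (maxDist S T + d) * (n : ℝ) ^ (2 + e d)) ∧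
          (m = roundingSize n d → (t : ℝ) ≤ K * ((maxDist S T + d) * (n : ℝ) ^ (2 + e d))) ∧
          IsApproxOTKernel (roundedPoints S (bandwidth n d ρ c) (seed w)) T (accuracy n d) κbar ∧
          Samples evaluate s (outputKernel S (bandwidth n d ρ c) κbar) (K * (n * d))) := by
  refine ⟨⟨128, riskConst, ?_⟩, ?_⟩
  · intro n d m ρ ε c hn hd hm hρ hε _ hc μ ν hμp hνp hμ hν Ω mΩ P hP X Y X' Y' seed κbar hX hY hX'
      _ hseed hXi hXl hYi hYl hXc hYc hcube hlaw hind hκ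
    refine outerExpectation_transportError_le hn hd hm hρ hε hc hμ hν hX hY hX' hseed hXi hXl hYi
      hYl hXc hYc hcube hlaw ?_ hκ
    exact hind.comp (measurable_fst.comp measurable_snd) measurable_id
  · refine ⟨trainProg, evaluateProg, 10000, fun d => (2 : ℝ) / (d + 2), tendsto_two_div, ?_⟩
    intro n d m ρ ε c hn hd hm _ _ _ _ S T hT
    refine ⟨tapeSeed hn d m, measurePreserving_tapeSeed hn d m, fun w => ?_⟩
    obtain ⟨t, s, hexec, ht, h0, h1, h3, hS, hT1, hv, hκ⟩ :=
      runs_trainProg hn hd hm ρ ε c S T hT w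
    have htime := train_time_le hn hd ht
    have hmax := maxDist_nonneg S T
    have hpow : (0 : ℝ) ≤ (n : ℝ) ^ (2 + (2 : ℝ) / (d + 2)) := by positivity
    have hle : (d : ℝ) * (n : ℝ) ^ (2 + (2 : ℝ) / (d + 2)) ≤
        (maxDist S T + d) * (n : ℝ) ^ (2 + (2 : ℝ) / (d + 2)) := by
      gcongr; linarith
    have hdmn : (0 : ℝ) ≤ d * m * n := by positivity
    refine ⟨t, s, _, hexec, ?_, ?_, hκ, ?_⟩
    · have : (0 : ℝ) ≤ d * (n : ℝ) ^ (2 + (2 : ℝ) / (d + 2)) := by positivity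
      linarith
    · rintro rfl
      have h2 := roundingSize_mul_le (d := d) hn
      have : (0 : ℝ) ≤ d * (n : ℝ) ^ (2 + (2 : ℝ) / (d + 2)) := by positivity
      linarith
    · intro x
      obtain ⟨out, hm1, hm2, hout⟩ := samples_evaluateProg hn hd h0 h1 h3 hS hT1 hv x
      refine ⟨out, hm1, hm2, fun w' => ?_⟩
      obtain ⟨t', s', e1, e2, e3⟩ := hout w'
      refine ⟨t', s', e1, e2.trans ?_, e3⟩
      have : (0 : ℝ) ≤ (n : ℝ) * d := by positivity
      linarith
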